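/- **Setting.** Let $G=(V,E)$ be a directed graph on a finite nonempty set $V$ of $K$ arms with $(i,i)\in E$ for all $i$; let $N^{\mathrm{out}}(i)=\{j:(i,j)\in E\}$ and $N^{\mathrm{in}}(i)=\{j:(j,i)\in E\}$. A set $A\subseteq V$ is strongly independent if there are no two distinct $i,j\in A$ with both $(i,j)\in E$ and $(j,i)\in E$; $\mathcal I(G)$ is the collection of all strongly independent sets and $\tilde\alpha$ the maximal size of such a set. At each round $t=1,2,\dots$ the learner plays an arm $I_t$, suffers $\ell_{t,I_t}$ and observes $\ell_{t,j}$ for all $j\in N^{\mathrm{out}}(I_t)$. The loss vectors $\ell_t\in[0,1]^V$ are i.i.d. over the rounds, and $\ell_t$ is independent of everything that happened before round $t$, including the learner's randomness. Put $\mu_i=\mathbb E[\ell_{1,i}]$, $\Delta_i=\mu_i-\min_j\mu_j$, $\Delta_{\min}=\min\{\Delta_i:\Delta_i>0\}$ and $$\mathcal R_T=\mathbb E\Big[\sum_{t=1}^T\ell_{t,I_t}\Big]-\min_{i\in V}\mathbb E\Big[\sum_{t=1}^T\ell_{t,i}\Big].$$ **Algorithm (EXP3.G++)** with $\gamma=4$,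 $\beta=320$, $\lambda=\tilde\alpha$, $\eta_t=\sqrt{\ln K/(2\tilde\alpha t)}$. In the rounds $1,\dots,K$ every arm is played once, in a fixed order. Let $O_{t,i}$ be the number of rounds $s\le t$ with $i\in N^{\mathrm{out}}(I_s)$, $\hat L_{t,i}$ the sum of $\ell_{s,i}$ over these rounds, and $\tilde L_{K,i}=0$. At each round $t>K$: 1. With $w_{t,i}=\sqrt{\gamma\ln(tK^{1/\gamma})/(2O_{t-1,i})}$ put $\mathrm{UCB}_{t,i}=\min\{1,\hat L_{t-1,i}/O_{t-1,i}+w_{t,i}\}$, $\mathrm{LCB}_{t,i}=\max\{0,\hat L_{t-1,i}/O_{t-1,i}-w_{t,i}\}$ and $\hat\Delta_{t,i}=\max\{0,\mathrm{LCB}_{t,i}-\min_j\mathrm{UCB}_{t,j}\}$. 2. Build the exploration set $S_t$: list the arms in ascending order of $\hat\Delta_{t,i}$ (ties are broken in any non-anticipating way); repeatedly add the first remaining arm $i$ to $S_t$ and delete $i$ and $N^{\mathrm{out}}(i)$ from the list, until the list is empty. 3. Put $\varepsilon_{t,i}=\min\Big\{\frac1{2K},\frac12\sqrt{\frac{\lambda\ln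 K}{tK^2}},\xi_{t,i}\Big\}$ with $\xi_{t,i}=\frac{\beta\ln t}{t\hat\Delta_{t,i}^2}$ for $i\in S_t$ ($+\infty$ if $\hat\Delta_{t,i}=0$) and $\xi_{t,i}=\frac4{t^2}$ for $i\notin S_t$. 4. Draw $I_t$, with fresh randomness, from $p_{t,i}=\big(1-\sum_j\varepsilon_{t,j}\big)q_{t,i}+\varepsilon_{t,i}$, where $q_{t,i}=e^{-\eta_t\tilde L_{t-1,i}}\big/\sum_je^{-\eta_t\tilde L_{t-1,j}}$. 5. Put $\tilde L_{t,i}=\tilde L_{t-1,i}+\ell_{t,i}\mathbf 1[i\in N^{\mathrm{out}}(I_t)]/P_{t,i}$ with $P_{t,i}=\sum_{j\in N^{\mathrm{in}}(i)}p_{t,j}$. **Theorem.** For every such graph, every such stochastic loss sequence and every $T\ge1$, $$\mathcal R_T\le\max_{A\in\mathcal I(G)}\Big\{\sum_{i\in A:\,\Delta_i>0}\frac{4\beta(\ln T)^2}{\Delta_i}\Big\}+2\tilde\alpha\ln T+\frac{81\beta K}{\Delta_{\min}^2}\ln\Big(\frac{6\beta^2K^2}{\Delta_{\min}^4}\Big)+\sum_{i:\,\Delta_i>0}\frac{4\tilde\alpha}{\Delta_i},$$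 where the third term is read as $0$ if no arm has $\Delta_i>0$. -/

import Mathlib

open MeasureTheory ProbabilityTheory

namespace FeedbackGraph

/-- Tuning parameters of EXP3.G++: the confidence parameter `γ`, the exploration constants `β`
and `lam`, and the learning rates `η 1, η 2, …`. -/
structure Params where
  γ : ℝ
  β : ℝ
  lam : ℝ
  η : ℕ → ℝ

section Algorithm

/- Rounds are numbered `1, 2, …`.  In this section `a s` is the arm played at round `s` and `x s i`
is the loss of arm `i` at round `s`; playing `i` reveals the losses of all `j` with `G.Adj i j`.
The quantities below read the loss `x s i` only if `G.Adj (a s) i`. -/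

open Classical in
/-- Number of observations of arm `i` during the rounds `1, …, t`. -/
noncomputable def obsCount {V : Type*} (G : Digraph V) (a : ℕ → V) (t : ℕ) (i : V) : ℕ :=
  ((Finset.Icc 1 t).filter (fun s => G.Adj (a s) i)).card

open Classical in
/-- Cumulative observed loss of arm `i` during the rounds `1, …, t`. -/
noncomputable def obsLoss {V : Type*} (G : Digraph V) (a : ℕ → V) (x : ℕ → V → ℝ) (t : ℕ)
    (i : V) : ℝ :=
  ∑ s ∈ (Finset.Icc 1 t).filter (fun s => G.Adj (a s) i), x s i

/-- Width of the confidence interval of arm `i` at round `t`; it uses the rounds before `t`. -/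
noncomputable def confWidth {V : Type*} [Fintype V] (G : Digraph V) (γ : ℝ) (a : ℕ → V) (t : ℕ)
    (i : V) : ℝ :=
  Real.sqrt (γ * Real.log (t * (Fintype.card V : ℝ) ^ (1 / γ)) / (2 * obsCount G a (t - 1) i))

/-- Upper confidence bound of arm `i` at round `t`. -/
noncomputable def ucb {V : Type*} [Fintype V] (G : Digraph V) (γ : ℝ) (a : ℕ → V)
    (x : ℕ → V → ℝ) (t : ℕ) (i : V) : ℝ :=
  min 1 (obsLoss G a x (t - 1) i / obsCount G a (t - 1) i + confWidth G γ a t i)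

/-- Lower confidence bound of arm `i` at round `t`. -/
noncomputable def lcb {V : Type*} [Fintype V] (G : Digraph V) (γ : ℝ) (a : ℕ → V)
    (x : ℕ → V → ℝ) (t : ℕ) (i : V) : ℝ :=
  max 0 (obsLoss G a x (t - 1) i / obsCount G a (t - 1) i - confWidth G γ a t i)

/-- Estimate of the suboptimality gap of arm `i` at round `t`. -/
noncomputable def gapEst {V : Type*} [Fintype V] (G : Digraph V) (γ : ℝ) (a : ℕ → V)
    (x : ℕ → V → ℝ) (t : ℕ) (i : V) : ℝ :=
  max 0 (lcb G γ a x t i - ⨅ j : V, ucb G γ a x t j)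

open Classical in
/-- Greedy scan of a list of arms: take the first remaining arm and delete all the arms of its
out-neighbourhood from the rest of the list. -/
noncomputable def greedy {V : Type*} (G : Digraph V) : List V → Finset V
  | [] => ∅
  | i :: rest => insert i (greedy G (rest.filter (fun j => ¬ G.Adj i j)))
termination_by l => l.length
decreasing_by
  simp only [List.length_unattach, List.length_cons]
  exact Nat.lt_succ_of_le ((List.length_filter_le _ _).trans_eq List.length_attach)

/-- `S` is a possible output of the exploration set construction for the gap estimates `d`: the
result of the greedy scan of the list of all arms, sorted in ascending order of `d` (with ties
ordered in any way). -/
def IsExplorationSet {V : Type*} (G : Digraph V) (d : V → ℝ) (S : Finset V) : Prop :=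
  ∃ l : List V, l.Nodup ∧ (∀ i, i ∈ l) ∧ l.Pairwise (fun i j => d i ≤ d j) ∧ S = greedy G l

open Classical in
/-- Exploration rate of arm `i` at round `t`, for gap estimates `d` and exploration set `S`.  The
bound `β ln t / (t (d i)²)` is `+∞` if `d i = 0`, and then it does not enter the minimum. -/
noncomputable def explRate {V : Type*} [Fintype V] (β lam : ℝ) (d : V → ℝ) (S : Finset V) (t : ℕ)
    (i : V) : ℝ :=
  let K : ℝ := Fintype.card V
  let c : ℝ := min (1 / (2 * K)) (1 / 2 * Real.sqrt (lam * Real.log K / (t * K ^ 2)))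
  if i ∈ S then
    if d i = 0 then c else min c (β * Real.log t / (t * d i ^ 2))
  else min c (4 / (t : ℝ) ^ 2)

/-- Exponential weight of arm `i` for the learning rate `η` and the estimated cumulative losses
`L`. -/
noncomputable def expWeight {V : Type*} [Fintype V] (η : ℝ) (L : V → ℝ) (i : V) : ℝ :=
  Real.exp (-η * L i) / ∑ j, Real.exp (-η * L j)

/-- Exponential weights mixed with the exploration rates `ε`. -/
noncomputable def mixedProb {V : Type*} [Fintype V] (η : ℝ) (ε L : V → ℝ) (i : V) : ℝ :=
  (1 - ∑ j, ε j) * expWeight η L i + ε i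

open Classical in
/-- Probability that arm `i` is observed if the played arm has law `p`. -/
noncomputable def obsProb {V : Type*} [Fintype V] (G : Digraph V) (p : V → ℝ) (i : V) : ℝ :=
  ∑ j ∈ Finset.univ.filter (fun j => G.Adj j i), p j

/-- Exploration rates at round `t`, with `S s` the exploration set of round `s`. -/
noncomputable def roundRate {V : Type*} [Fintype V] (G : Digraph V) (prm : Params) (a : ℕ → V)
    (x : ℕ → V → ℝ) (S : ℕ → Finset V) (t : ℕ) : V → ℝ :=
  explRate prm.β prm.lam (gapEst G prm.γ a x t) (S t) t

open Classical in
/-- Importance-weighted cumulative loss estimates after round `t`.  They are `0` until the end of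
the initial rounds `1, …, K`. -/
noncomputable def estLoss {V : Type*} [Fintype V] (G : Digraph V) (prm : Params) (a : ℕ → V)
    (x : ℕ → V → ℝ) (S : ℕ → Finset V) : ℕ → V → ℝ
  | 0 => fun _ => 0
  | t + 1 => fun i =>
    if Fintype.card V < t + 1 then
      estLoss G prm a x S t i +
        if G.Adj (a (t + 1)) i then
          x (t + 1) i /
            obsProb G (mixedProb (prm.η (t + 1)) (roundRate G prm a x S (t + 1))
              (estLoss G prm a x S t)) i
        else 0
    else 0

/-- Probability with which EXP3.G++ plays arm `i` at a round `t > K`. -/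
noncomputable def playProb {V : Type*} [Fintype V] (G : Digraph V) (prm : Params) (a : ℕ → V)
    (x : ℕ → V → ℝ) (S : ℕ → Finset V) (t : ℕ) : V → ℝ :=
  mixedProb (prm.η t) (roundRate G prm a x S t) (estLoss G prm a x S (t - 1))

end Algorithm

/-- Stochastic losses: `loss t ω i ∈ [0,1]` is the loss of arm `i` at round `t ≥ 1`; the loss
vectors of the rounds are independent and identically distributed, and the loss vector of a round
is independent of the past `𝓕` (which also records the randomness of the learner).  Nothing is
assumed on the dependence between the losses of different arms in the same round. -/
structure IsStochasticLoss {V Ω : Type*} {mΩ : MeasurableSpace Ω} (P : Measure Ω)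
    (𝓕 : Filtration ℕ mΩ) (loss : ℕ → Ω → V → ℝ) : Prop where
  adapted : ∀ t, 1 ≤ t → Measurable[𝓕 t] (loss t)
  mem_Icc : ∀ t, 1 ≤ t → ∀ ω i, loss t ω i ∈ Set.Icc (0 : ℝ) 1
  indep_past : ∀ t, Indep (MeasurableSpace.comap (loss (t + 1)) inferInstance) (𝓕 t) P
  identDistrib : ∀ t, 1 ≤ t → IdentDistrib (loss t) (loss 1) P P

/-- The arms `arm 1, arm 2, …` are played by EXP3.G++ on the graph `G` with parameters `prm`, and
`S t` is the exploration set of round `t > K`.  `𝓕 t` is the information up to the end of round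
`t`.  The first `K` rounds play each arm once, in a fixed order.  At a round `t + 1 > K` the
exploration set is built from the gap estimates without looking ahead, and the arm is drawn from
`playProb` with fresh randomness: this is its conditional law given the past and the losses of
that round. -/
structure IsRun {V Ω : Type*} [Fintype V] {mΩ : MeasurableSpace Ω} (G : Digraph V) (prm : Params)
    (P : Measure Ω) (𝓕 : Filtration ℕ mΩ) (loss : ℕ → Ω → V → ℝ) (arm : ℕ → Ω → V)
    (S : ℕ → Ω → Finset V) : Prop where
  arm_adapted : ∀ t, 1 ≤ t → ∀ i, MeasurableSet[𝓕 t] {ω | arm t ω = i}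
  initial : ∃ σ : ℕ → V, Set.BijOn σ (Set.Icc 1 (Fintype.card V)) Set.univ ∧
    ∀ t ∈ Set.Icc 1 (Fintype.card V), ∀ ω, arm t ω = σ t
  expl_predictable : ∀ t, Fintype.card V ≤ t → ∀ s, MeasurableSet[𝓕 t] {ω | S (t + 1) ω = s}
  expl_greedy : ∀ t, Fintype.card V ≤ t → ∀ ω,
    IsExplorationSet G (gapEst G prm.γ (fun s => arm s ω) (fun s => loss s ω) (t + 1))
      (S (t + 1) ω)
  sampling : ∀ t, Fintype.card V ≤ t → ∀ i,
    P[Set.indicator {ω | arm (t + 1) ω = i} (fun _ => (1 : ℝ)) |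
        𝓕 t ⊔ MeasurableSpace.comap (loss (t + 1)) inferInstance]
      =ᵐ[P] fun ω =>
        playProb G prm (fun s => arm s ω) (fun s => loss s ω) (fun s => S s ω) (t + 1) i

/-- Pseudo-regret after `T` rounds. -/
noncomputable def pseudoRegret {V Ω : Type*} {mΩ : MeasurableSpace Ω} (P : Measure Ω)
    (loss : ℕ → Ω → V → ℝ) (arm : ℕ → Ω → V) (T : ℕ) : ℝ :=
  (∫ ω, ∑ t ∈ Finset.Icc 1 T, loss t ω (arm t ω) ∂P) -
    ⨅ i : V, ∫ ω, ∑ t ∈ Finset.Icc 1 T, loss t ω i ∂P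

/-- Suboptimality gap of arm `i`. -/
noncomputable def gap {V Ω : Type*} {mΩ : MeasurableSpace Ω} (P : Measure Ω)
    (loss : ℕ → Ω → V → ℝ) (i : V) : ℝ :=
  (∫ ω, loss 1 ω i ∂P) - ⨅ j : V, ∫ ω, loss 1 ω j ∂P

/-- Smallest positive suboptimality gap.  If all arms are optimal this is the infimum of an empty
family, with value `0`. -/
noncomputable def gapMin {V Ω : Type*} {mΩ : MeasurableSpace Ω} (P : Measure Ω)
    (loss : ℕ → Ω → V → ℝ) : ℝ :=
  ⨅ i : {i : V // 0 < gap P loss i}, gap P loss i.1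

/-- Strong independence number: the independence number of the graph of the bidirectional edges
(without loops). -/
noncomputable def strongIndepNum {V : Type*} (G : Digraph V) : ℕ :=
  G.toSimpleGraphStrict.indepNum

/-- The collection of all strongly independent sets. -/
def StrongIndepSets {V : Type*} (G : Digraph V) : Set (Finset V) :=
  {A | G.toSimpleGraphStrict.IsIndepSet (A : Set V)}

/-- The parameters `γ = 4`, `β = 320`, `λ = α̃` and `η t = √(ln K / (2 α̃ t))`, where `α̃` is the
strong independence number of `G`. -/
noncomputable def tuning {V : Type*} [Fintype V] (G : Digraph V) : Params where
  γ := 4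
  β := 320
  lam := strongIndepNum G
  η := fun t => Real.sqrt (Real.log (Fintype.card V) / (2 * strongIndepNum G * t))

end FeedbackGraph

namespace FeedbackGraph

theorem mem_strongIndepSets {V : Type*} {G : Digraph V} {A : Finset V} :
    A ∈ StrongIndepSets G ↔ ∀ i ∈ A, ∀ j ∈ A, i ≠ j → G.Adj i j → ¬ G.Adj j i := by
  simp only [StrongIndepSets, Set.mem_ofPred_eq, SimpleGraph.IsIndepSet, Set.Pairwise,
    Digraph.toSimpleGraphStrict, Finset.mem_coe]
  grind

theorem card_le_strongIndepNum {V : Type*} [Fintype V] {G : Digraph V} {A : Finset V}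
    (hA : A ∈ StrongIndepSets G) : A.card ≤ strongIndepNum G :=
  SimpleGraph.IsIndepSet.card_le_indepNum hA

theorem one_le_strongIndepNum {V : Type*} [Fintype V] [Nonempty V] (G : Digraph V) :
    1 ≤ strongIndepNum G := by
  obtain ⟨i⟩ := ‹Nonempty V›
  have : ({i} : Finset V) ∈ StrongIndepSets G := by
    rw [mem_strongIndepSets]; grind
  simpa using card_le_strongIndepNum this

theorem strongIndepNum_le_card {V : Type*} [Fintype V] (G : Digraph V) :
    strongIndepNum G ≤ Fintype.card V := by
  obtain ⟨s, hs⟩ := G.toSimpleGraphStrict.exists_isNIndepSet_indepNum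
  rw [strongIndepNum, ← hs.card_eq]
  exact Finset.card_le_univ s

theorem greedy_cons {V : Type*} (G : Digraph V) (i : V) (l : List V) :
    ∃ l' : List V, l'.Sublist l ∧ (∀ j, j ∈ l' ↔ j ∈ l ∧ ¬ G.Adj i j) ∧
      ∀ j, j ∈ greedy G (i :: l) ↔ j = i ∨ j ∈ greedy G l' := by
  classical
  refine ⟨l.filter (fun j => ¬ G.Adj i j), List.filter_sublist, by simp, ?_⟩
  intro j
  rw [greedy, Finset.mem_insert]

theorem greedy_spec {V : Type*} {G : Digraph V} (hloop : ∀ i, G.Adj i i) (d : V → ℝ) (n : ℕ) :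
    ∀ l : List V, l.length ≤ n → l.Pairwise (fun i j => d i ≤ d j) →
      (∀ i ∈ greedy G l, i ∈ l) ∧ greedy G l ∈ StrongIndepSets G ∧
      ∀ i ∈ l, ∃ j ∈ greedy G l, G.Adj j i ∧ d j ≤ d i := by
  induction n with
  | zero =>
    intro l hl _
    obtain rfl : l = [] := List.length_eq_zero_iff.1 (by omega)
    simp [greedy, mem_strongIndepSets]
  | succ n ih =>
    intro l hl hp
    cases l with
    | nil => simp [greedy, mem_strongIndepSets]
    | cons i l =>
      obtain ⟨l', hsub, hmem, hg⟩ := greedy_cons G i l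
      rw [List.pairwise_cons] at hp
      obtain ⟨h1, h2, h3⟩ := ih l' (by have := hsub.length_le; simp at hl; omega)
        (hp.2.sublist hsub)
      rw [mem_strongIndepSets] at h2 ⊢
      refine ⟨?_, ?_, ?_⟩
      · intro j hj
        rcases (hg j).1 hj with rfl | hj
        · simp
        · exact List.mem_cons_of_mem _ (hsub.subset (h1 j hj))
      · intro a ha b hb hab h
        rcases (hg a).1 ha with ha' | ha' <;> rcases (hg b).1 hb with hb' | hb'
        · exact absurd (ha'.trans hb'.symm) hab
        · exact absurd (ha' ▸ h) ((hmem b).1 (h1 b hb')).2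
        · exact hb' ▸ ((hmem a).1 (h1 a ha')).2
        · exact h2 a ha' b hb' hab h
      · intro j hj
        by_cases hij : G.Adj i j
        · refine ⟨i, (hg i).2 (Or.inl rfl), hij, ?_⟩
          rcases List.mem_cons.1 hj with rfl | hj
          · exact le_rfl
          · exact hp.1 j hj
        · have hjl : j ∈ l := by
            rcases List.mem_cons.1 hj with rfl | hj
            · exact absurd (hloop j) hij
            · exact hj
          obtain ⟨k, hk, hk'⟩ := h3 j ((hmem j).2 ⟨hjl, hij⟩)
          exact ⟨k, (hg k).2 (Or.inr hk), hk'⟩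

theorem IsExplorationSet.mem_strongIndepSets {V : Type*} {G : Digraph V}
    (hloop : ∀ i, G.Adj i i) {d : V → ℝ} {S : Finset V} (h : IsExplorationSet G d S) :
    S ∈ StrongIndepSets G := by
  obtain ⟨l, -, -, hp, rfl⟩ := h
  exact (greedy_spec hloop d _ l le_rfl hp).2.1

theorem IsExplorationSet.exists_adj {V : Type*} {G : Digraph V}
    (hloop : ∀ i, G.Adj i i) {d : V → ℝ} {S : Finset V} (h : IsExplorationSet G d S) (i : V) :
    ∃ j ∈ S, G.Adj j i ∧ d j ≤ d i := by
  obtain ⟨l, -, hm, hp, rfl⟩ := h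
  exact (greedy_spec hloop d _ l le_rfl hp).2.2 i (hm i)

open Classical in
theorem exists_strongIndep_sum_div_le {V : Type*} {G : Digraph V} (hloop : ∀ i, G.Adj i i)
    {q : V → ℝ} (hq : ∀ i, 0 < q i) (n : ℕ) : ∀ U : Finset V, U.card ≤ n →
    ∃ A ⊆ U, A ∈ StrongIndepSets G ∧
      ∑ i ∈ U, q i / ∑ j ∈ U with G.Adj j i, q j ≤ A.card := by
  induction n with
  | zero =>
    intro U hU
    obtain rfl : U = ∅ := Finset.card_eq_zero.1 (by omega)
    exact ⟨∅, by simp, by simp [mem_strongIndepSets], by simp⟩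
  | succ n ih =>
    intro U hU
    rcases U.eq_empty_or_nonempty with rfl | hne
    · exact ⟨∅, by simp, by simp [mem_strongIndepSets], by simp⟩
    set Q : V → ℝ := fun i => ∑ j ∈ U with G.Adj j i, q j with hQ
    have hQpos : ∀ i ∈ U, 0 < Q i := fun i hi =>
      Finset.sum_pos (fun j _ => hq j) ⟨i, by simp [hi, hloop]⟩
    obtain ⟨i, hiU, hi⟩ := U.exists_min_image Q hne
    set U' := U.filter (fun j => ¬ G.Adj j i) with hU'
    have hcard : U'.card < U.card :=
      Finset.card_lt_card (Finset.filter_ssubset.2 ⟨i, hiU, by simp [hloop]⟩)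
    obtain ⟨A, hAU, hA, hsum⟩ := ih U' (by omega)
    have hiA : i ∉ A := fun h => by simpa [hU', hloop] using hAU h
    refine ⟨insert i A, ?_, ?_, ?_⟩
    · exact Finset.insert_subset hiU (hAU.trans (Finset.filter_subset _ _))
    · rw [mem_strongIndepSets] at hA ⊢
      intro a ha b hb hab h
      rcases Finset.mem_insert.1 ha with ha' | ha' <;> rcases Finset.mem_insert.1 hb with hb' | hb'
      · exact absurd (ha'.trans hb'.symm) hab
      · exact ha' ▸ (Finset.mem_filter.1 (hAU hb')).2
      · exact absurd (hb' ▸ h) (Finset.mem_filter.1 (hAU ha')).2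
      · exact hA a ha' b hb' hab h
    · rw [Finset.card_insert_of_notMem hiA, ← Finset.sum_filter_add_sum_filter_not U
        (fun j => G.Adj j i)]
      push_cast
      rw [add_comm (A.card : ℝ)]
      refine add_le_add ?_ ?_
      · calc ∑ j ∈ U with G.Adj j i, q j / Q j
            ≤ ∑ j ∈ U with G.Adj j i, q j / Q i := by
              refine Finset.sum_le_sum fun j hj => ?_
              have hj' := (Finset.mem_filter.1 hj).1
              exact div_le_div_of_nonneg_left (hq j).le (hQpos i hiU) (hi j hj')
          _ = 1 := by
              rw [← Finset.sum_div]
              exact div_self (hQpos i hiU).ne'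
      · refine le_trans (Finset.sum_le_sum fun j hj => ?_) hsum
        refine div_le_div_of_nonneg_left (hq j).le
          (Finset.sum_pos (fun k _ => hq k) ⟨j, Finset.mem_filter.2 ⟨hj, hloop j⟩⟩) ?_
        exact Finset.sum_le_sum_of_subset_of_nonneg
          (Finset.filter_subset_filter _ (Finset.filter_subset _ _)) (fun k _ _ => (hq k).le)

theorem sum_div_obsProb_le {V : Type*} [Fintype V] {G : Digraph V} (hloop : ∀ i, G.Adj i i)
    {q : V → ℝ} (hq : ∀ i, 0 < q i) : ∑ i, q i / obsProb G q i ≤ strongIndepNum G := by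
  obtain ⟨A, -, hA, h⟩ := exists_strongIndep_sum_div_le hloop hq _ Finset.univ le_rfl
  exact h.trans (by exact_mod_cast card_le_strongIndepNum hA)

section Distribution

variable {V : Type*} [Fintype V]

theorem expWeight_pos [Nonempty V] (η : ℝ) (L : V → ℝ) (i : V) : 0 < expWeight η L i :=
  div_pos (Real.exp_pos _) (Finset.sum_pos (fun _ _ => Real.exp_pos _) Finset.univ_nonempty)

theorem sum_expWeight [Nonempty V] (η : ℝ) (L : V → ℝ) : ∑ i, expWeight η L i = 1 := by
  simp only [expWeight]
  rw [← Finset.sum_div]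
  exact div_self (Finset.sum_pos (fun _ _ => Real.exp_pos _) Finset.univ_nonempty).ne'

theorem expWeight_le_exp (η : ℝ) (L : V → ℝ) (i j : V) :
    expWeight η L i ≤ Real.exp (-(η * (L i - L j))) := by
  have h : Real.exp (-η * L j) ≤ ∑ k, Real.exp (-η * L k) :=
    Finset.single_le_sum (f := fun k => Real.exp (-η * L k))
      (fun k _ => (Real.exp_pos _).le) (Finset.mem_univ j)
  calc expWeight η L i ≤ Real.exp (-η * L i) / Real.exp (-η * L j) :=
        div_le_div_of_nonneg_left (Real.exp_pos _).le (Real.exp_pos _) h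
    _ = _ := by rw [← Real.exp_sub]; congr 1; ring

theorem sum_mixedProb [Nonempty V] (η : ℝ) (ε L : V → ℝ) : ∑ i, mixedProb η ε L i = 1 := by
  simp only [mixedProb, Finset.sum_add_distrib, ← Finset.mul_sum, sum_expWeight]
  ring

theorem obsProb_mono {G : Digraph V} {p p' : V → ℝ} (h : ∀ j, p j ≤ p' j) (i : V) :
    obsProb G p i ≤ obsProb G p' i :=
  Finset.sum_le_sum fun j _ => h j

theorem le_obsProb {G : Digraph V} {p : V → ℝ} (hp : ∀ j, 0 ≤ p j) {i j : V} (h : G.Adj j i) :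
    p j ≤ obsProb G p i := by
  classical
  exact Finset.single_le_sum (f := p) (fun k _ => hp k) (by simp [h])

theorem obsProb_const_mul {G : Digraph V} (c : ℝ) (p : V → ℝ) (i : V) :
    obsProb G (fun j => c * p j) i = c * obsProb G p i := by
  simp [obsProb, Finset.mul_sum]

variable {ε : V → ℝ}

theorem half_expWeight_le_mixedProb [Nonempty V] (hε : ∀ i, 0 ≤ ε i) (hs : ∑ i, ε i ≤ 1 / 2)
    (η : ℝ) (L : V → ℝ) (i : V) : 1 / 2 * expWeight η L i ≤ mixedProb η ε L i := by
  have := expWeight_pos η L i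
  have := hε i
  unfold mixedProb
  nlinarith

theorem le_mixedProb [Nonempty V] (hs : ∑ i, ε i ≤ 1 / 2)
    (η : ℝ) (L : V → ℝ) (i : V) : ε i ≤ mixedProb η ε L i := by
  have := expWeight_pos η L i
  unfold mixedProb
  nlinarith

theorem mixedProb_le [Nonempty V] (hε : ∀ i, 0 ≤ ε i)
    (η : ℝ) (L : V → ℝ) (i : V) : mixedProb η ε L i ≤ expWeight η L i + ε i := by
  have := expWeight_pos η L i
  have := Finset.sum_nonneg fun i (_ : i ∈ Finset.univ) => hε i
  unfold mixedProb
  nlinarith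

theorem sum_expWeight_div_obsProb_le [Nonempty V] {G : Digraph V} (hloop : ∀ i, G.Adj i i)
    (hε : ∀ i, 0 ≤ ε i) (hs : ∑ i, ε i ≤ 1 / 2) (η : ℝ) (L : V → ℝ) :
    ∑ i, expWeight η L i / obsProb G (mixedProb η ε L) i ≤ 2 * strongIndepNum G := by
  calc _ ≤ ∑ i, 2 * (expWeight η L i / obsProb G (expWeight η L) i) :=
        Finset.sum_le_sum fun i _ => ?_
    _ ≤ _ := by
        rw [← Finset.mul_sum]
        exact mul_le_mul_of_nonneg_left (sum_div_obsProb_le hloop (expWeight_pos η L)) zero_le_two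
  · have hq := expWeight_pos η L
    have h1 : obsProb G (fun j => 1 / 2 * expWeight η L j) i
        ≤ obsProb G (mixedProb η ε L) i :=
      obsProb_mono (half_expWeight_le_mixedProb hε hs η L) i
    rw [obsProb_const_mul] at h1
    have h2 : 0 < obsProb G (expWeight η L) i :=
      (hq i).trans_le (le_obsProb (fun j => (hq j).le) (hloop i))
    calc _ ≤ expWeight η L i / (1 / 2 * obsProb G (expWeight η L) i) :=
          div_le_div_of_nonneg_left (hq i).le (by positivity) h1
      _ = _ := by field_simp

end Distribution

section Hedge

variable {V : Type*} [Fintype V] [Nonempty V]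

/-- Normalised log-partition function of the exponential weights. -/
noncomputable def potential (η : ℝ) (L : V → ℝ) : ℝ :=
  1 / η * Real.log (∑ i, 1 / (Fintype.card V : ℝ) * Real.exp (-η * L i))

theorem potential_mono {a b : ℝ} (ha : 0 < a) (hab : a ≤ b) (L : V → ℝ) :
    potential a L ≤ potential b L := by
  have hb : 0 < b := ha.trans_le hab
  have hK : (0 : ℝ) < Fintype.card V := by exact_mod_cast Fintype.card_pos
  have key := Real.rpow_arith_mean_le_arith_mean_rpow (Finset.univ : Finset V)
    (fun _ => 1 / (Fintype.card V : ℝ)) (fun i => Real.exp (-a * L i)) (fun _ _ => by positivity)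
    (by simp) (fun _ _ => (Real.exp_pos _).le) (p := b / a) ((one_le_div ha).2 hab)
  have h1 : 0 < ∑ i, 1 / (Fintype.card V : ℝ) * Real.exp (-a * L i) :=
    Finset.sum_pos (fun _ _ => by positivity) Finset.univ_nonempty
  have h2 : ∀ i, Real.exp (-a * L i) ^ (b / a) = Real.exp (-b * L i) := fun i => by
    rw [← Real.exp_mul]; congr 1; field_simp
  simp only [h2] at key
  have := Real.log_le_log (Real.rpow_pos_of_pos h1 _) key
  rw [Real.log_rpow h1] at this
  unfold potential
  calc _ = 1 / b * (b / a * Real.log (∑ i, 1 / (Fintype.card V : ℝ) * Real.exp (-a * L i))) := by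
        field_simp
    _ ≤ _ := by gcongr

theorem exp_neg_le_quadratic {x : ℝ} (hx : 0 ≤ x) : Real.exp (-x) ≤ 1 - x + x ^ 2 / 2 := by
  have hu : 0 < 1 + x + x ^ 2 / 2 := by positivity
  have h := Real.quadratic_le_exp_of_nonneg hx
  rw [Real.exp_neg]
  calc (Real.exp x)⁻¹ ≤ (1 + x + x ^ 2 / 2)⁻¹ := inv_anti₀ hu h
    _ ≤ 1 - x + x ^ 2 / 2 := by
      rw [inv_le_iff_one_le_mul₀ hu]
      nlinarith [sq_nonneg (x ^ 2)]

theorem potential_add_le {η : ℝ} (hη : 0 < η) (L l : V → ℝ) (hl : ∀ i, 0 ≤ l i) :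
    potential η (fun i => L i + l i) ≤ potential η L - (∑ i, expWeight η L i * l i
      - η / 2 * ∑ i, expWeight η L i * l i ^ 2) := by
  have hK : (0 : ℝ) < Fintype.card V := by exact_mod_cast Fintype.card_pos
  set D := ∑ i, Real.exp (-η * L i) with hD
  have hDpos : 0 < D := Finset.sum_pos (fun _ _ => Real.exp_pos _) Finset.univ_nonempty
  have h1 : ∑ i, 1 / (Fintype.card V : ℝ) * Real.exp (-η * (L i + l i))
      = (∑ i, 1 / (Fintype.card V : ℝ) * Real.exp (-η * L i)) *
        ∑ i, expWeight η L i * Real.exp (-(η * l i)) := by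
    simp only [expWeight, ← Finset.mul_sum, ← hD]
    rw [mul_assoc, Finset.mul_sum (a := D)]
    congr 1
    refine Finset.sum_congr rfl fun i _ => ?_
    rw [div_mul_eq_mul_div, mul_div_cancel₀ _ hDpos.ne', ← Real.exp_add]
    congr 1; ring
  have hq := expWeight_pos η L
  have h2 : ∑ i, expWeight η L i * Real.exp (-(η * l i))
      ≤ 1 - (η * ∑ i, expWeight η L i * l i - η ^ 2 / 2 * ∑ i, expWeight η L i * l i ^ 2) := by
    rw [← sum_expWeight η L, Finset.mul_sum, Finset.mul_sum, ← Finset.sum_sub_distrib,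
      ← Finset.sum_sub_distrib]
    refine Finset.sum_le_sum fun i _ => ?_
    have := mul_le_mul_of_nonneg_left (exp_neg_le_quadratic (mul_nonneg hη.le (hl i))) (hq i).le
    linarith
  have h3 : 0 < ∑ i, expWeight η L i * Real.exp (-(η * l i)) :=
    Finset.sum_pos (fun i _ => mul_pos (hq i) (Real.exp_pos _)) Finset.univ_nonempty
  have h4 := (Real.log_le_sub_one_of_pos h3).trans (sub_le_sub_right h2 1)
  have h5 : 0 < ∑ i, 1 / (Fintype.card V : ℝ) * Real.exp (-η * L i) :=
    Finset.sum_pos (fun _ _ => by positivity) Finset.univ_nonempty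
  unfold potential
  rw [h1, Real.log_mul h5.ne' h3.ne', mul_add]
  have h6 := mul_le_mul_of_nonneg_left h4 (one_div_pos.2 hη).le
  have h7 : 1 / η * (1 - (η * ∑ i, expWeight η L i * l i
      - η ^ 2 / 2 * ∑ i, expWeight η L i * l i ^ 2) - 1)
      = -(∑ i, expWeight η L i * l i - η / 2 * ∑ i, expWeight η L i * l i ^ 2) := by
    field_simp; ring
  linarith

theorem neg_potential_le {η : ℝ} (hη : 0 < η) (L : V → ℝ) (j : V) :
    -potential η L ≤ L j + Real.log (Fintype.card V) / η := by
  have hK : (0 : ℝ) < Fintype.card V := by exact_mod_cast Fintype.card_pos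
  have h1 : 1 / (Fintype.card V : ℝ) * Real.exp (-η * L j)
      ≤ ∑ i, 1 / (Fintype.card V : ℝ) * Real.exp (-η * L i) :=
    Finset.single_le_sum (f := fun i => 1 / (Fintype.card V : ℝ) * Real.exp (-η * L i))
      (fun i _ => by positivity) (Finset.mem_univ j)
  have h2 := Real.log_le_log (by positivity) h1
  rw [Real.log_mul (by positivity) (Real.exp_pos _).ne', Real.log_exp, one_div, Real.log_inv] at h2
  have h3 := mul_le_mul_of_nonneg_left h2 (one_div_pos.2 hη).le
  unfold potential
  rw [one_div (Fintype.card V : ℝ)]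
  have : 1 / η * (-Real.log (Fintype.card V) + -η * L j)
      = -(L j + Real.log (Fintype.card V) / η) := by field_simp; ring
  linarith

theorem hedge_potential {η : ℕ → ℝ} {L l : ℕ → V → ℝ} {m : ℕ}
    (hη : ∀ t, m < t → 0 < η t) (hanti : ∀ s t, m < s → s ≤ t → η t ≤ η s)
    (hl : ∀ t i, m < t → 0 ≤ l t i) (h0 : ∀ i, L m i = 0)
    (hL : ∀ t i, m ≤ t → L (t + 1) i = L t i + l (t + 1) i) (n : ℕ) (hn : m ≤ n) :
    ∀ b, 0 < b → (∀ t ∈ Finset.Ioc m n, b ≤ η t) →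
    ∑ t ∈ Finset.Ioc m n, (∑ i, expWeight (η t) (L (t - 1)) i * l t i
      - η t / 2 * ∑ i, expWeight (η t) (L (t - 1)) i * l t i ^ 2) ≤ -potential b (L n) := by
  have hK : (0 : ℝ) < Fintype.card V := by exact_mod_cast Fintype.card_pos
  induction n, hn using Nat.le_induction with
  | base =>
    intro b hb _
    simp [potential, h0, hK.ne']
  | succ n hn ih =>
    intro b hb hbη
    rw [Finset.sum_Ioc_succ_top hn, Nat.add_sub_cancel]
    have h1 := ih (η (n + 1)) (hη _ (by omega)) (fun t ht => by
      rw [Finset.mem_Ioc] at ht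
      exact hanti _ _ ht.1 (by omega))
    have h2 : potential b (L (n + 1)) ≤ potential (η (n + 1)) (L (n + 1)) :=
      potential_mono hb (hbη _ (by simp; omega)) _
    have h3 := potential_add_le (hη (n + 1) (by omega)) (L n) (l (n + 1))
      (fun i => hl _ i (by omega))
    rw [← funext (fun i => hL n i hn)] at h3
    linarith

/-- Regret bound of exponential weights with decreasing learning rates. -/
theorem hedge_regret {η : ℕ → ℝ} {L l : ℕ → V → ℝ} {m n : ℕ} (hmn : m < n)
    (hη : ∀ t, m < t → 0 < η t) (hanti : ∀ s t, m < s → s ≤ t → η t ≤ η s)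
    (hl : ∀ t i, m < t → 0 ≤ l t i) (h0 : ∀ i, L m i = 0)
    (hL : ∀ t i, m ≤ t → L (t + 1) i = L t i + l (t + 1) i) (j : V) :
    ∑ t ∈ Finset.Ioc m n, (∑ i, expWeight (η t) (L (t - 1)) i * l t i - l t j)
      ≤ Real.log (Fintype.card V) / η n
        + ∑ t ∈ Finset.Ioc m n, η t / 2 * ∑ i, expWeight (η t) (L (t - 1)) i * l t i ^ 2 := by
  have h1 := hedge_potential hη hanti hl h0 hL n hmn.le (η n) (hη n hmn)
    (fun t ht => by rw [Finset.mem_Ioc] at ht; exact hanti _ _ ht.1 ht.2)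
  have h2 := neg_potential_le (hη n hmn) (L n) j
  have h3 : ∀ n, m ≤ n → L n j = ∑ t ∈ Finset.Ioc m n, l t j := by
    intro n hn
    induction n, hn using Nat.le_induction with
    | base => simp [h0]
    | succ n hn ih => rw [Finset.sum_Ioc_succ_top hn, hL n j hn, ih]
  rw [Finset.sum_sub_distrib] at h1 ⊢
  rw [h3 n hmn.le] at h2
  linarith

end Hedge

section Series

theorem sum_one_div_sqrt_le (m n : ℕ) :
    ∑ t ∈ Finset.Ioc m n, 1 / Real.sqrt t ≤ 2 * Real.sqrt n := by
  rcases le_total n m with h | h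
  · simp [Finset.Ioc_eq_empty_of_le h]
  induction n, h using Nat.le_induction with
  | base => simp
  | succ n hn ih =>
    rw [Finset.sum_Ioc_succ_top hn]
    have h1 : 0 < Real.sqrt ((n + 1 : ℕ) : ℝ) := Real.sqrt_pos.2 (by positivity)
    have h2 : Real.sqrt ((n + 1 : ℕ) : ℝ) ^ 2 = n + 1 := by
      rw [Real.sq_sqrt (by positivity)]; push_cast; ring
    have h3 : Real.sqrt n ^ 2 = n := Real.sq_sqrt (by positivity)
    have h4 : Real.sqrt n ≤ Real.sqrt ((n + 1 : ℕ) : ℝ) := Real.sqrt_le_sqrt (by simp)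
    have h5 : 1 / Real.sqrt ((n + 1 : ℕ) : ℝ)
        ≤ 2 * (Real.sqrt ((n + 1 : ℕ) : ℝ) - Real.sqrt n) := by
      rw [div_le_iff₀ h1]
      nlinarith [Real.sqrt_nonneg n]
    linarith

theorem sum_one_div_le_log {m n : ℕ} (hm : 1 ≤ m) (hmn : m ≤ n) :
    ∑ t ∈ Finset.Ioc m n, 1 / (t : ℝ) ≤ Real.log n - Real.log m := by
  induction n, hmn using Nat.le_induction with
  | base => simp
  | succ n hn ih =>
    rw [Finset.sum_Ioc_succ_top hn]
    have hn0 : (0 : ℝ) < n := by exact_mod_cast (by omega : 0 < n)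
    have h1 := Real.log_le_sub_one_of_pos (x := (n : ℝ) / ((n + 1 : ℕ) : ℝ)) (by positivity)
    rw [Real.log_div (by positivity) (by positivity)] at h1
    have h2 : (n : ℝ) / ((n + 1 : ℕ) : ℝ) - 1 = - (1 / ((n + 1 : ℕ) : ℝ)) := by
      push_cast; field_simp; ring
    linarith

theorem sum_one_div_sq_le {m n : ℕ} (hm : 1 ≤ m) :
    ∑ t ∈ Finset.Ioc m n, 1 / (t : ℝ) ^ 2 ≤ 1 / (m : ℝ) := by
  rcases le_total n m with h | h
  · simp [Finset.Ioc_eq_empty_of_le h]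
  have key : ∑ t ∈ Finset.Ioc m n, 1 / (t : ℝ) ^ 2 ≤ 1 / (m : ℝ) - 1 / (n : ℝ) := by
    induction n, h using Nat.le_induction with
    | base => simp
    | succ n hn ih =>
      rw [Finset.sum_Ioc_succ_top hn]
      have hn0 : (0 : ℝ) < n := by exact_mod_cast (by omega : 0 < n)
      have : 1 / ((n + 1 : ℕ) : ℝ) ^ 2 ≤ 1 / (n : ℝ) - 1 / ((n + 1 : ℕ) : ℝ) := by
        push_cast
        rw [div_sub_div _ _ hn0.ne' (by positivity), div_le_div_iff₀ (by positivity) (by positivity)]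
        nlinarith
      linarith
  have : (0 : ℝ) ≤ 1 / (n : ℝ) := by positivity
  linarith

end Series

section ExplorationRate

variable {V : Type*} [Fintype V]

/-- Upper bound of all the exploration rates of round `t`. -/
noncomputable def explCap (V : Type*) [Fintype V] (lam : ℝ) (t : ℕ) : ℝ :=
  min (1 / (2 * (Fintype.card V : ℝ)))
    (1 / 2 * Real.sqrt (lam * Real.log (Fintype.card V) / (t * (Fintype.card V : ℝ) ^ 2)))

variable {β lam : ℝ} {d : V → ℝ} {S : Finset V} {t : ℕ} {i : V}

theorem explRate_of_mem (hi : i ∈ S) : explRate β lam d S t i =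
    if d i = 0 then explCap V lam t
    else min (explCap V lam t) (β * Real.log t / (t * d i ^ 2)) := by
  simp [explRate, explCap, hi]

theorem explRate_of_notMem (hi : i ∉ S) : explRate β lam d S t i =
    min (explCap V lam t) (4 / (t : ℝ) ^ 2) := by
  simp [explRate, explCap, hi]

theorem explCap_nonneg (lam : ℝ) (t : ℕ) : 0 ≤ explCap V lam t := by
  unfold explCap; positivity

theorem explCap_pos (hK : 2 ≤ Fintype.card V) (hlam : 0 < lam) (ht : 1 ≤ t) :
    0 < explCap V lam t := by
  have : 0 < Real.log (Fintype.card V) := Real.log_pos (by exact_mod_cast hK)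
  have ht' : (0 : ℝ) < t := by exact_mod_cast ht
  have hK' : (0 : ℝ) < Fintype.card V := by positivity
  unfold explCap
  exact lt_min (by positivity) (mul_pos (by norm_num) (Real.sqrt_pos.2 (by positivity)))

theorem explCap_anti (hlam : 0 ≤ lam) {s : ℕ} (hs : 1 ≤ s) (hst : s ≤ t) :
    explCap V lam t ≤ explCap V lam s := by
  have hs' : (0 : ℝ) < s := by exact_mod_cast hs
  have hst' : (s : ℝ) ≤ t := by exact_mod_cast hst
  rcases Nat.eq_zero_or_pos (Fintype.card V) with h | h
  · simp [explCap, h]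
  have hK : (1 : ℝ) ≤ Fintype.card V := by exact_mod_cast h
  have hl : 0 ≤ Real.log (Fintype.card V) := Real.log_nonneg hK
  unfold explCap
  refine min_le_min le_rfl (mul_le_mul_of_nonneg_left (Real.sqrt_le_sqrt ?_) (by norm_num))
  exact div_le_div_of_nonneg_left (by positivity) (by positivity) (by gcongr)

theorem explRate_nonneg (hβ : 0 ≤ β) : 0 ≤ explRate β lam d S t i := by
  have h := explCap_nonneg (V := V) lam t
  by_cases hi : i ∈ S
  · rw [explRate_of_mem hi]
    split_ifs
    · exact h
    · exact le_min h (by positivity)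
  · rw [explRate_of_notMem hi]
    exact le_min h (by positivity)

theorem explRate_le_explCap : explRate β lam d S t i ≤ explCap V lam t := by
  by_cases hi : i ∈ S
  · rw [explRate_of_mem hi]
    split_ifs
    · exact le_rfl
    · exact min_le_left _ _
  · rw [explRate_of_notMem hi]
    exact min_le_left _ _

theorem sum_explRate_le_card_mul :
    ∑ i, explRate β lam d S t i ≤ Fintype.card V * explCap V lam t := by
  refine (Finset.sum_le_sum fun i _ => explRate_le_explCap).trans ?_
  simp

theorem sum_explRate_le_half : ∑ i, explRate β lam d S t i ≤ 1 / 2 := by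
  refine sum_explRate_le_card_mul.trans ?_
  rcases Nat.eq_zero_or_pos (Fintype.card V) with h | h
  · simp [h]
  have hK : (0 : ℝ) < Fintype.card V := by exact_mod_cast h
  calc (Fintype.card V : ℝ) * explCap V lam t
      ≤ Fintype.card V * (1 / (2 * (Fintype.card V : ℝ))) := by
        gcongr; exact min_le_left _ _
    _ = 1 / 2 := by field_simp

theorem sum_explRate_le_sqrt :
    ∑ i, explRate β lam d S t i ≤ 1 / 2 * Real.sqrt (lam * Real.log (Fintype.card V) / t) := by
  refine sum_explRate_le_card_mul.trans ?_
  have hK : (0 : ℝ) ≤ Fintype.card V := by positivity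
  rcases hK.eq_or_lt with h | h
  · rw [← h]; simp
  calc (Fintype.card V : ℝ) * explCap V lam t
      ≤ Fintype.card V * (1 / 2 *
        Real.sqrt (lam * Real.log (Fintype.card V) / (t * (Fintype.card V : ℝ) ^ 2))) := by
        gcongr; exact min_le_right _ _
    _ = 1 / 2 * Real.sqrt (lam * Real.log (Fintype.card V) / t) := by
        rw [← div_div, Real.sqrt_div' _ (by positivity), Real.sqrt_sq hK]
        field_simp

theorem min_le_explRate (hβ : 0 ≤ β) (hi : i ∈ S) (hd : 0 ≤ d i) {D : ℝ} (hD : d i ≤ D) :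
    min (explCap V lam t) (β * Real.log t / (t * D ^ 2)) ≤ explRate β lam d S t i := by
  rw [explRate_of_mem hi]
  split_ifs with h
  · exact min_le_left _ _
  · have hd' : 0 < d i := lt_of_le_of_ne hd (Ne.symm h)
    refine min_le_min le_rfl ?_
    rcases Nat.eq_zero_or_pos t with rfl | ht
    · simp
    have ht' : (0 : ℝ) < t := by exact_mod_cast ht
    have := Real.log_nonneg (x := t) (by exact_mod_cast ht)
    exact div_le_div_of_nonneg_left (by positivity) (by positivity) (by gcongr)

theorem explRate_eq_explCap (hi : i ∈ S) (hd : d i = 0) :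
    explRate β lam d S t i = explCap V lam t := by
  rw [explRate_of_mem hi, if_pos hd]

theorem explRate_le_of_mem (hβ : 0 ≤ β) (hi : i ∈ S) {D : ℝ} (hD : 0 < D) (hd : D / 2 ≤ d i) :
    explRate β lam d S t i ≤ 4 * β * Real.log t / (t * D ^ 2) := by
  have hd' : 0 < d i := by linarith
  rw [explRate_of_mem hi, if_neg hd'.ne']
  refine (min_le_right _ _).trans ?_
  rcases Nat.eq_zero_or_pos t with rfl | ht
  · simp
  have ht' : (0 : ℝ) < t := by exact_mod_cast ht
  have hl := Real.log_nonneg (x := t) (by exact_mod_cast ht)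
  rw [div_le_div_iff₀ (by positivity) (by positivity)]
  have h1 : D ^ 2 ≤ 4 * d i ^ 2 := by nlinarith
  have h2 : 0 ≤ β * Real.log t * t := by positivity
  nlinarith [mul_le_mul_of_nonneg_left h1 h2]

theorem explRate_le_of_notMem (hi : i ∉ S) :
    explRate β lam d S t i ≤ 4 / (t : ℝ) ^ 2 := by
  rw [explRate_of_notMem hi]
  exact min_le_right _ _

theorem lower_le_explRate (hβ : 0 ≤ β) (hd : 0 ≤ d i) (hd1 : d i ≤ 1) :
    min (explCap V lam t) (min (β * Real.log t / t) (4 / (t : ℝ) ^ 2))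
      ≤ explRate β lam d S t i := by
  by_cases hi : i ∈ S
  · refine le_trans ?_ (min_le_explRate hβ hi hd hd1)
    simp
  · rw [explRate_of_notMem hi]
    exact min_le_min le_rfl (min_le_right _ _)

end ExplorationRate

section Path

variable {V : Type*} {G : Digraph V} {a : ℕ → V} {x : ℕ → V → ℝ} {t : ℕ} {i : V}

theorem obsCount_le (t : ℕ) (i : V) : obsCount G a t i ≤ t := by
  classical
  refine (Finset.card_filter_le _ _).trans ?_
  simp

theorem obsLoss_nonneg (hx : ∀ t, 1 ≤ t → ∀ i, x t i ∈ Set.Icc (0 : ℝ) 1) (t : ℕ) (i : V) :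
    0 ≤ obsLoss G a x t i := by
  classical
  exact Finset.sum_nonneg fun s hs => (hx s (Finset.mem_Icc.1 (Finset.mem_filter.1 hs).1).1 i).1

theorem obsLoss_le_obsCount (hx : ∀ t, 1 ≤ t → ∀ i, x t i ∈ Set.Icc (0 : ℝ) 1) (t : ℕ) (i : V) :
    obsLoss G a x t i ≤ obsCount G a t i := by
  classical
  unfold obsLoss obsCount
  refine (Finset.sum_le_card_nsmul _ _ 1 fun s hs =>
    (hx s (Finset.mem_Icc.1 (Finset.mem_filter.1 hs).1).1 i).2).trans ?_
  simp

theorem obsLoss_div_obsCount_mem (hx : ∀ t, 1 ≤ t → ∀ i, x t i ∈ Set.Icc (0 : ℝ) 1) (t : ℕ)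
    (i : V) : obsLoss G a x t i / obsCount G a t i ∈ Set.Icc (0 : ℝ) 1 :=
  ⟨div_nonneg (obsLoss_nonneg hx t i) (by positivity),
    div_le_one_of_le₀ (obsLoss_le_obsCount hx t i) (by positivity)⟩

variable [Fintype V] {γ : ℝ}

theorem gapEst_nonneg : 0 ≤ gapEst G γ a x t i := le_max_left _ _

theorem gapEst_le_one [Nonempty V] (hx : ∀ t, 1 ≤ t → ∀ i, x t i ∈ Set.Icc (0 : ℝ) 1) :
    gapEst G γ a x t i ≤ 1 := by
  have h1 : ∀ j, 0 ≤ ucb G γ a x t j := fun j =>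
    le_min zero_le_one (add_nonneg (obsLoss_div_obsCount_mem hx _ _).1 (Real.sqrt_nonneg _))
  have h2 : lcb G γ a x t i ≤ 1 := by
    refine max_le zero_le_one ?_
    have := (obsLoss_div_obsCount_mem (G := G) (a := a) hx (t - 1) i).2
    have : 0 ≤ confWidth G γ a t i := Real.sqrt_nonneg _
    linarith
  have h3 := le_ciInf h1
  exact max_le zero_le_one (by linarith)

/-- The confidence intervals of round `t` contain the means `μ`. -/
def Confident (G : Digraph V) (γ : ℝ) (μ : V → ℝ) (a : ℕ → V) (x : ℕ → V → ℝ) (t : ℕ) : Prop :=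
  ∀ i, |obsLoss G a x (t - 1) i / obsCount G a (t - 1) i - μ i| ≤ confWidth G γ a t i

variable {μ : V → ℝ}

theorem Confident.gapEst_le [Nonempty V] (h : Confident G γ μ a x t)
    (hμ : ∀ i, μ i ∈ Set.Icc (0 : ℝ) 1) (i : V) : gapEst G γ a x t i ≤ μ i - ⨅ j, μ j := by
  have hb : BddBelow (Set.range μ) := (Set.finite_range μ).bddBelow
  have h1 : ⨅ j, μ j ≤ ⨅ j, ucb G γ a x t j := by
    refine le_ciInf fun j => (ciInf_le hb j).trans (le_min (hμ j).2 ?_)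
    have := (abs_le.1 (h j)).1
    linarith
  have h2 : lcb G γ a x t i ≤ μ i := by
    refine max_le (hμ i).1 ?_
    have := (abs_le.1 (h i)).2
    linarith
  have h3 := ciInf_le hb i
  exact max_le (by linarith) (by linarith)

theorem Confident.le_gapEst [Nonempty V] (h : Confident G γ μ a x t) (i : V) {k : V}
    (hk : μ k = ⨅ j, μ j) :
    μ i - (⨅ j, μ j) - 2 * confWidth G γ a t i - 2 * confWidth G γ a t k
      ≤ gapEst G γ a x t i := by
  have h1 : ⨅ j, ucb G γ a x t j ≤ ucb G γ a x t k :=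
    ciInf_le (Set.finite_range _).bddBelow k
  have h2 : ucb G γ a x t k ≤ (⨅ j, μ j) + 2 * confWidth G γ a t k := by
    have := (abs_le.1 (h k)).2
    have h' := min_le_right 1
      (obsLoss G a x (t - 1) k / obsCount G a (t - 1) k + confWidth G γ a t k)
    unfold ucb
    linarith
  have h3 : μ i - 2 * confWidth G γ a t i ≤ lcb G γ a x t i := by
    have := (abs_le.1 (h i)).1
    refine le_trans ?_ (le_max_right _ _)
    linarith
  refine le_trans ?_ (le_max_right _ _)
  linarith

/-- If round `s` is confident, every arm is observed at round `s` at least with the exploration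
rate belonging to its gap. -/
theorem Confident.le_obsProb [Nonempty V] (hloop : ∀ i, G.Adj i i) {prm : Params}
    {S : ℕ → Finset V} (hβ : 0 ≤ prm.β) (h : Confident G prm.γ μ a x t)
    (hμ : ∀ i, μ i ∈ Set.Icc (0 : ℝ) 1)
    (hS : IsExplorationSet G (gapEst G prm.γ a x t) (S t)) (i : V) {c : ℝ}
    (hcap : c ≤ explCap V prm.lam t)
    (hc : 0 < μ i - ⨅ j, μ j → c ≤ prm.β * Real.log t / (t * (μ i - ⨅ j, μ j) ^ 2)) :
    c ≤ obsProb G (playProb G prm a x S t) i := by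
  have hε : ∀ j, 0 ≤ roundRate G prm a x S t j := fun j => explRate_nonneg hβ
  have hp : ∀ j, roundRate G prm a x S t j ≤ playProb G prm a x S t j :=
    le_mixedProb sum_explRate_le_half _ _
  obtain ⟨j, hj, hadj, hd⟩ := hS.exists_adj hloop i
  refine le_trans ?_ (FeedbackGraph.le_obsProb (fun k => (hε k).trans (hp k)) hadj)
  refine le_trans ?_ (hp j)
  have hd' := hd.trans (h.gapEst_le hμ i)
  have hj0 : 0 ≤ gapEst G prm.γ a x t j := gapEst_nonneg
  rcases (hj0.trans hd').eq_or_lt with h0 | h0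
  · have : roundRate G prm a x S t j = explCap V prm.lam t :=
      explRate_eq_explCap hj (le_antisymm (by linarith) hj0)
    rw [this]; exact hcap
  · exact (le_min hcap (hc h0)).trans (min_le_explRate hβ hj hj0 hd')

end Path

section Measurability

variable {V Ω : Type*} [MeasurableSpace Ω] {G : Digraph V} {arm : ℕ → Ω → V}
  {loss : ℕ → Ω → V → ℝ} {S : ℕ → Ω → Finset V} {n : ℕ}

theorem measurableSet_comp_of_fibers {α : Type*} [Finite α] {f : Ω → α}
    (hf : ∀ i, MeasurableSet {ω | f ω = i}) (p : α → Prop) : MeasurableSet {ω | p (f ω)} := by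
  have : {ω | p (f ω)} = ⋃ i ∈ {i | p i}, {ω | f ω = i} := by ext; simp
  rw [this]
  exact MeasurableSet.biUnion (Set.to_countable _) fun i _ => hf i

theorem measurable_obsCount [Finite V]
    (harm : ∀ s, 1 ≤ s → s ≤ n → ∀ i, MeasurableSet {ω | arm s ω = i}) (i : V) :
    Measurable fun ω => (obsCount G (fun s => arm s ω) n i : ℝ) := by
  classical
  unfold obsCount
  simp only [Finset.card_filter, Nat.cast_sum]
  refine Finset.measurable_sum _ fun s hs => ?_
  rw [Finset.mem_Icc] at hs
  have : MeasurableSet {ω | G.Adj (arm s ω) i} :=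
    measurableSet_comp_of_fibers (harm s hs.1 hs.2) (fun j => G.Adj j i)
  simp only [Nat.cast_ite]
  exact Measurable.ite this measurable_const measurable_const

theorem measurable_obsLoss [Finite V]
    (harm : ∀ s, 1 ≤ s → s ≤ n → ∀ i, MeasurableSet {ω | arm s ω = i})
    (hloss : ∀ s, 1 ≤ s → s ≤ n → Measurable (loss s)) (i : V) :
    Measurable fun ω => obsLoss G (fun s => arm s ω) (fun s => loss s ω) n i := by
  classical
  unfold obsLoss
  simp only [Finset.sum_filter]
  refine Finset.measurable_sum _ fun s hs => ?_
  rw [Finset.mem_Icc] at hs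
  have : MeasurableSet {ω | G.Adj (arm s ω) i} :=
    measurableSet_comp_of_fibers (harm s hs.1 hs.2) (fun j => G.Adj j i)
  exact Measurable.ite this ((measurable_pi_apply i).comp (hloss s hs.1 hs.2)) measurable_const

variable [Fintype V] {γ : ℝ} {prm : Params}

theorem measurable_confWidth
    (harm : ∀ s, 1 ≤ s → s ≤ n → ∀ i, MeasurableSet {ω | arm s ω = i}) (i : V) :
    Measurable fun ω => confWidth G γ (fun s => arm s ω) (n + 1) i := by
  unfold confWidth
  simp only [Nat.add_sub_cancel]
  exact ((measurable_obsCount harm i).const_mul 2).const_div _ |>.sqrt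

theorem measurable_gapEst
    (harm : ∀ s, 1 ≤ s → s ≤ n → ∀ i, MeasurableSet {ω | arm s ω = i})
    (hloss : ∀ s, 1 ≤ s → s ≤ n → Measurable (loss s)) (i : V) :
    Measurable fun ω => gapEst G γ (fun s => arm s ω) (fun s => loss s ω) (n + 1) i := by
  have h1 : ∀ i, Measurable fun ω => obsLoss G (fun s => arm s ω) (fun s => loss s ω) n i /
      obsCount G (fun s => arm s ω) n i := fun i =>
    (measurable_obsLoss harm hloss i).div (measurable_obsCount harm i)
  have h2 := fun i => measurable_confWidth (G := G) (γ := γ) harm i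
  unfold gapEst ucb lcb
  simp only [Nat.add_sub_cancel]
  refine measurable_const.max ((measurable_const.max ((h1 i).sub (h2 i))).sub ?_)
  exact Measurable.iInf fun j => measurable_const.min ((h1 j).add (h2 j))

theorem measurableSet_confident {μ : V → ℝ}
    (harm : ∀ s, 1 ≤ s → s ≤ n → ∀ i, MeasurableSet {ω | arm s ω = i})
    (hloss : ∀ s, 1 ≤ s → s ≤ n → Measurable (loss s)) :
    MeasurableSet {ω | Confident G γ μ (fun s => arm s ω) (fun s => loss s ω) (n + 1)} := by
  have : {ω | Confident G γ μ (fun s => arm s ω) (fun s => loss s ω) (n + 1)} =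
      ⋂ i, {ω | |obsLoss G (fun s => arm s ω) (fun s => loss s ω) n i /
      obsCount G (fun s => arm s ω) n i - μ i| ≤ confWidth G γ (fun s => arm s ω) (n + 1) i} := by
    ext ω; simp [Confident]
  rw [this]
  refine MeasurableSet.iInter fun i => measurableSet_le ?_ (measurable_confWidth harm i)
  exact (((measurable_obsLoss harm hloss i).div (measurable_obsCount harm i)).sub_const _).abs

theorem measurable_roundRate
    (harm : ∀ s, 1 ≤ s → s ≤ n → ∀ i, MeasurableSet {ω | arm s ω = i})
    (hloss : ∀ s, 1 ≤ s → s ≤ n → Measurable (loss s))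
    (hS : ∀ U, MeasurableSet {ω | S (n + 1) ω = U}) (i : V) :
    Measurable fun ω => roundRate G prm (fun s => arm s ω) (fun s => loss s ω)
      (fun s => S s ω) (n + 1) i := by
  have hd := fun i => measurable_gapEst (G := G) (γ := prm.γ) harm hloss i
  have hi : MeasurableSet {ω | i ∈ S (n + 1) ω} :=
    measurableSet_comp_of_fibers hS (fun U => i ∈ U)
  unfold roundRate explRate
  refine Measurable.ite hi (Measurable.ite ?_ measurable_const ?_) measurable_const
  · exact measurableSet_eq_fun (hd i) measurable_const
  · exact measurable_const.min ((((hd i).pow_const 2).const_mul _).const_div _)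

theorem measurable_expWeight {η : ℝ} {L : Ω → V → ℝ} (hL : ∀ i, Measurable fun ω => L ω i)
    (i : V) : Measurable fun ω => expWeight η (L ω) i := by
  unfold expWeight
  exact (((hL i).const_mul _).exp).div
    (Finset.measurable_sum _ fun j _ => ((hL j).const_mul _).exp)

theorem measurable_mixedProb {η : ℝ} {ε L : Ω → V → ℝ} (hε : ∀ i, Measurable fun ω => ε ω i)
    (hL : ∀ i, Measurable fun ω => L ω i) (i : V) :
    Measurable fun ω => mixedProb η (ε ω) (L ω) i := by
  unfold mixedProb
  exact ((measurable_const.sub (Finset.measurable_sum _ fun j _ => hε j)).mul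
    (measurable_expWeight hL i)).add (hε i)

theorem measurable_obsProb {p : Ω → V → ℝ} (hp : ∀ i, Measurable fun ω => p ω i) (i : V) :
    Measurable fun ω => obsProb G (p ω) i := by
  classical
  unfold obsProb
  exact Finset.measurable_sum _ fun j _ => hp j

theorem measurable_estLoss
    (harm : ∀ s, 1 ≤ s → s ≤ n → ∀ i, MeasurableSet {ω | arm s ω = i})
    (hloss : ∀ s, 1 ≤ s → s ≤ n → Measurable (loss s))
    (hS : ∀ s, Fintype.card V ≤ s → s < n → ∀ U, MeasurableSet {ω | S (s + 1) ω = U}) :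
    ∀ i, Measurable fun ω => estLoss G prm (fun s => arm s ω) (fun s => loss s ω)
      (fun s => S s ω) n i := by
  induction n with
  | zero => intro i; exact measurable_const
  | succ n ih =>
    intro i
    have ih' := ih (fun s h1 h2 => harm s h1 (by omega)) (fun s h1 h2 => hloss s h1 (by omega))
      (fun s h1 h2 => hS s h1 (by omega))
    unfold estLoss
    split_ifs with h
    · refine (ih' i).add (Measurable.ite
        (measurableSet_comp_of_fibers (harm (n + 1) (by omega) le_rfl) (fun j => G.Adj j i))
        (Measurable.div ?_ (measurable_obsProb (fun j => measurable_mixedProb (fun k => ?_)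
          ih' j) i)) measurable_const)
      · exact (measurable_pi_apply i).comp (hloss (n + 1) (by omega) le_rfl)
      · exact measurable_roundRate (fun s h1 h2 => harm s h1 (by omega))
          (fun s h1 h2 => hloss s h1 (by omega)) (hS n (by omega) (by omega)) k
    · exact measurable_const

theorem measurable_playProb
    (harm : ∀ s, 1 ≤ s → s ≤ n → ∀ i, MeasurableSet {ω | arm s ω = i})
    (hloss : ∀ s, 1 ≤ s → s ≤ n → Measurable (loss s))
    (hS : ∀ s, Fintype.card V ≤ s → s ≤ n → ∀ U, MeasurableSet {ω | S (s + 1) ω = U})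
    (hn : Fintype.card V ≤ n) (i : V) :
    Measurable fun ω => playProb G prm (fun s => arm s ω) (fun s => loss s ω)
      (fun s => S s ω) (n + 1) i := by
  unfold playProb
  exact measurable_mixedProb (measurable_roundRate harm hloss (hS n hn le_rfl))
    (measurable_estLoss harm hloss fun s h1 h2 => hS s h1 h2.le) i

end Measurability

/-- Bounded measurable real functions. -/
structure BddMeasurable {Ω : Type*} (m : MeasurableSpace Ω) (f : Ω → ℝ) : Prop where
  measurable : Measurable[m] f
  bdd : ∃ C, ∀ ω, |f ω| ≤ C

namespace BddMeasurable

variable {Ω : Type*} {m : MeasurableSpace Ω} {f g : Ω → ℝ}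

theorem const (c : ℝ) : BddMeasurable m (fun _ => c) := ⟨measurable_const, |c|, fun _ => le_rfl⟩

theorem of_mem_Icc {a b : ℝ} (hf : Measurable[m] f) (h : ∀ ω, f ω ∈ Set.Icc a b) :
    BddMeasurable m f :=
  ⟨hf, max |a| |b|, fun ω => abs_le_max_abs_abs (h ω).1 (h ω).2⟩

theorem mono {m' : MeasurableSpace Ω} (hf : BddMeasurable m f) (h : m ≤ m') :
    BddMeasurable m' f := ⟨hf.measurable.mono h le_rfl, hf.bdd⟩

theorem add (hf : BddMeasurable m f) (hg : BddMeasurable m g) :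
    BddMeasurable m (fun ω => f ω + g ω) := by
  obtain ⟨A, hA⟩ := hf.bdd
  obtain ⟨B, hB⟩ := hg.bdd
  exact ⟨hf.measurable.add hg.measurable, A + B, fun ω =>
    (abs_add_le _ _).trans (add_le_add (hA ω) (hB ω))⟩

theorem mul (hf : BddMeasurable m f) (hg : BddMeasurable m g) :
    BddMeasurable m (fun ω => f ω * g ω) := by
  obtain ⟨A, hA⟩ := hf.bdd
  obtain ⟨B, hB⟩ := hg.bdd
  refine ⟨hf.measurable.mul hg.measurable, A * B, fun ω => ?_⟩
  rw [abs_mul]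
  exact mul_le_mul (hA ω) (hB ω) (abs_nonneg _) ((abs_nonneg _).trans (hA ω))

theorem neg (hf : BddMeasurable m f) : BddMeasurable m (fun ω => -f ω) :=
  ⟨hf.measurable.neg, by simpa using hf.bdd⟩

theorem sub (hf : BddMeasurable m f) (hg : BddMeasurable m g) :
    BddMeasurable m (fun ω => f ω - g ω) := by
  simpa only [sub_eq_add_neg] using hf.add hg.neg

theorem const_mul (c : ℝ) (hf : BddMeasurable m f) : BddMeasurable m (fun ω => c * f ω) :=
  (const c).mul hf

theorem sum {ι : Type*} {s : Finset ι} {F : ι → Ω → ℝ} (h : ∀ i ∈ s, BddMeasurable m (F i)) :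
    BddMeasurable m (fun ω => ∑ i ∈ s, F i ω) := by
  classical
  induction s using Finset.induction_on with
  | empty => simpa using const 0
  | insert a s ha ih =>
    simp only [Finset.sum_insert ha]
    exact (h a (Finset.mem_insert_self _ _)).add
      (ih fun i hi => h i (Finset.mem_insert_of_mem hi))

theorem pow (hf : BddMeasurable m f) (n : ℕ) : BddMeasurable m (fun ω => f ω ^ n) := by
  induction n with
  | zero => simpa using const 1
  | succ n ih => simpa only [pow_succ] using ih.mul hf

theorem exp (hf : BddMeasurable m f) : BddMeasurable m (fun ω => Real.exp (f ω)) := by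
  obtain ⟨A, hA⟩ := hf.bdd
  refine ⟨hf.measurable.exp, Real.exp A, fun ω => ?_⟩
  rw [abs_of_pos (Real.exp_pos _)]
  exact Real.exp_le_exp.2 ((le_abs_self _).trans (hA ω))

open Classical in
theorem ite {p : Ω → Prop} (hp : MeasurableSet[m] {ω | p ω}) (hf : BddMeasurable m f)
    (hg : BddMeasurable m g) : BddMeasurable m (fun ω => if p ω then f ω else g ω) := by
  obtain ⟨A, hA⟩ := hf.bdd
  obtain ⟨B, hB⟩ := hg.bdd
  refine ⟨Measurable.ite hp hf.measurable hg.measurable, max A B, fun ω => ?_⟩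
  split_ifs
  · exact (hA ω).trans (le_max_left _ _)
  · exact (hB ω).trans (le_max_right _ _)

theorem inv (hf : Measurable[m] f) {c : ℝ} (hc : 0 < c) (h : ∀ ω, c ≤ f ω) :
    BddMeasurable m (fun ω => (f ω)⁻¹) := by
  refine ⟨hf.inv, c⁻¹, fun ω => ?_⟩
  rw [abs_of_pos (inv_pos.2 (hc.trans_le (h ω)))]
  exact inv_anti₀ hc (h ω)

theorem integrable {mΩ : MeasurableSpace Ω} {P : Measure Ω} [IsFiniteMeasure P]
    (hf : BddMeasurable m f) (h : m ≤ mΩ) : Integrable f P := by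
  obtain ⟨A, hA⟩ := hf.bdd
  exact Integrable.of_bound (hf.measurable.mono h le_rfl).aestronglyMeasurable A
    (Filter.Eventually.of_forall hA)

theorem integral_mono {mΩ : MeasurableSpace Ω} {P : Measure Ω} [IsFiniteMeasure P]
    (hf : BddMeasurable mΩ f) (hg : BddMeasurable mΩ g) (h : ∀ ω, f ω ≤ g ω) :
    ∫ ω, f ω ∂P ≤ ∫ ω, g ω ∂P :=
  MeasureTheory.integral_mono (hf.integrable le_rfl) (hg.integrable le_rfl) h

end BddMeasurable

set_option linter.unusedSectionVars false

section Run

variable {V Ω : Type*} [Fintype V] [Nonempty V] {mΩ : MeasurableSpace Ω} {G : Digraph V}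
  {prm : Params} {P : Measure Ω} [IsProbabilityMeasure P] {𝓕 : Filtration ℕ mΩ}
  {loss : ℕ → Ω → V → ℝ} {arm : ℕ → Ω → V} {S : ℕ → Ω → Finset V}

theorem IsStochasticLoss.bddMeasurable_comp (hloss : IsStochasticLoss P 𝓕 loss)
    {h : (V → ℝ) → ℝ} (hh : Continuous h) {t : ℕ} (ht : 1 ≤ t) :
    BddMeasurable (𝓕 t) (fun ω => h (loss t ω)) := by
  refine ⟨hh.measurable.comp (hloss.adapted t ht), ?_⟩
  obtain ⟨C, hC⟩ := (isCompact_Icc (a := (0 : V → ℝ)) (b := 1)).exists_bound_of_continuousOn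
    hh.continuousOn
  exact ⟨C, fun ω => hC _ ⟨fun i => (hloss.mem_Icc t ht ω i).1, fun i => (hloss.mem_Icc t ht ω i).2⟩⟩

theorem IsStochasticLoss.integral_comp (hloss : IsStochasticLoss P 𝓕 loss)
    {h : (V → ℝ) → ℝ} (hh : Continuous h) {t : ℕ} (ht : 1 ≤ t) :
    ∫ ω, h (loss t ω) ∂P = ∫ ω, h (loss 1 ω) ∂P :=
  ((hloss.identDistrib t ht).comp hh.measurable).integral_eq

theorem IsStochasticLoss.integral_mul (hloss : IsStochasticLoss P 𝓕 loss)
    {h : (V → ℝ) → ℝ} (hh : Continuous h) {t : ℕ} {Z : Ω → ℝ} (hZ : BddMeasurable (𝓕 t) Z) :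
    ∫ ω, Z ω * h (loss (t + 1) ω) ∂P = (∫ ω, Z ω ∂P) * ∫ ω, h (loss 1 ω) ∂P := by
  have hind : IndepFun Z (fun ω => h (loss (t + 1) ω)) P := by
    have h1 := (hloss.indep_past t).symm
    refine indep_of_indep_of_le_left (indep_of_indep_of_le_right h1 ?_) hZ.measurable.comap_le
    exact (hh.measurable.comp (comap_measurable (loss (t + 1)))).comap_le
  rw [← hloss.integral_comp hh (Nat.le_add_left 1 t)]
  exact hind.integral_fun_mul_eq_mul_integral
    (hZ.integrable (𝓕.le t)).aestronglyMeasurable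
    ((hloss.bddMeasurable_comp hh (Nat.le_add_left 1 t)).integrable
      (𝓕.le _)).aestronglyMeasurable

theorem IsRun.measurable_playProb (hloss : IsStochasticLoss P 𝓕 loss)
    (hrun : IsRun G prm P 𝓕 loss arm S) {t : ℕ} (ht : Fintype.card V ≤ t) (i : V) :
    Measurable[𝓕 t] fun ω => playProb G prm (fun s => arm s ω) (fun s => loss s ω)
      (fun s => S s ω) (t + 1) i :=
  @FeedbackGraph.measurable_playProb V Ω (𝓕 t) G arm loss S t _ prm
    (fun s h1 h2 j => 𝓕.mono h2 _ (hrun.arm_adapted s h1 j))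
    (fun s h1 h2 => (hloss.adapted s h1).mono (𝓕.mono h2) le_rfl)
    (fun s h1 h2 U => 𝓕.mono h2 _ (hrun.expl_predictable s h1 U)) ht i

theorem IsRun.measurable_estLoss (hloss : IsStochasticLoss P 𝓕 loss)
    (hrun : IsRun G prm P 𝓕 loss arm S) (t : ℕ) (i : V) :
    Measurable[𝓕 t] fun ω => estLoss G prm (fun s => arm s ω) (fun s => loss s ω)
      (fun s => S s ω) t i :=
  @FeedbackGraph.measurable_estLoss V Ω (𝓕 t) G arm loss S t _ prm
    (fun s h1 h2 j => 𝓕.mono h2 _ (hrun.arm_adapted s h1 j))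
    (fun s h1 h2 => (hloss.adapted s h1).mono (𝓕.mono h2) le_rfl)
    (fun s h1 h2 U => 𝓕.mono h2.le _ (hrun.expl_predictable s h1 U)) i

theorem IsRun.measurableSet_confident (hloss : IsStochasticLoss P 𝓕 loss)
    (hrun : IsRun G prm P 𝓕 loss arm S) (γ : ℝ) (μ : V → ℝ) (t : ℕ) :
    MeasurableSet[𝓕 t] {ω | Confident G γ μ (fun s => arm s ω) (fun s => loss s ω) (t + 1)} :=
  @FeedbackGraph.measurableSet_confident V Ω (𝓕 t) G arm loss t _ γ μ
    (fun s h1 h2 j => 𝓕.mono h2 _ (hrun.arm_adapted s h1 j))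
    (fun s h1 h2 => (hloss.adapted s h1).mono (𝓕.mono h2) le_rfl)

theorem playProb_nonneg (hβ : 0 ≤ prm.β) (a : ℕ → V) (x : ℕ → V → ℝ) (U : ℕ → Finset V)
    (t : ℕ) (i : V) : 0 ≤ playProb G prm a x U t i :=
  (explRate_nonneg hβ).trans (le_mixedProb sum_explRate_le_half _ _ i)

theorem sum_playProb (a : ℕ → V) (x : ℕ → V → ℝ) (U : ℕ → Finset V)
    (t : ℕ) : ∑ i, playProb G prm a x U t i = 1 := sum_mixedProb _ _ _

theorem playProb_le_one (hβ : 0 ≤ prm.β) (a : ℕ → V) (x : ℕ → V → ℝ) (U : ℕ → Finset V)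
    (t : ℕ) (i : V) : playProb G prm a x U t i ≤ 1 := by
  rw [← sum_playProb (G := G) (prm := prm) a x U t]
  exact Finset.single_le_sum (f := playProb G prm a x U t)
    (fun j _ => playProb_nonneg hβ a x U t j) (Finset.mem_univ i)

theorem IsRun.bddMeasurable_playProb (hβ : 0 ≤ prm.β) (hloss : IsStochasticLoss P 𝓕 loss)
    (hrun : IsRun G prm P 𝓕 loss arm S) {t : ℕ} (ht : Fintype.card V ≤ t) (i : V) :
    BddMeasurable (𝓕 t) fun ω => playProb G prm (fun s => arm s ω) (fun s => loss s ω)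
      (fun s => S s ω) (t + 1) i :=
  .of_mem_Icc (hrun.measurable_playProb hloss ht i) fun _ =>
    ⟨playProb_nonneg hβ _ _ _ _ i, playProb_le_one hβ _ _ _ _ i⟩

open Classical in
/-- Indicator that arm `i` is played. -/
noncomputable def armInd (arm : ℕ → Ω → V) (t : ℕ) (i : V) (ω : Ω) : ℝ :=
  if arm t ω = i then 1 else 0

open Classical in
/-- Indicator that arm `i` is observed. -/
noncomputable def obsInd (G : Digraph V) (arm : ℕ → Ω → V) (t : ℕ) (i : V) (ω : Ω) : ℝ :=
  if G.Adj (arm t ω) i then 1 else 0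

open Classical in
theorem obsInd_eq_sum (t : ℕ) (i : V) (ω : Ω) :
    obsInd G arm t i ω = ∑ j ∈ Finset.univ.filter (fun j => G.Adj j i), armInd arm t j ω := by
  simp [obsInd, armInd]

theorem IsRun.bddMeasurable_armInd (hrun : IsRun G prm P 𝓕 loss arm S) {t : ℕ} (ht : 1 ≤ t)
    (i : V) : BddMeasurable (𝓕 t) (armInd arm t i) :=
  .ite (hrun.arm_adapted t ht i) (.const 1) (.const 0)

theorem IsRun.bddMeasurable_obsInd (hrun : IsRun G prm P 𝓕 loss arm S) {t : ℕ} (ht : 1 ≤ t)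
    (i : V) : BddMeasurable (𝓕 t) (obsInd G arm t i) :=
  .ite (@measurableSet_comp_of_fibers Ω (𝓕 t) V _ _ (hrun.arm_adapted t ht) (fun j => G.Adj j i))
    (.const 1) (.const 0)

theorem IsRun.integral_mul_armInd_mul_loss (hβ : 0 ≤ prm.β) (hloss : IsStochasticLoss P 𝓕 loss)
    (hrun : IsRun G prm P 𝓕 loss arm S) {t : ℕ} (ht : Fintype.card V ≤ t)
    {Z : Ω → ℝ} (hZ : BddMeasurable (𝓕 t) Z) {h : (V → ℝ) → ℝ} (hh : Continuous h) (i : V) :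
    ∫ ω, Z ω * armInd arm (t + 1) i ω * h (loss (t + 1) ω) ∂P =
      (∫ ω, Z ω * playProb G prm (fun s => arm s ω) (fun s => loss s ω)
        (fun s => S s ω) (t + 1) i ∂P) * ∫ ω, h (loss 1 ω) ∂P := by
  have hle : 𝓕 t ⊔ MeasurableSpace.comap (loss (t + 1)) inferInstance ≤ mΩ :=
    sup_le (𝓕.le t) ((hloss.adapted (t + 1) (Nat.le_add_left 1 t)).mono (𝓕.le _) le_rfl).comap_le
  have hp := hrun.bddMeasurable_playProb hβ hloss ht i
  have hb := hloss.bddMeasurable_comp hh (Nat.le_add_left 1 t)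
  have ha := hrun.bddMeasurable_armInd (Nat.le_add_left 1 t) i
  rw [← hloss.integral_mul hh (hZ.mul hp)]
  have hg : Measurable[𝓕 t ⊔ MeasurableSpace.comap (loss (t + 1)) inferInstance]
      (fun ω => Z ω * h (loss (t + 1) ω)) := by
    refine Measurable.mul (hZ.measurable.mono le_sup_left le_rfl) ?_
    refine hh.measurable.comp (Measurable.mono (comap_measurable _) le_sup_right le_rfl)
  have e1 : (fun ω => Z ω * armInd arm (t + 1) i ω * h (loss (t + 1) ω)) =
      (fun ω => Z ω * h (loss (t + 1) ω)) * (Set.indicator {ω | arm (t + 1) ω = i} (fun _ => (1 : ℝ))) := by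
    ext ω
    simp only [armInd, Pi.mul_apply, Set.indicator, Set.mem_ofPred_eq]
    ring
  have e2 : Set.indicator {ω | arm (t + 1) ω = i} (fun _ => (1 : ℝ)) = armInd arm (t + 1) i := by
    ext ω; simp [armInd, Set.indicator]
  rw [e1, ← integral_condExp hle]
  refine integral_congr_ae ?_
  have h2 := condExp_mul_of_stronglyMeasurable_left (μ := P) hg.stronglyMeasurable
    (g := Set.indicator {ω | arm (t + 1) ω = i} (fun _ => (1 : ℝ)))
    (by rw [e2]; exact (((hZ.mono (𝓕.le t)).mul (hb.mono (𝓕.le _))).mul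
      (ha.mono (𝓕.le _))).integrable le_rfl)
    (by rw [e2]; exact ha.integrable (𝓕.le _))
  filter_upwards [h2, hrun.sampling t ht i] with ω h3 h4
  rw [h3, Pi.mul_apply, h4]
  ring

theorem IsRun.integral_mul_armInd (hβ : 0 ≤ prm.β) (hloss : IsStochasticLoss P 𝓕 loss)
    (hrun : IsRun G prm P 𝓕 loss arm S) {t : ℕ} (ht : Fintype.card V ≤ t)
    {Z : Ω → ℝ} (hZ : BddMeasurable (𝓕 t) Z) (i : V) :
    ∫ ω, Z ω * armInd arm (t + 1) i ω ∂P =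
      ∫ ω, Z ω * playProb G prm (fun s => arm s ω) (fun s => loss s ω)
        (fun s => S s ω) (t + 1) i ∂P := by
  have := hrun.integral_mul_armInd_mul_loss hβ hloss ht hZ (h := fun _ => 1) continuous_const i
  simpa using this

/-- The loss vector of a round is independent of the arm of that round and the past. -/
theorem IsRun.integral_mul_armInd_mul (hβ : 0 ≤ prm.β) (hloss : IsStochasticLoss P 𝓕 loss)
    (hrun : IsRun G prm P 𝓕 loss arm S) (t : ℕ)
    {Z : Ω → ℝ} (hZ : BddMeasurable (𝓕 t) Z) {h : (V → ℝ) → ℝ} (hh : Continuous h) (i : V) :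
    ∫ ω, Z ω * armInd arm (t + 1) i ω * h (loss (t + 1) ω) ∂P =
      (∫ ω, Z ω * armInd arm (t + 1) i ω ∂P) * ∫ ω, h (loss 1 ω) ∂P := by
  by_cases ht : Fintype.card V ≤ t
  · rw [hrun.integral_mul_armInd hβ hloss ht hZ, hrun.integral_mul_armInd_mul_loss hβ hloss ht hZ hh]
  · obtain ⟨σ, -, hσ⟩ := hrun.initial
    have h1 : ∀ ω, arm (t + 1) ω = σ (t + 1) := hσ (t + 1) ⟨by omega, by omega⟩
    have h2 : ∀ ω, Z ω * armInd arm (t + 1) i ω =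
        Z ω * (open Classical in if σ (t + 1) = i then 1 else 0) := by
      intro ω; by_cases h : σ (t + 1) = i <;> simp [armInd, h1, h]
    simp only [h2]
    exact hloss.integral_mul hh (hZ.mul (.const _))

theorem IsRun.integral_mul_obsInd_mul (hβ : 0 ≤ prm.β) (hloss : IsStochasticLoss P 𝓕 loss)
    (hrun : IsRun G prm P 𝓕 loss arm S) (t : ℕ)
    {Z : Ω → ℝ} (hZ : BddMeasurable (𝓕 t) Z) {h : (V → ℝ) → ℝ} (hh : Continuous h) (i : V) :
    ∫ ω, Z ω * obsInd G arm (t + 1) i ω * h (loss (t + 1) ω) ∂P =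
      (∫ ω, Z ω * obsInd G arm (t + 1) i ω ∂P) * ∫ ω, h (loss 1 ω) ∂P := by
  have ha := fun j => (hrun.bddMeasurable_armInd (Nat.le_add_left 1 t) j).mono (𝓕.le _)
  have hb := (hloss.bddMeasurable_comp hh (Nat.le_add_left 1 t)).mono (𝓕.le _)
  have hZ' := hZ.mono (𝓕.le _)
  simp only [obsInd_eq_sum, Finset.mul_sum, Finset.sum_mul]
  rw [integral_finsetSum _ fun j _ => ((hZ'.mul (ha j)).mul hb).integrable le_rfl,
    integral_finsetSum _ fun j _ => (hZ'.mul (ha j)).integrable le_rfl, Finset.sum_mul]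
  exact Finset.sum_congr rfl fun j _ => hrun.integral_mul_armInd_mul hβ hloss t hZ hh j

theorem IsRun.integral_mul_obsInd (hβ : 0 ≤ prm.β) (hloss : IsStochasticLoss P 𝓕 loss)
    (hrun : IsRun G prm P 𝓕 loss arm S) {t : ℕ} (ht : Fintype.card V ≤ t)
    {Z : Ω → ℝ} (hZ : BddMeasurable (𝓕 t) Z) (i : V) :
    ∫ ω, Z ω * obsInd G arm (t + 1) i ω ∂P =
      ∫ ω, Z ω * obsProb G (playProb G prm (fun s => arm s ω) (fun s => loss s ω)
        (fun s => S s ω) (t + 1)) i ∂P := by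
  have ha := fun j => (hrun.bddMeasurable_armInd (Nat.le_add_left 1 t) j).mono (𝓕.le _)
  have hp := fun j => (hrun.bddMeasurable_playProb hβ hloss ht j).mono (𝓕.le _)
  have hZ' := hZ.mono (𝓕.le _)
  simp only [obsInd_eq_sum, obsProb, Finset.mul_sum]
  rw [integral_finsetSum _ fun j _ => (hZ'.mul (ha j)).integrable le_rfl,
    integral_finsetSum _ fun j _ => (hZ'.mul (hp j)).integrable le_rfl]
  exact Finset.sum_congr rfl fun j _ => hrun.integral_mul_armInd hβ hloss ht hZ j

end Run

section Concentration

variable {V Ω : Type*} [Fintype V] [Nonempty V] {mΩ : MeasurableSpace Ω} {G : Digraph V}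
  {prm : Params} {P : Measure Ω} [IsProbabilityMeasure P] {𝓕 : Filtration ℕ mΩ}
  {loss : ℕ → Ω → V → ℝ} {arm : ℕ → Ω → V} {S : ℕ → Ω → Finset V}

theorem bddMeasurable_prod {Y : ℕ → Ω → ℝ} {m n : ℕ}
    (hmn : m ≤ n) (hY : ∀ s, m < s → BddMeasurable (𝓕 s) (Y s)) :
    BddMeasurable (𝓕 n) fun ω => ∏ s ∈ Finset.Ioc m n, Y s ω := by
  induction n, hmn using Nat.le_induction with
  | base => simpa using BddMeasurable.const 1
  | succ n hn ih =>
    simp only [Finset.prod_Ioc_succ_top hn]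
    exact (ih.mono (𝓕.mono (Nat.le_succ n))).mul (hY _ (by omega))

/-- Products of adapted factors with conditional expectations at most `c`. -/
theorem integral_prod_le_pow {Y : ℕ → Ω → ℝ} {m n : ℕ} {c : ℝ} (hc : 0 ≤ c)
    (hmn : m ≤ n) (hY : ∀ s, m < s → BddMeasurable (𝓕 s) (Y s)) (hY0 : ∀ s ω, 0 ≤ Y s ω)
    (hstep : ∀ t, m ≤ t → t < n → ∀ Z : Ω → ℝ, BddMeasurable (𝓕 t) Z → (∀ ω, 0 ≤ Z ω) →
      ∫ ω, Z ω * Y (t + 1) ω ∂P ≤ c * ∫ ω, Z ω ∂P) :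
    ∫ ω, ∏ s ∈ Finset.Ioc m n, Y s ω ∂P ≤ c ^ (n - m) := by
  induction n, hmn using Nat.le_induction with
  | base => simp
  | succ n hn ih =>
    simp only [Finset.prod_Ioc_succ_top hn]
    refine (hstep n hn (Nat.lt_succ_self n) _ (bddMeasurable_prod hn hY)
      fun ω => Finset.prod_nonneg fun s _ => hY0 s ω).trans ?_
    rw [Nat.succ_sub hn, pow_succ, mul_comm]
    exact mul_le_mul_of_nonneg_right
      (ih fun t h1 h2 => hstep t h1 (h2.trans (Nat.lt_succ_self n))) hc

/-- Mean loss of arm `i`. -/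
noncomputable def meanLoss (P : Measure Ω) (loss : ℕ → Ω → V → ℝ) (i : V) : ℝ :=
  ∫ ω, loss 1 ω i ∂P

theorem meanLoss_mem_Icc (hloss : IsStochasticLoss P 𝓕 loss) (i : V) :
    meanLoss P loss i ∈ Set.Icc (0 : ℝ) 1 := by
  have h := hloss.bddMeasurable_comp (continuous_apply i) le_rfl
  refine ⟨integral_nonneg fun ω => (hloss.mem_Icc 1 le_rfl ω i).1, ?_⟩
  have : meanLoss P loss i ≤ ∫ _, (1 : ℝ) ∂P :=
    (h.mono (𝓕.le 1)).integral_mono (P := P) (.const 1) fun ω => (hloss.mem_Icc 1 le_rfl ω i).2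
  simpa using this

theorem integral_exp_centered_le (hloss : IsStochasticLoss P 𝓕 loss) (i : V) (c : ℝ) :
    ∫ ω, Real.exp (c * (loss 1 ω i - meanLoss P loss i) - c ^ 2 / 8) ∂P ≤ 1 := by
  have hm : AEMeasurable (fun ω => loss 1 ω i) P :=
    ((hloss.bddMeasurable_comp (continuous_apply i) le_rfl).mono (𝓕.le 1)).measurable.aemeasurable
  have h := (hasSubgaussianMGF_of_mem_Icc (a := 0) (b := 1) hm
    (Filter.Eventually.of_forall fun ω => hloss.mem_Icc 1 le_rfl ω i)).mgf_le c
  simp only [mgf] at h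
  simp only [sub_eq_add_neg _ (c ^ 2 / 8), Real.exp_add]
  rw [integral_mul_const, Real.exp_neg, ← div_eq_mul_inv, div_le_one (Real.exp_pos _)]
  refine h.trans (Real.exp_le_exp.2 (le_of_eq ?_))
  simp
  ring

theorem obsCount_eq_sum (n : ℕ) (i : V) (ω : Ω) :
    (obsCount G (fun s => arm s ω) n i : ℝ) = ∑ s ∈ Finset.Ioc 0 n, obsInd G arm s i ω := by
  classical
  rw [obsCount, Finset.card_filter]
  push_cast
  rfl

theorem obsLoss_eq_sum (n : ℕ) (i : V) (ω : Ω) :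
    obsLoss G (fun s => arm s ω) (fun s => loss s ω) n i =
      ∑ s ∈ Finset.Ioc 0 n, obsInd G arm s i ω * loss s ω i := by
  classical
  rw [obsLoss, Finset.sum_filter]
  refine Finset.sum_congr rfl fun s _ => ?_
  simp [obsInd]

/-- Exponential deviation process of the observed losses of arm `i`. -/
noncomputable def devExp (G : Digraph V) (P : Measure Ω) (loss : ℕ → Ω → V → ℝ)
    (arm : ℕ → Ω → V) (n : ℕ) (i : V) (c : ℝ) (ω : Ω) : ℝ :=
  Real.exp (c * (obsLoss G (fun s => arm s ω) (fun s => loss s ω) n i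
    - obsCount G (fun s => arm s ω) n i * meanLoss P loss i)
    - c ^ 2 / 8 * obsCount G (fun s => arm s ω) n i)

theorem devExp_eq_prod (n : ℕ) (i : V) (c : ℝ) (ω : Ω) :
    devExp G P loss arm n i c ω = ∏ s ∈ Finset.Ioc 0 n,
      (1 + obsInd G arm s i ω *
        (Real.exp (c * (loss s ω i - meanLoss P loss i) - c ^ 2 / 8) - 1)) := by
  have h : ∀ s, 1 + obsInd G arm s i ω *
        (Real.exp (c * (loss s ω i - meanLoss P loss i) - c ^ 2 / 8) - 1) =
      Real.exp (c * (obsInd G arm s i ω * loss s ω i - obsInd G arm s i ω * meanLoss P loss i)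
        - c ^ 2 / 8 * obsInd G arm s i ω) := by
    intro s
    by_cases hs : G.Adj (arm s ω) i <;> simp [obsInd, hs]
  simp only [h]
  rw [← Real.exp_sum, devExp, obsCount_eq_sum, obsLoss_eq_sum, Finset.sum_sub_distrib,
    ← Finset.mul_sum, ← Finset.mul_sum, Finset.sum_sub_distrib, ← Finset.sum_mul]

variable (hβ : 0 ≤ prm.β) (hloss : IsStochasticLoss P 𝓕 loss)
  (hrun : IsRun G prm P 𝓕 loss arm S)

include hβ hloss hrun

theorem devExp_spec (n : ℕ) (i : V) (c : ℝ) :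
    BddMeasurable (𝓕 n) (devExp G P loss arm n i c) ∧ ∫ ω, devExp G P loss arm n i c ω ∂P ≤ 1 := by
  have hcont : Continuous fun v : V → ℝ =>
      Real.exp (c * (v i - meanLoss P loss i) - c ^ 2 / 8) := by fun_prop
  have hY : ∀ s, 0 < s → BddMeasurable (𝓕 s) fun ω => 1 + obsInd G arm s i ω *
      (Real.exp (c * (loss s ω i - meanLoss P loss i) - c ^ 2 / 8) - 1) := fun s hs =>
    (BddMeasurable.const 1).add ((hrun.bddMeasurable_obsInd hs i).mul
      ((hloss.bddMeasurable_comp hcont hs).sub (.const 1)))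
  have e : devExp G P loss arm n i c = fun ω => ∏ s ∈ Finset.Ioc 0 n, (1 + obsInd G arm s i ω *
        (Real.exp (c * (loss s ω i - meanLoss P loss i) - c ^ 2 / 8) - 1)) :=
    funext fun ω => devExp_eq_prod n i c ω
  rw [e]
  refine ⟨bddMeasurable_prod (Nat.zero_le n) hY, ?_⟩
  refine (integral_prod_le_pow zero_le_one (Nat.zero_le n) hY ?_ ?_).trans (by simp)
  · intro s ω
    by_cases hs : G.Adj (arm s ω) i <;> simp [obsInd, hs, Real.exp_nonneg]
  · intro t _ _ Z hZ hZ0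
    have ho := (hrun.bddMeasurable_obsInd (Nat.le_add_left 1 t) i).mono (𝓕.le _)
    have hb := (hloss.bddMeasurable_comp hcont (Nat.le_add_left 1 t)).mono (𝓕.le _)
    have hZ' := hZ.mono (𝓕.le _)
    have e2 : (fun ω => Z ω * (1 + obsInd G arm (t + 1) i ω *
        (Real.exp (c * (loss (t + 1) ω i - meanLoss P loss i) - c ^ 2 / 8) - 1))) =
        fun ω => Z ω + (Z ω * obsInd G arm (t + 1) i ω *
          Real.exp (c * (loss (t + 1) ω i - meanLoss P loss i) - c ^ 2 / 8)
          - Z ω * obsInd G arm (t + 1) i ω) := by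
      ext ω; ring
    rw [e2, integral_add (hZ'.integrable le_rfl)
      ((((hZ'.mul ho).mul hb).sub (hZ'.mul ho)).integrable le_rfl),
      integral_sub (((hZ'.mul ho).mul hb).integrable le_rfl) ((hZ'.mul ho).integrable le_rfl),
      hrun.integral_mul_obsInd_mul hβ hloss t hZ hcont i]
    have h1 := integral_exp_centered_le hloss i c
    have h2 : 0 ≤ ∫ ω, Z ω * obsInd G arm (t + 1) i ω ∂P :=
      integral_nonneg fun ω => mul_nonneg (hZ0 ω) (by unfold obsInd; positivity)
    nlinarith

omit hβ hloss in
theorem one_le_obsCount (hloop : ∀ i, G.Adj i i) {t : ℕ} (ht : Fintype.card V ≤ t) (i : V)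
    (ω : Ω) : 1 ≤ obsCount G (fun s => arm s ω) t i := by
  classical
  obtain ⟨σ, hσ, hσ'⟩ := hrun.initial
  obtain ⟨s, hs, rfl⟩ := hσ.surjOn (Set.mem_univ i)
  refine Finset.card_pos.2 ⟨s, Finset.mem_filter.2 ⟨Finset.mem_Icc.2 ⟨hs.1, hs.2.trans ht⟩, ?_⟩⟩
  simp only [hσ' s hs]
  exact hloop _

open Classical in
/-- Indicator that the confidence intervals of round `t` fail. -/
noncomputable def failInd (G : Digraph V) (P : Measure Ω) (loss : ℕ → Ω → V → ℝ)
    (arm : ℕ → Ω → V) (t : ℕ) (ω : Ω) : ℝ :=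
  if Confident G 4 (meanLoss P loss) (fun s => arm s ω) (fun s => loss s ω) t then 0 else 1

omit hβ in
theorem bddMeasurable_failInd (t : ℕ) :
    BddMeasurable (𝓕 t) (failInd G P loss arm (t + 1)) :=
  .ite (hrun.measurableSet_confident hloss _ _ t) (.const 0) (.const 1)

omit hβ hloss in
theorem failInd_le (hloop : ∀ i, G.Adj i i) {t : ℕ} (ht : Fintype.card V ≤ t) (ω : Ω) {v : ℝ}
    (hv : 4 * Real.log ((t + 1 : ℕ) * (Fintype.card V : ℝ) ^ (1 / (4 : ℝ))) = v) (hv0 : 0 ≤ v) :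
    failInd G P loss arm (t + 1) ω ≤ ∑ i, ∑ n ∈ Finset.Icc 1 t, Real.exp (-v) *
      (devExp G P loss arm t i (4 * Real.sqrt (v / (2 * n))) ω
        + devExp G P loss arm t i (-(4 * Real.sqrt (v / (2 * n)))) ω) := by
  have hpos : ∀ i : V, ∀ n : ℕ, 0 ≤ Real.exp (-v) *
      (devExp G P loss arm t i (4 * Real.sqrt (v / (2 * n))) ω
        + devExp G P loss arm t i (-(4 * Real.sqrt (v / (2 * n)))) ω) := fun i n =>
    mul_nonneg (Real.exp_nonneg _) (add_nonneg (Real.exp_nonneg _) (Real.exp_nonneg _))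
  unfold failInd
  split_ifs with h
  · exact Finset.sum_nonneg fun i _ => Finset.sum_nonneg fun n _ => hpos i n
  · simp only [Confident, not_forall, not_le, Nat.add_sub_cancel, confWidth] at h
    obtain ⟨i, hi⟩ := h
    rw [hv] at hi
    have hO1 := one_le_obsCount hrun hloop ht i ω
    have hOt := obsCount_le (G := G) (a := fun s => arm s ω) t i
    set O := obsCount G (fun s => arm s ω) t i with hO
    set L := obsLoss G (fun s => arm s ω) (fun s => loss s ω) t i with hL
    have hOr : (0 : ℝ) < O := by exact_mod_cast hO1
    refine le_trans ?_ (Finset.single_le_sum (f := fun i => ∑ n ∈ Finset.Icc 1 t, Real.exp (-v) *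
      (devExp G P loss arm t i (4 * Real.sqrt (v / (2 * n))) ω
        + devExp G P loss arm t i (-(4 * Real.sqrt (v / (2 * n)))) ω))
      (fun i _ => Finset.sum_nonneg fun n _ => hpos i n) (Finset.mem_univ i))
    refine le_trans ?_ (Finset.single_le_sum (f := fun n : ℕ => Real.exp (-v) *
      (devExp G P loss arm t i (4 * Real.sqrt (v / (2 * n))) ω
        + devExp G P loss arm t i (-(4 * Real.sqrt (v / (2 * n)))) ω))
      (fun n _ => hpos i n) (Finset.mem_Icc.2 ⟨hO1, hOt⟩))
    set w := Real.sqrt (v / (2 * O)) with hw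
    have hw0 : 0 ≤ w := Real.sqrt_nonneg _
    have hw2 : 2 * w ^ 2 * O = v := by
      rw [hw, Real.sq_sqrt (by positivity)]; field_simp
    have key : ∀ c : ℝ, v ≤ c * (L - O * meanLoss P loss i) - c ^ 2 / 8 * O →
        1 ≤ Real.exp (-v) * devExp G P loss arm t i c ω := by
      intro c hc
      rw [devExp, ← Real.exp_add]
      exact Real.one_le_exp (by rw [← hO, ← hL]; linarith)
    have hdiv : L / O * O = L := div_mul_cancel₀ _ hOr.ne'
    rw [mul_add]
    rcases lt_abs.1 hi with hlt | hlt
    · have h1 := key (4 * w) (by nlinarith [mul_lt_mul_of_pos_right hlt hOr])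
      have h2 : 0 ≤ Real.exp (-v) * devExp G P loss arm t i (-(4 * w)) ω :=
        mul_nonneg (Real.exp_nonneg _) (Real.exp_nonneg _)
      linarith
    · have h1 := key (-(4 * w)) (by nlinarith [mul_lt_mul_of_pos_right hlt hOr])
      have h2 : 0 ≤ Real.exp (-v) * devExp G P loss arm t i (4 * w) ω :=
        mul_nonneg (Real.exp_nonneg _) (Real.exp_nonneg _)
      linarith

theorem integral_failInd_le (hloop : ∀ i, G.Adj i i) {t : ℕ} (ht : Fintype.card V ≤ t) :
    ∫ ω, failInd G P loss arm (t + 1) ω ∂P ≤ 1 / ((t + 1 : ℕ) : ℝ) ^ 2 := by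
  have hK : (1 : ℝ) ≤ Fintype.card V := by exact_mod_cast Fintype.card_pos
  have ht1 : (1 : ℝ) ≤ t := hK.trans (by exact_mod_cast ht)
  set v := 4 * Real.log ((t + 1 : ℕ) * (Fintype.card V : ℝ) ^ (1 / (4 : ℝ))) with hv
  have hv' : v = 4 * Real.log (t + 1 : ℕ) + Real.log (Fintype.card V) := by
    rw [hv, Real.log_mul (by positivity) (by positivity), Real.log_rpow (by linarith)]
    ring
  have hv0 : 0 ≤ v := by
    rw [hv']
    have := Real.log_nonneg hK
    have := Real.log_nonneg (x := ((t + 1 : ℕ) : ℝ)) (by push_cast; linarith)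
    linarith
  have hev : Real.exp (-v) = 1 / (((t + 1 : ℕ) : ℝ) ^ 4 * Fintype.card V) := by
    rw [Real.exp_neg, hv', Real.exp_add, Real.exp_log (by linarith), mul_comm (4 : ℝ),
      Real.exp_mul, Real.exp_log (by positivity), one_div]
    norm_cast
  have hd := fun i c => devExp_spec hβ hloss hrun t i c
  have hterm : ∀ (i : V) (n : ℕ), BddMeasurable mΩ fun ω => Real.exp (-v) *
      (devExp G P loss arm t i (4 * Real.sqrt (v / (2 * n))) ω
        + devExp G P loss arm t i (-(4 * Real.sqrt (v / (2 * n)))) ω) := fun i n =>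
    ((((hd i _).1).add ((hd i _).1)).const_mul _).mono (𝓕.le t)
  have hle := ((bddMeasurable_failInd hloss hrun t).mono (𝓕.le t)).integral_mono (P := P)
    (.sum fun i _ => .sum fun n _ => hterm i n)
    (fun ω => failInd_le hrun hloop ht ω hv.symm hv0)
  refine hle.trans ?_
  rw [integral_finsetSum _ fun i _ =>
    (BddMeasurable.sum fun n (_ : n ∈ Finset.Icc 1 t) => hterm i n).integrable le_rfl]
  have hi : ∀ i : V, ∫ ω, ∑ n ∈ Finset.Icc 1 t, Real.exp (-v) *
      (devExp G P loss arm t i (4 * Real.sqrt (v / (2 * n))) ω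
        + devExp G P loss arm t i (-(4 * Real.sqrt (v / (2 * n)))) ω) ∂P
      ≤ t * (2 * Real.exp (-v)) := by
    intro i
    rw [integral_finsetSum _ fun n _ => (hterm i n).integrable le_rfl]
    refine (Finset.sum_le_card_nsmul _ _ (2 * Real.exp (-v)) fun n _ => ?_).trans (by simp)
    rw [integral_const_mul, integral_add ((hd i _).1.integrable (𝓕.le t))
      ((hd i _).1.integrable (𝓕.le t))]
    nlinarith [(hd i (4 * Real.sqrt (v / (2 * n)))).2, (hd i (-(4 * Real.sqrt (v / (2 * n))))).2,
      Real.exp_pos (-v)]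
  refine (Finset.sum_le_sum fun i _ => hi i).trans ?_
  rw [hev]
  simp only [Finset.sum_const, Finset.card_univ, nsmul_eq_mul]
  have : (Fintype.card V : ℝ) * (t * (2 * (1 / (((t + 1 : ℕ) : ℝ) ^ 4 * Fintype.card V))))
      = 2 * t / ((t + 1 : ℕ) : ℝ) ^ 4 := by field_simp
  rw [this, div_le_div_iff₀ (by positivity) (by positivity)]
  push_cast
  nlinarith [sq_nonneg ((t : ℝ) + 1), sq_nonneg (t : ℝ)]

end Concentration

section Estimates

variable {V Ω : Type*} [Fintype V] [Nonempty V] {mΩ : MeasurableSpace Ω} {G : Digraph V}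
  {P : Measure Ω} [IsProbabilityMeasure P] {𝓕 : Filtration ℕ mΩ}
  {loss : ℕ → Ω → V → ℝ} {arm : ℕ → Ω → V} {S : ℕ → Ω → Finset V}

theorem tuning_beta_pos : 0 < (tuning G).β := by norm_num [tuning]

/-- Probability with which arm `i` is observed at round `t`. -/
noncomputable def runObsProb (G : Digraph V) (loss : ℕ → Ω → V → ℝ) (arm : ℕ → Ω → V)
    (S : ℕ → Ω → Finset V) (t : ℕ) (i : V) (ω : Ω) : ℝ :=
  obsProb G (playProb G (tuning G) (fun s => arm s ω) (fun s => loss s ω) (fun s => S s ω) t) i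

/-- Importance-weighted loss estimate of round `t`. -/
noncomputable def estInc (G : Digraph V) (loss : ℕ → Ω → V → ℝ) (arm : ℕ → Ω → V)
    (S : ℕ → Ω → Finset V) (t : ℕ) (i : V) (ω : Ω) : ℝ :=
  (runObsProb G loss arm S t i ω)⁻¹ * obsInd G arm t i ω * loss t ω i

/-- Estimated cumulative loss after round `t`. -/
noncomputable def runEst (G : Digraph V) (loss : ℕ → Ω → V → ℝ) (arm : ℕ → Ω → V)
    (S : ℕ → Ω → Finset V) (t : ℕ) (ω : Ω) : V → ℝ :=
  estLoss G (tuning G) (fun s => arm s ω) (fun s => loss s ω) (fun s => S s ω) t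

theorem runEst_succ {t : ℕ} (ht : Fintype.card V ≤ t) (i : V) (ω : Ω) :
    runEst G loss arm S (t + 1) ω i = runEst G loss arm S t ω i + estInc G loss arm S (t + 1) i ω := by
  rw [runEst, estLoss]
  refine (if_pos (Nat.lt_succ_of_le ht)).trans ?_
  unfold estInc runObsProb obsInd playProb runEst
  congr 1
  split_ifs with h
  · simp [div_eq_mul_inv, mul_comm]
  · simp

theorem runEst_card (i : V) (ω : Ω) : runEst G loss arm S (Fintype.card V) ω i = 0 := by
  unfold runEst
  have : 0 < Fintype.card V := Fintype.card_pos
  cases h : Fintype.card V with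
  | zero => omega
  | succ n => rw [estLoss]; exact if_neg (by omega)

theorem runEst_eq_sum {t : ℕ} (ht : Fintype.card V ≤ t) (i : V) (ω : Ω) :
    runEst G loss arm S t ω i
      = ∑ s ∈ Finset.Ioc (Fintype.card V) t, estInc G loss arm S s i ω := by
  induction t, ht using Nat.le_induction with
  | base => simp [runEst_card]
  | succ n hn ih => rw [Finset.sum_Ioc_succ_top hn, runEst_succ hn, ih]

theorem obsInd_mem_Icc (t : ℕ) (i : V) (ω : Ω) : obsInd G arm t i ω ∈ Set.Icc (0 : ℝ) 1 := by
  unfold obsInd; split_ifs <;> simp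

theorem obsInd_sq (t : ℕ) (i : V) (ω : Ω) : obsInd G arm t i ω ^ 2 = obsInd G arm t i ω := by
  unfold obsInd; split_ifs <;> simp

theorem failInd_mem_Icc (t : ℕ) (ω : Ω) : failInd G P loss arm t ω ∈ Set.Icc (0 : ℝ) 1 := by
  unfold failInd; split_ifs <;> simp

theorem runObsProb_nonneg (t : ℕ) (i : V) (ω : Ω) : 0 ≤ runObsProb G loss arm S t i ω :=
  Finset.sum_nonneg fun j _ => playProb_nonneg tuning_beta_pos.le _ _ _ _ j

variable (hK : 2 ≤ Fintype.card V) (hloop : ∀ i, G.Adj i i) (hloss : IsStochasticLoss P 𝓕 loss)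
  (hrun : IsRun G (tuning G) P 𝓕 loss arm S)

include hloss in
theorem estInc_nonneg {t : ℕ} (ht : 1 ≤ t) (i : V) (ω : Ω) : 0 ≤ estInc G loss arm S t i ω :=
  mul_nonneg (mul_nonneg (inv_nonneg.2 (runObsProb_nonneg t i ω)) (obsInd_mem_Icc t i ω).1)
    (hloss.mem_Icc t ht ω i).1

include hloss in
theorem estInc_sq_le {t : ℕ} (ht : 1 ≤ t) (i : V) (ω : Ω) :
    estInc G loss arm S t i ω ^ 2 ≤ (runObsProb G loss arm S t i ω)⁻¹ ^ 2 * obsInd G arm t i ω := by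
  rw [estInc, mul_pow, mul_pow, obsInd_sq]
  have h := hloss.mem_Icc t ht ω i
  have h0 : 0 ≤ (runObsProb G loss arm S t i ω)⁻¹ ^ 2 * obsInd G arm t i ω :=
    mul_nonneg (sq_nonneg _) (obsInd_mem_Icc t i ω).1
  exact mul_le_of_le_one_right h0 (pow_le_one₀ h.1 h.2)

theorem tuning_lam_pos : 0 < (tuning G).lam := by
  have := one_le_strongIndepNum G
  simp only [tuning]
  exact_mod_cast this

include hK hloop hloss in
theorem exists_le_runObsProb {t : ℕ} (ht : Fintype.card V ≤ t) :
    ∃ c, 0 < c ∧ ∀ i ω, c ≤ runObsProb G loss arm S (t + 1) i ω := by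
  have ht' : (1 : ℝ) < ((t + 1 : ℕ) : ℝ) := by exact_mod_cast (by omega : 1 < t + 1)
  refine ⟨min (explCap V (tuning G).lam (t + 1)) (min ((tuning G).β * Real.log (t + 1 : ℕ)
    / (t + 1 : ℕ)) (4 / ((t + 1 : ℕ) : ℝ) ^ 2)), ?_, fun i ω => ?_⟩
  · have := Real.log_pos ht'
    have hb := tuning_beta_pos (G := G)
    exact lt_min (explCap_pos hK tuning_lam_pos (by omega))
      (lt_min (by positivity) (by positivity))
  · refine le_trans ?_ (le_obsProb (fun j => playProb_nonneg tuning_beta_pos.le _ _ _ _ j)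
      (hloop i))
    refine le_trans ?_ (le_mixedProb sum_explRate_le_half _ _ i)
    exact lower_le_explRate tuning_beta_pos.le gapEst_nonneg
      (gapEst_le_one fun s hs j => hloss.mem_Icc s hs ω j)

include hloss hrun

theorem bddMeasurable_runObsProb {t : ℕ} (ht : Fintype.card V ≤ t) (i : V) :
    BddMeasurable (𝓕 t) (runObsProb G loss arm S (t + 1) i) := by
  classical
  exact .sum fun j _ => hrun.bddMeasurable_playProb tuning_beta_pos.le hloss ht j

include hK hloop

theorem bddMeasurable_inv_runObsProb {t : ℕ} (ht : Fintype.card V ≤ t) (i : V) :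
    BddMeasurable (𝓕 t) fun ω => (runObsProb G loss arm S (t + 1) i ω)⁻¹ := by
  obtain ⟨c, hc, h⟩ := exists_le_runObsProb (arm := arm) (S := S) hK hloop hloss ht
  exact .inv (bddMeasurable_runObsProb hloss hrun ht i).measurable hc (h i)

theorem bddMeasurable_estInc {t : ℕ} (ht : Fintype.card V ≤ t) (i : V) :
    BddMeasurable (𝓕 (t + 1)) (estInc G loss arm S (t + 1) i) :=
  (((bddMeasurable_inv_runObsProb hK hloop hloss hrun ht i).mono (𝓕.mono (Nat.le_succ t))).mul
    (hrun.bddMeasurable_obsInd (Nat.le_add_left 1 t) i)).mul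
    (hloss.bddMeasurable_comp (continuous_apply i) (Nat.le_add_left 1 t))

theorem integral_mul_inv_mul_obsInd {t : ℕ} (ht : Fintype.card V ≤ t) (i : V) {Z : Ω → ℝ}
    (hZ : BddMeasurable (𝓕 t) Z) :
    ∫ ω, Z ω * (runObsProb G loss arm S (t + 1) i ω)⁻¹ * obsInd G arm (t + 1) i ω ∂P
      = ∫ ω, Z ω ∂P := by
  rw [hrun.integral_mul_obsInd tuning_beta_pos.le hloss ht
    (hZ.mul (bddMeasurable_inv_runObsProb hK hloop hloss hrun ht i)) i]
  obtain ⟨c, hc, h⟩ := exists_le_runObsProb (arm := arm) (S := S) hK hloop hloss ht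
  refine integral_congr_ae (Filter.Eventually.of_forall fun ω => ?_)
  exact inv_mul_cancel_right₀ (hc.trans_le (h i ω)).ne' _

theorem integral_mul_estInc {t : ℕ} (ht : Fintype.card V ≤ t) (i : V) {Z : Ω → ℝ}
    (hZ : BddMeasurable (𝓕 t) Z) :
    ∫ ω, Z ω * estInc G loss arm S (t + 1) i ω ∂P = (∫ ω, Z ω ∂P) * meanLoss P loss i := by
  have e : (fun ω => Z ω * estInc G loss arm S (t + 1) i ω) = fun ω =>
      Z ω * (runObsProb G loss arm S (t + 1) i ω)⁻¹ * obsInd G arm (t + 1) i ω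
        * loss (t + 1) ω i := by
    ext ω; simp only [estInc]; ring
  have h := hrun.integral_mul_obsInd_mul tuning_beta_pos.le hloss t
    (hZ.mul (bddMeasurable_inv_runObsProb hK hloop hloss hrun ht i)) (continuous_apply i) i
  rw [e, h, integral_mul_inv_mul_obsInd hK hloop hloss hrun ht i hZ]
  rfl

theorem integral_mul_inv_sq_mul_obsInd {t : ℕ} (ht : Fintype.card V ≤ t) (i : V) {Z : Ω → ℝ}
    (hZ : BddMeasurable (𝓕 t) Z) :
    ∫ ω, Z ω * ((runObsProb G loss arm S (t + 1) i ω)⁻¹ ^ 2 * obsInd G arm (t + 1) i ω) ∂P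
      = ∫ ω, Z ω * (runObsProb G loss arm S (t + 1) i ω)⁻¹ ∂P := by
  rw [← integral_mul_inv_mul_obsInd hK hloop hloss hrun ht i
    (hZ.mul (bddMeasurable_inv_runObsProb hK hloop hloss hrun ht i))]
  refine integral_congr_ae (Filter.Eventually.of_forall fun ω => ?_)
  simp only; ring

omit hK hloop hloss hrun in
theorem exp_le_one_add_add_sq {y : ℝ} (hy : y ≤ 1) : Real.exp y ≤ 1 + y + y ^ 2 := by
  rcases le_total 0 y with h | h
  · have := (abs_le.1 (Real.abs_exp_sub_one_sub_id_le (x := y) (abs_le.2 ⟨by linarith, hy⟩))).2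
    linarith
  · have := exp_neg_le_quadratic (x := -y) (by linarith)
    rw [neg_neg] at this
    nlinarith [sq_nonneg y]

theorem integral_mul_exp_estInc_le {t : ℕ} (ht : Fintype.card V ≤ t) (i k : V) {ρ θ : ℝ}
    (hθ : 0 ≤ θ) (hθρ : θ ≤ ρ) (hρ : 0 < ρ) {Z : Ω → ℝ} (hZ : BddMeasurable (𝓕 t) Z)
    (hZ0 : ∀ ω, 0 ≤ Z ω)
    (hi : ∀ ω, Z ω ≠ 0 → ρ ≤ runObsProb G loss arm S (t + 1) i ω)
    (hk : ∀ ω, Z ω ≠ 0 → ρ ≤ runObsProb G loss arm S (t + 1) k ω) :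
    ∫ ω, Z ω * Real.exp (-θ * (estInc G loss arm S (t + 1) i ω
        - estInc G loss arm S (t + 1) k ω)) ∂P
      ≤ Real.exp (-(θ * (meanLoss P loss i - meanLoss P loss k) - 2 * θ ^ 2 / ρ))
        * ∫ ω, Z ω ∂P := by
  have hZ' := hZ.mono (𝓕.le t)
  have hX := fun j => (bddMeasurable_estInc hK hloop hloss hrun ht j).mono (𝓕.le (t + 1))
  have hO := fun j => (hrun.bddMeasurable_obsInd (Nat.le_add_left 1 t) j).mono (𝓕.le (t + 1))
  have hQ := fun j => (bddMeasurable_inv_runObsProb hK hloop hloss hrun ht j).mono (𝓕.le t)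
  set X := fun j => estInc G loss arm S (t + 1) j with hXdef
  set Q := fun j ω => (runObsProb G loss arm S (t + 1) j ω)⁻¹ with hQdef
  have hpt : ∀ ω, Z ω * Real.exp (-θ * (X i ω - X k ω)) ≤ Z ω - θ * (Z ω * X i ω)
      + θ * (Z ω * X k ω) + θ ^ 2 * (Z ω * (Q i ω ^ 2 * obsInd G arm (t + 1) i ω))
      + θ ^ 2 * (Z ω * (Q k ω ^ 2 * obsInd G arm (t + 1) k ω)) := by
    intro ω
    by_cases h : Z ω = 0
    · simp [h]
    have hx := fun j => estInc_nonneg (G := G) (arm := arm) (S := S) hloss (Nat.le_add_left 1 t) j ω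
    have hsq := fun j => estInc_sq_le (G := G) (arm := arm) (S := S) hloss (Nat.le_add_left 1 t) j ω
    have hxk : X k ω ≤ ρ⁻¹ := by
      have h1 : (runObsProb G loss arm S (t + 1) k ω)⁻¹ ≤ ρ⁻¹ := inv_anti₀ hρ (hk ω h)
      have h2 := obsInd_mem_Icc (G := G) (arm := arm) (t + 1) k ω
      have h3 := hloss.mem_Icc (t + 1) (Nat.le_add_left 1 t) ω k
      have h4 : 0 ≤ (runObsProb G loss arm S (t + 1) k ω)⁻¹ := inv_nonneg.2 (runObsProb_nonneg _ _ _)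
      refine le_trans ?_ h1
      exact (mul_le_of_le_one_right (mul_nonneg h4 h2.1) h3.2).trans
        (mul_le_of_le_one_right h4 h2.2)
    have h1 : -θ * (X i ω - X k ω) ≤ 1 := by
      have h2 : θ * X k ω ≤ ρ * ρ⁻¹ := mul_le_mul hθρ hxk (hx k) hρ.le
      rw [mul_inv_cancel₀ hρ.ne'] at h2
      have h3 : 0 ≤ θ * X i ω := mul_nonneg hθ (hx i)
      linarith
    have h2 := exp_le_one_add_add_sq h1
    have h3 : (X i ω - X k ω) ^ 2 ≤ Q i ω ^ 2 * obsInd G arm (t + 1) i ω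
        + Q k ω ^ 2 * obsInd G arm (t + 1) k ω := by
      have := hsq i
      have := hsq k
      nlinarith [mul_nonneg (hx i) (hx k)]
    have h4 := mul_le_mul_of_nonneg_left h2 (hZ0 ω)
    have h5 := mul_le_mul_of_nonneg_left h3 (mul_nonneg (hZ0 ω) (sq_nonneg θ))
    nlinarith
  have b1 := (hZ'.mul (hX i)).const_mul θ
  have b2 := (hZ'.mul (hX k)).const_mul θ
  have b3 := (hZ'.mul (((hQ i).pow 2).mul (hO i))).const_mul (θ ^ 2)
  have b4 := (hZ'.mul (((hQ k).pow 2).mul (hO k))).const_mul (θ ^ 2)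
  have hle := (hZ'.mul ((((hX i).sub (hX k)).const_mul (-θ)).exp)).integral_mono (P := P)
    ((((hZ'.sub b1).add b2).add b3).add b4) hpt
  refine hle.trans ?_
  rw [integral_add ((((hZ'.sub b1).add b2).add b3).integrable le_rfl) (b4.integrable le_rfl),
    integral_add (((hZ'.sub b1).add b2).integrable le_rfl) (b3.integrable le_rfl),
    integral_add ((hZ'.sub b1).integrable le_rfl) (b2.integrable le_rfl),
    integral_sub (hZ'.integrable le_rfl) (b1.integrable le_rfl)]
  simp only [integral_const_mul]
  rw [integral_mul_estInc hK hloop hloss hrun ht i hZ, integral_mul_estInc hK hloop hloss hrun ht k hZ,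
    integral_mul_inv_sq_mul_obsInd hK hloop hloss hrun ht i hZ,
    integral_mul_inv_sq_mul_obsInd hK hloop hloss hrun ht k hZ]
  have hq : ∀ j, (∀ ω, Z ω ≠ 0 → ρ ≤ runObsProb G loss arm S (t + 1) j ω) →
      ∫ ω, Z ω * (runObsProb G loss arm S (t + 1) j ω)⁻¹ ∂P ≤ ρ⁻¹ * ∫ ω, Z ω ∂P := by
    intro j hj
    rw [← integral_const_mul]
    refine (hZ'.mul (hQ j)).integral_mono (hZ'.const_mul _) fun ω => ?_
    by_cases h : Z ω = 0
    · simp [h]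
    · rw [mul_comm]
      exact mul_le_mul_of_nonneg_right (inv_anti₀ hρ (hj ω h)) (hZ0 ω)
  have h1 := mul_le_mul_of_nonneg_left (hq i hi) (sq_nonneg θ)
  have h2 := mul_le_mul_of_nonneg_left (hq k hk) (sq_nonneg θ)
  have h3 := Real.add_one_le_exp (-(θ * (meanLoss P loss i - meanLoss P loss k) - 2 * θ ^ 2 / ρ))
  have h4 := mul_le_mul_of_nonneg_right h3 (integral_nonneg hZ0 : 0 ≤ ∫ ω, Z ω ∂P)
  refine le_trans ?_ h4
  rw [div_eq_mul_inv]
  linarith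

omit hK hloop in
theorem integral_mul_exp_obsInd_le {t : ℕ} (ht : Fintype.card V ≤ t) (i : V) {ρ : ℝ}
    {Z : Ω → ℝ} (hZ : BddMeasurable (𝓕 t) Z) (hZ0 : ∀ ω, 0 ≤ Z ω)
    (hi : ∀ ω, Z ω ≠ 0 → ρ ≤ runObsProb G loss arm S (t + 1) i ω) :
    ∫ ω, Z ω * Real.exp (-obsInd G arm (t + 1) i ω) ∂P
      ≤ Real.exp (-((1 - Real.exp (-1)) * ρ)) * ∫ ω, Z ω ∂P := by
  have hZ' := hZ.mono (𝓕.le t)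
  have hO := (hrun.bddMeasurable_obsInd (Nat.le_add_left 1 t) i).mono (𝓕.le (t + 1))
  have hp := (bddMeasurable_runObsProb hloss hrun ht i).mono (𝓕.le t)
  have hκ : 0 ≤ 1 - Real.exp (-1) := by
    have : Real.exp (-1) ≤ 1 := Real.exp_le_one_iff.2 (by norm_num)
    linarith
  have e : (fun ω => Z ω * Real.exp (-obsInd G arm (t + 1) i ω)) =
      fun ω => Z ω - (1 - Real.exp (-1)) * (Z ω * obsInd G arm (t + 1) i ω) := by
    ext ω
    by_cases h : G.Adj (arm (t + 1) ω) i
    · simp [obsInd, h]; ring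
    · simp [obsInd, h]
  have h0 := hrun.integral_mul_obsInd tuning_beta_pos.le hloss ht hZ i
  rw [e, integral_sub (hZ'.integrable le_rfl) (((hZ'.mul hO).const_mul _).integrable le_rfl),
    integral_const_mul, h0]
  have h1 : ρ * ∫ ω, Z ω ∂P ≤ ∫ ω, Z ω * runObsProb G loss arm S (t + 1) i ω ∂P := by
    rw [← integral_const_mul]
    refine (hZ'.const_mul _).integral_mono (hZ'.mul hp) fun ω => ?_
    by_cases h : Z ω = 0
    · simp [h]
    · rw [mul_comm]
      exact mul_le_mul_of_nonneg_left (hi ω h) (hZ0 ω)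
  have h2 := mul_le_mul_of_nonneg_left h1 hκ
  have h3 := Real.add_one_le_exp (-((1 - Real.exp (-1)) * ρ))
  have h4 := mul_le_mul_of_nonneg_right h3 (integral_nonneg hZ0 : 0 ≤ ∫ ω, Z ω ∂P)
  refine le_trans ?_ h4
  have h5 : ∫ ω, Z ω * runObsProb G loss arm S (t + 1) i ω ∂P = ∫ ω, Z ω *
    obsProb G (playProb G (tuning G) (fun s => arm s ω) (fun s => loss s ω)
        (fun s => S s ω) (t + 1)) i ∂P := rfl
  rw [h5] at h2
  linarith

omit hK hloop in
/-- Exponential supermartingale along the confident rounds; the other rounds contribute the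
deterministic factor `exp (-κ)`. -/
theorem integral_exp_sum_le {X : ℕ → Ω → ℝ} {n : ℕ} {κ : ℝ} (hn : Fintype.card V ≤ n)
    (hX : ∀ s, Fintype.card V < s → BddMeasurable (𝓕 s) (X s))
    (hstep : ∀ t, Fintype.card V ≤ t → t < n → ∀ Z : Ω → ℝ, BddMeasurable (𝓕 t) Z →
      (∀ ω, 0 ≤ Z ω) → (∀ ω, Z ω ≠ 0 → failInd G P loss arm (t + 1) ω = 0) →
      ∫ ω, Z ω * Real.exp (-X (t + 1) ω) ∂P ≤ Real.exp (-κ) * ∫ ω, Z ω ∂P) :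
    BddMeasurable mΩ (fun ω => Real.exp (∑ s ∈ Finset.Ioc (Fintype.card V) n,
      (-(1 - failInd G P loss arm s ω) * X s ω - failInd G P loss arm s ω * κ))) ∧
    ∫ ω, Real.exp (∑ s ∈ Finset.Ioc (Fintype.card V) n,
      (-(1 - failInd G P loss arm s ω) * X s ω - failInd G P loss arm s ω * κ)) ∂P
      ≤ Real.exp (-(κ * (n - Fintype.card V))) := by
  have hF : ∀ s, Fintype.card V < s → BddMeasurable (𝓕 (s - 1)) (failInd G P loss arm s) := by
    intro s hs
    obtain ⟨s, rfl⟩ : ∃ r, s = r + 1 := ⟨s - 1, by omega⟩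
    exact bddMeasurable_failInd hloss hrun s
  have hY : ∀ s, Fintype.card V < s → BddMeasurable (𝓕 s) fun ω => Real.exp
      (-(1 - failInd G P loss arm s ω) * X s ω - failInd G P loss arm s ω * κ) := by
    intro s hs
    have h1 := (hF s hs).mono (𝓕.mono (Nat.sub_le s 1))
    exact ((((BddMeasurable.const 1).sub h1).neg.mul (hX s hs)).sub (h1.mul (.const κ))).exp
  simp only [Real.exp_sum]
  refine ⟨(bddMeasurable_prod hn hY).mono (𝓕.le n), ?_⟩
  refine (integral_prod_le_pow (Real.exp_nonneg (-κ)) hn hY (fun s ω => Real.exp_nonneg _)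
    ?_).trans (le_of_eq ?_)
  · intro t ht htn Z hZ hZ0
    have hFt := bddMeasurable_failInd (arm := arm) hloss hrun t
    have hFm := failInd_mem_Icc (G := G) (P := P) (loss := loss) (arm := arm) (t + 1)
    have hZF : BddMeasurable (𝓕 t) fun ω => Z ω * (1 - failInd G P loss arm (t + 1) ω) :=
      hZ.mul ((BddMeasurable.const 1).sub hFt)
    have e : (fun ω => Z ω * Real.exp (-(1 - failInd G P loss arm (t + 1) ω) * X (t + 1) ω
        - failInd G P loss arm (t + 1) ω * κ)) = fun ω =>
        Z ω * (1 - failInd G P loss arm (t + 1) ω) * Real.exp (-X (t + 1) ω)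
        + Real.exp (-κ) * (Z ω * failInd G P loss arm (t + 1) ω) := by
      ext ω
      unfold failInd
      split_ifs <;> simp [mul_comm]
    have h1 := hstep t ht htn _ hZF
      (fun ω => mul_nonneg (hZ0 ω) (by have := (hFm ω).2; linarith)) (by
        intro ω h
        unfold failInd at h ⊢
        split_ifs at h ⊢ <;> simp_all)
    have b1 := (hZF.mono (𝓕.le t)).mul
      ((hX (t + 1) (by omega)).neg.exp.mono (𝓕.le (t + 1)))
    have b2 := (hZ.mul hFt).mono (𝓕.le t)
    rw [e, integral_add (b1.integrable le_rfl) ((b2.const_mul _).integrable le_rfl),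
      integral_const_mul]
    refine (add_le_add_left h1 _).trans (le_of_eq ?_)
    rw [← mul_add, ← integral_add ((hZF.mono (𝓕.le t)).integrable le_rfl) (b2.integrable le_rfl)]
    congr 2
    ext ω; ring
  · rw [← Real.exp_nat_mul, Nat.cast_sub hn]
    congr 1; ring

end Estimates

section StochasticRounds

variable {V Ω : Type*} [Fintype V] [Nonempty V] {mΩ : MeasurableSpace Ω} {G : Digraph V}
  {P : Measure Ω} [IsProbabilityMeasure P] {𝓕 : Filtration ℕ mΩ}
  {loss : ℕ → Ω → V → ℝ} {arm : ℕ → Ω → V} {S : ℕ → Ω → Finset V}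

theorem gap_eq (i : V) : gap P loss i = meanLoss P loss i - ⨅ j, meanLoss P loss j := rfl

theorem gap_nonneg (i : V) : 0 ≤ gap P loss i := by
  rw [gap_eq, sub_nonneg]
  exact ciInf_le (Set.finite_range _).bddBelow i

theorem gap_le_one (hloss : IsStochasticLoss P 𝓕 loss) (i : V) : gap P loss i ≤ 1 := by
  have h1 := (meanLoss_mem_Icc hloss i).2
  have h2 := le_ciInf fun j => (meanLoss_mem_Icc hloss j).1
  rw [gap_eq]
  linarith

theorem exists_meanLoss_eq_iInf : ∃ k, meanLoss P loss k = ⨅ j, meanLoss P loss j :=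
  exists_eq_ciInf_of_finite

theorem one_le_log {t : ℕ} (ht : 3 ≤ t) : 1 ≤ Real.log t := by
  rw [Real.le_log_iff_exp_le (by positivity)]
  have h1 := Real.exp_one_lt_d9
  have h2 : (3 : ℝ) ≤ t := by exact_mod_cast ht
  linarith

theorem log_div_anti {s t : ℕ} (hs : 3 ≤ s) (hst : s ≤ t) :
    Real.log t / t ≤ Real.log s / s := by
  have h1 := Real.exp_one_lt_d9
  have h2 : (3 : ℝ) ≤ s := by exact_mod_cast hs
  have h3 : (s : ℝ) ≤ t := by exact_mod_cast hst
  exact Real.log_div_self_antitoneOn (by simp; linarith) (by simp; linarith) h3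

theorem exp_neg_two_mul_log {t : ℕ} (ht : 0 < t) {x : ℝ} (hx : 2 * Real.log t ≤ x) :
    Real.exp (-x) ≤ 1 / (t : ℝ) ^ 2 := by
  have ht' : (0 : ℝ) < t := by exact_mod_cast ht
  refine (Real.exp_le_exp.2 (neg_le_neg hx)).trans (le_of_eq ?_)
  rw [Real.exp_neg, mul_comm, Real.exp_mul, Real.exp_log ht', one_div]
  norm_cast

theorem failInd_eq_zero {t : ℕ} {ω : Ω} (h : failInd G P loss arm t ω = 0) :
    Confident G 4 (meanLoss P loss) (fun s => arm s ω) (fun s => loss s ω) t := by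
  unfold failInd at h
  split_ifs at h with h'
  · exact h'
  · norm_num at h

theorem failInd_cases (t : ℕ) (ω : Ω) :
    failInd G P loss arm t ω = 0 ∨ failInd G P loss arm t ω = 1 := by
  unfold failInd
  split_ifs <;> simp

/-- At round `t` the gap-dependent exploration rate is the active one for all gaps `≥ D`. -/
def LateRound (G : Digraph V) (D : ℝ) (t : ℕ) : Prop :=
  320 * Real.log t / (t * D ^ 2) ≤ explCap V (tuning G).lam t

theorem LateRound.card_mul_le {D : ℝ} (hD : 0 < D) {t : ℕ} (ht : 0 < t) (h : LateRound G D t) :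
    640 * Fintype.card V * Real.log t ≤ t * D ^ 2 := by
  have ht' : (0 : ℝ) < t := by exact_mod_cast ht
  have hK : (0 : ℝ) < Fintype.card V := by exact_mod_cast Fintype.card_pos
  have h1 := h.trans (min_le_left _ _)
  rw [div_le_div_iff₀ (by positivity) (by positivity)] at h1
  linarith

theorem LateRound.card_le {D : ℝ} (hD : 0 < D) (hD1 : D ≤ 1) {t : ℕ} (ht : 3 ≤ t)
    (h : LateRound G D t) : 640 * (Fintype.card V : ℝ) ≤ t := by
  have h1 := h.card_mul_le hD (by omega)
  have h2 := one_le_log ht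
  have h3 : D ^ 2 ≤ 1 := pow_le_one₀ hD.le hD1
  have h4 : (0 : ℝ) ≤ t := by positivity
  have hK : (0 : ℝ) ≤ Fintype.card V := by positivity
  nlinarith

theorem LateRound.le_rate_mul {D : ℝ} (hD : 0 < D) (hD1 : D ≤ 1) {t : ℕ} (ht : 3 ≤ t)
    (h : LateRound G D t) : 10 * Real.log t ≤ (tuning G).η t * t * D := by
  have ht' : (0 : ℝ) < t := by exact_mod_cast (by omega : 0 < t)
  have hK : (1 : ℝ) ≤ Fintype.card V := by exact_mod_cast Fintype.card_pos
  have ha : (1 : ℝ) ≤ strongIndepNum G := by exact_mod_cast one_le_strongIndepNum G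
  have haK : (strongIndepNum G : ℝ) ≤ Fintype.card V := by exact_mod_cast strongIndepNum_le_card G
  have hl := one_le_log ht
  have hlK : 0 ≤ Real.log (Fintype.card V) := Real.log_nonneg hK
  have h1 := h.trans (min_le_right _ _)
  simp only [tuning] at h1 ⊢
  set a : ℝ := (strongIndepNum G : ℝ)
  set K : ℝ := (Fintype.card V : ℝ)
  set l := Real.log t
  have h2 : 640 * l / (t * D ^ 2) ≤ Real.sqrt (a * Real.log K / (t * K ^ 2)) := by
    have : 640 * l / (t * D ^ 2) = 2 * (320 * l / (t * D ^ 2)) := by ring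
    linarith
  rw [Real.le_sqrt (by positivity) (by positivity), div_pow,
    div_le_div_iff₀ (by positivity) (by positivity)] at h2
  have h3 : (640 * l * K) ^ 2 ≤ a * Real.log K * t * D ^ 4 := by
    have : (640 * l) ^ 2 * (t * K ^ 2) = (640 * l * K) ^ 2 * t := by ring
    have h' : a * Real.log K * (t * D ^ 2) ^ 2 = a * Real.log K * t * D ^ 4 * t := by ring
    rw [this, h'] at h2
    exact le_of_mul_le_mul_right h2 ht'
  have h4 : 10 * l / (t * D) ≤ Real.sqrt (Real.log K / (2 * a * t)) := by
    rw [Real.le_sqrt (by positivity) (by positivity), div_pow,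
      div_le_div_iff₀ (by positivity) (by positivity)]
    have e1 : (10 * l) ^ 2 * (2 * a * t) = 200 * (l ^ 2 * a) * t := by ring
    have e2 : Real.log K * (t * D) ^ 2 = Real.log K * t * D ^ 2 * t := by ring
    rw [e1, e2]
    refine mul_le_mul_of_nonneg_right ?_ ht'.le
    have h5 : 200 * (l ^ 2 * a) * a ≤ (640 * l * K) ^ 2 := by
      have : a * a ≤ K * K := mul_le_mul haK haK (by linarith) (by linarith)
      nlinarith [sq_nonneg l, mul_le_mul_of_nonneg_left this (sq_nonneg l)]
    have h6 : a * Real.log K * t * D ^ 4 ≤ Real.log K * t * D ^ 2 * a := by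
      have h7 : D ^ 4 ≤ D ^ 2 := pow_le_pow_of_le_one hD.le hD1 (by norm_num)
      have h8 : 0 ≤ a * Real.log K * t := by positivity
      nlinarith [mul_le_mul_of_nonneg_left h7 h8]
    exact le_of_mul_le_mul_right ((h5.trans h3).trans h6) (by linarith)
  have h5 := mul_le_mul_of_nonneg_right h4 (by positivity : 0 ≤ t * D)
  rw [div_mul_cancel₀ _ (by positivity)] at h5
  linarith

theorem confWidth_le {a : ℕ → V} {t : ℕ} (ht : 3 ≤ t) (hKt : Fintype.card V ≤ t) {i : V}
    {δ : ℝ} (hδ : 0 < δ) (hO : 160 * Real.log t / δ ^ 2 ≤ obsCount G a (t - 1) i) :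
    confWidth G 4 a t i ≤ δ / 8 := by
  have hK : (1 : ℝ) ≤ Fintype.card V := by exact_mod_cast Fintype.card_pos
  have hKt' : (Fintype.card V : ℝ) ≤ t := by exact_mod_cast hKt
  have hl := one_le_log ht
  have hlK := Real.log_le_log (by linarith) hKt'
  have hO' : (0 : ℝ) < obsCount G a (t - 1) i := lt_of_lt_of_le (by positivity) hO
  unfold confWidth
  rw [Real.sqrt_le_left (by positivity), div_le_iff₀ (by positivity),
    Real.log_mul (by positivity) (by positivity), Real.log_rpow (by linarith)]
  rw [div_le_iff₀ (by positivity)] at hO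
  nlinarith

variable (hK : 2 ≤ Fintype.card V) (hloop : ∀ i, G.Adj i i) (hloss : IsStochasticLoss P 𝓕 loss)
  (hrun : IsRun G (tuning G) P 𝓕 loss arm S)

include hK hloop hloss hrun in
theorem LateRound.le_runObsProb {D : ℝ} (hD : 0 < D) {t : ℕ} (h : LateRound G D t) {s : ℕ}
    (hs : Fintype.card V ≤ s) (hst : s + 1 ≤ t) {ω : Ω}
    (hF : failInd G P loss arm (s + 1) ω = 0) {δ : ℝ} (hδ : D ≤ δ) {j : V}
    (hj : gap P loss j ≤ δ) :
    320 * Real.log t / (t * δ ^ 2) ≤ runObsProb G loss arm S (s + 1) j ω := by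
  have ht' : (0 : ℝ) < t := by exact_mod_cast (by omega : 0 < t)
  have hl := one_le_log (t := t) (by omega)
  refine (failInd_eq_zero hF).le_obsProb hloop (prm := tuning G) tuning_beta_pos.le
    (meanLoss_mem_Icc hloss) (hrun.expl_greedy s hs ω) j ?_ ?_
  · refine le_trans ?_ (explCap_anti tuning_lam_pos.le (Nat.le_add_left 1 s) hst)
    refine le_trans ?_ h
    gcongr
  · intro hpos
    rw [← gap_eq] at hpos ⊢
    have h1 := log_div_anti (s := s + 1) (t := t) (by omega) hst
    have h2 : 320 * Real.log t / (t * δ ^ 2) = 320 * (Real.log t / t) / δ ^ 2 := by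
      field_simp
    have h3 : (tuning G).β * Real.log (s + 1 : ℕ) / ((s + 1 : ℕ) * gap P loss j ^ 2)
        = 320 * (Real.log (s + 1 : ℕ) / (s + 1 : ℕ)) / gap P loss j ^ 2 := by
      simp only [tuning]; field_simp
    rw [h2, h3]
    have h4 : 0 ≤ Real.log t / t := by positivity
    gcongr

/-- Weight of the rounds `s ≤ n` without confidence, with respect to the arm `k`. -/
noncomputable def failWeight (G : Digraph V) (P : Measure Ω) (loss : ℕ → Ω → V → ℝ)
    (arm : ℕ → Ω → V) (S : ℕ → Ω → Finset V) (k : V) (n : ℕ) (ω : Ω) : ℝ :=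
  ∑ s ∈ Finset.Ioc (Fintype.card V) n,
    failInd G P loss arm s ω * (estInc G loss arm S s k ω + 1)

include hloss in
theorem failWeight_nonneg (k : V) (n : ℕ) (ω : Ω) : 0 ≤ failWeight G P loss arm S k n ω :=
  Finset.sum_nonneg fun s hs => mul_nonneg (failInd_mem_Icc s ω).1
    (add_nonneg (estInc_nonneg hloss (by rw [Finset.mem_Ioc] at hs; omega) k ω) zero_le_one)

include hloss in
theorem sum_failInd_le_failWeight (k : V) (n : ℕ) (ω : Ω) :
    ∑ s ∈ Finset.Ioc (Fintype.card V) n, failInd G P loss arm s ω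
      ≤ failWeight G P loss arm S k n ω := by
  refine Finset.sum_le_sum fun s hs => ?_
  have h1 := (failInd_mem_Icc (G := G) (P := P) (loss := loss) (arm := arm) s ω).1
  have h2 := estInc_nonneg (G := G) (arm := arm) (S := S) hloss
    (t := s) (by rw [Finset.mem_Ioc] at hs; omega) k ω
  nlinarith

include hK hloop hloss hrun

theorem failWeight_spec (k : V) (n : ℕ) :
    BddMeasurable mΩ (failWeight G P loss arm S k n) ∧
      ∫ ω, failWeight G P loss arm S k n ω ∂P ≤ 1 := by
  have hm : ∀ s ∈ Finset.Ioc (Fintype.card V) n, BddMeasurable mΩ fun ω =>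
      failInd G P loss arm s ω * (estInc G loss arm S s k ω + 1) := by
    intro s hs
    rw [Finset.mem_Ioc] at hs
    obtain ⟨s, rfl⟩ : ∃ r, s = r + 1 := ⟨s - 1, by omega⟩
    exact ((bddMeasurable_failInd hloss hrun s).mono (𝓕.le s)).mul
      (((bddMeasurable_estInc hK hloop hloss hrun (by omega) k).mono (𝓕.le _)).add (.const 1))
  refine ⟨.sum hm, ?_⟩
  unfold failWeight
  rw [integral_finsetSum _ fun s hs => (hm s hs).integrable le_rfl]
  have hle : ∀ s ∈ Finset.Ioc (Fintype.card V) n, ∫ ω, failInd G P loss arm s ω *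
      (estInc G loss arm S s k ω + 1) ∂P ≤ 2 * (1 / (s : ℝ) ^ 2) := by
    intro s hs
    rw [Finset.mem_Ioc] at hs
    obtain ⟨s, rfl⟩ : ∃ r, s = r + 1 := ⟨s - 1, by omega⟩
    have hF := bddMeasurable_failInd (arm := arm) hloss hrun s
    have hX := bddMeasurable_estInc hK hloop hloss hrun (by omega : Fintype.card V ≤ s) k
    simp only [mul_add, mul_one]
    rw [integral_add (((hF.mono (𝓕.le s)).mul (hX.mono (𝓕.le _))).integrable le_rfl)
      (hF.integrable (𝓕.le s)),
      integral_mul_estInc hK hloop hloss hrun (by omega) k hF]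
    have h1 := integral_failInd_le tuning_beta_pos.le hloss hrun hloop
      (by omega : Fintype.card V ≤ s)
    have h2 := meanLoss_mem_Icc hloss k
    have h3 : 0 ≤ ∫ ω, failInd G P loss arm (s + 1) ω ∂P :=
      integral_nonneg fun ω => (failInd_mem_Icc (s + 1) ω).1
    nlinarith [h2.1, h2.2]
  refine (Finset.sum_le_sum hle).trans ?_
  rw [← Finset.mul_sum]
  have h1 := sum_one_div_sq_le (m := Fintype.card V) (n := n) (by omega)
  have h2 : 1 / (Fintype.card V : ℝ) ≤ 1 / 2 := by
    have : (2 : ℝ) ≤ Fintype.card V := by exact_mod_cast hK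
    gcongr
  linarith

/-- Few observations of an arm are unlikely. -/
theorem exists_count_bound {D : ℝ} (hD : 0 < D) (hD1 : D ≤ 1) {n : ℕ}
    (hn : Fintype.card V ≤ n) (h : LateRound G D (n + 1)) {δ : ℝ} (hδ : D ≤ δ) (hδ1 : δ ≤ 1)
    {j : V} (hj : gap P loss j ≤ δ) (k : V) :
    ∃ B : Ω → ℝ, BddMeasurable mΩ B ∧ (∀ ω, 0 ≤ B ω) ∧
      ∫ ω, B ω ∂P ≤ 1 / ((n + 1 : ℕ) : ℝ) ^ 2 ∧
      ∀ ω, failWeight G P loss arm S k n ω < (n + 1 : ℕ) * D / 100 →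
        (obsCount G (fun s => arm s ω) n j : ℝ) < 160 * Real.log (n + 1 : ℕ) / δ ^ 2 → 1 ≤ B ω := by
  set t := n + 1 with ht
  have ht0 : (0 : ℝ) < t := by exact_mod_cast (by omega : 0 < t)
  have hδ0 : 0 < δ := hD.trans_le hδ
  have hl := one_le_log (t := t) (by omega)
  set ρ := 320 * Real.log t / (t * δ ^ 2) with hρ
  have hρ0 : 0 < ρ := by positivity
  set κ := (1 - Real.exp (-1)) * ρ with hκ
  have he1 : 0.63 ≤ 1 - Real.exp (-1) := by
    have h1 := Real.exp_one_gt_d9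
    have h2 : Real.exp (-1) ≤ 1 / 2.71 := by
      rw [Real.exp_neg, one_div]
      exact inv_anti₀ (by norm_num) (by linarith)
    norm_num at h2 ⊢
    linarith
  have he2 : 1 - Real.exp (-1) ≤ 1 := by linarith [Real.exp_pos (-1)]
  obtain ⟨hm, hint⟩ := integral_exp_sum_le (P := P) (arm := arm) (X := fun s => obsInd G arm s j)
    (κ := κ) hloss hrun hn (fun s hs => hrun.bddMeasurable_obsInd (by omega) j)
    (fun s hs hsn Z hZ hZ0 hZF => integral_mul_exp_obsInd_le hloss hrun hs j hZ hZ0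
      fun ω hω => h.le_runObsProb hK hloop hloss hrun hD hs (by omega) (hZF ω hω) hδ hj)
  have htρ : t * ρ = 320 * Real.log t / δ ^ 2 := by rw [hρ]; field_simp
  refine ⟨_, hm.const_mul (Real.exp (0.51 * (t * ρ))), fun ω => by positivity, ?_, ?_⟩
  · rw [integral_const_mul]
    refine (mul_le_mul_of_nonneg_left hint (Real.exp_nonneg _)).trans ?_
    rw [← Real.exp_add, ← neg_neg (0.51 * (t * ρ) + _)]
    refine exp_neg_two_mul_log (by omega) ?_
    have h1 := h.card_le hD hD1 (by omega)
    have hK1 : (2 : ℝ) ≤ Fintype.card V := by exact_mod_cast hK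
    have h2 : (0.99 : ℝ) * t ≤ n - Fintype.card V := by
      have : (t : ℝ) = n + 1 := by rw [ht]; push_cast; ring
      linarith
    have h3 : 0.63 * ρ * (0.99 * t) ≤ κ * (n - Fintype.card V) :=
      mul_le_mul (by rw [hκ]; gcongr) h2 (by positivity) (by rw [hκ]; nlinarith)
    have h4 : 320 * Real.log t ≤ t * ρ := by
      rw [htρ, le_div_iff₀ (by positivity)]
      have : δ ^ 2 ≤ 1 := pow_le_one₀ hδ0.le hδ1
      nlinarith
    linarith
  · intro ω hW hO
    rw [← Real.exp_add]
    refine Real.one_le_exp ?_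
    have h1 : ∑ s ∈ Finset.Ioc (Fintype.card V) n, obsInd G arm s j ω
        ≤ obsCount G (fun s => arm s ω) n j := by
      rw [obsCount_eq_sum]
      exact Finset.sum_le_sum_of_subset_of_nonneg (Finset.Ioc_subset_Ioc_left (Nat.zero_le _))
        fun s _ _ => (obsInd_mem_Icc s j ω).1
    have h2 := sum_failInd_le_failWeight (G := G) (P := P) (arm := arm) (S := S) hloss k n ω
    have h3 : -(∑ s ∈ Finset.Ioc (Fintype.card V) n, obsInd G arm s j ω)
        - ρ * ∑ s ∈ Finset.Ioc (Fintype.card V) n, failInd G P loss arm s ω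
        ≤ ∑ s ∈ Finset.Ioc (Fintype.card V) n, (-(1 - failInd G P loss arm s ω)
          * obsInd G arm s j ω - failInd G P loss arm s ω * κ) := by
      rw [Finset.mul_sum, ← Finset.sum_neg_distrib, ← Finset.sum_sub_distrib]
      refine Finset.sum_le_sum fun s _ => ?_
      have hf := (failInd_mem_Icc (G := G) (P := P) (loss := loss) (arm := arm) s ω).1
      have ho := (obsInd_mem_Icc (G := G) (arm := arm) s j ω).1
      have hκρ : κ ≤ ρ := by rw [hκ]; nlinarith
      nlinarith [mul_nonneg hf ho, mul_le_mul_of_nonneg_left hκρ hf]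
    have h4 : (t : ℝ) * D / 100 ≤ t / 100 := by
      have : (t : ℝ) * D ≤ t := mul_le_of_le_one_right ht0.le hD1
      linarith
    have h5 : ρ * ∑ s ∈ Finset.Ioc (Fintype.card V) n, failInd G P loss arm s ω ≤ ρ * (t / 100) :=
      mul_le_mul_of_nonneg_left (by linarith) hρ0.le
    have h6 : (obsCount G (fun s => arm s ω) n j : ℝ) ≤ 0.5 * (t * ρ) := by
      rw [htρ]
      refine hO.le.trans (le_of_eq ?_)
      ring
    linarith

/-- A small difference of the loss estimates of a suboptimal and an optimal arm is unlikely. -/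
theorem exists_estLoss_bound {D : ℝ} (hD : 0 < D) (hD1 : D ≤ 1) {n : ℕ}
    (hn : Fintype.card V ≤ n) (h : LateRound G D (n + 1)) {i k : V}
    (hi : D ≤ gap P loss i) (hk : meanLoss P loss k = ⨅ j, meanLoss P loss j) :
    ∃ B : Ω → ℝ, BddMeasurable mΩ B ∧ (∀ ω, 0 ≤ B ω) ∧
      ∫ ω, B ω ∂P ≤ 1 / ((n + 1 : ℕ) : ℝ) ^ 2 ∧
      ∀ ω, failWeight G P loss arm S k n ω < (n + 1 : ℕ) * D / 100 →
        runEst G loss arm S n ω i - runEst G loss arm S n ω k < (n + 1 : ℕ) * gap P loss i / 5 →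
        1 ≤ B ω := by
  set t := n + 1 with ht
  have ht0 : (0 : ℝ) < t := by exact_mod_cast (by omega : 0 < t)
  have hΔ1 := gap_le_one hloss i
  set Δ := gap P loss i with hΔ
  have hΔ0 : 0 < Δ := hD.trans_le hi
  have hl := one_le_log (t := t) (by omega)
  set l := Real.log t with hldef
  set ρ := 320 * l / (t * Δ ^ 2) with hρ
  have hρ0 : 0 < ρ := by positivity
  set θ := 10 * l / (t * Δ) with hθ
  have hθ0 : 0 < θ := by positivity
  have hθρ : θ ≤ ρ := by
    rw [hθ, hρ, div_le_div_iff₀ (by positivity) (by positivity)]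
    have : 0 < l * t * Δ := by positivity
    nlinarith
  set κ := θ * Δ - 2 * θ ^ 2 / ρ with hκ
  have hgk : gap P loss k ≤ Δ := by
    rw [gap_eq, hk, sub_self]; exact hΔ0.le
  have hdiff : meanLoss P loss i - meanLoss P loss k = Δ := by rw [hk, ← gap_eq]
  obtain ⟨hm, hint⟩ := integral_exp_sum_le (P := P) (arm := arm)
    (X := fun s ω => θ * (estInc G loss arm S s i ω - estInc G loss arm S s k ω))
    (κ := κ) hloss hrun hn (fun s hs => by
      obtain ⟨s, rfl⟩ : ∃ r, s = r + 1 := ⟨s - 1, by omega⟩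
      exact ((bddMeasurable_estInc hK hloop hloss hrun (by omega) i).sub
        (bddMeasurable_estInc hK hloop hloss hrun (by omega) k)).const_mul θ)
    (fun s hs hsn Z hZ hZ0 hZF => by
      have := integral_mul_exp_estInc_le hK hloop hloss hrun hs i k hθ0.le hθρ hρ0 hZ hZ0
        (fun ω hω => h.le_runObsProb hK hloop hloss hrun hD hs (by omega) (hZF ω hω) hi le_rfl)
        (fun ω hω => h.le_runObsProb hK hloop hloss hrun hD hs (by omega) (hZF ω hω) hi hgk)
      rw [hdiff] at this
      simpa only [neg_mul] using this)
  have htθ : t * Δ * θ = 10 * l := by rw [hθ]; field_simp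
  have htκ : t * κ = 9.375 * l := by
    have : t * (2 * θ ^ 2 / ρ) = 0.625 * l := by rw [hθ, hρ]; field_simp; norm_num
    rw [hκ, mul_sub, this]
    linarith
  have hκ0 : 0 ≤ κ := by
    by_contra hneg
    push Not at hneg
    nlinarith [mul_neg_of_pos_of_neg ht0 hneg]
  refine ⟨_, hm.const_mul (Real.exp (0.21 * (t * Δ * θ))), fun ω => by positivity, ?_, ?_⟩
  · rw [integral_const_mul]
    refine (mul_le_mul_of_nonneg_left hint (Real.exp_nonneg _)).trans ?_
    rw [← Real.exp_add, ← neg_neg (0.21 * (t * Δ * θ) + _)]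
    refine exp_neg_two_mul_log (by omega) ?_
    have h1 := h.card_le hD hD1 (by omega)
    have hK1 : (2 : ℝ) ≤ Fintype.card V := by exact_mod_cast hK
    have h2 : (0.99 : ℝ) * t ≤ n - Fintype.card V := by
      have : (t : ℝ) = n + 1 := by rw [ht]; push_cast; ring
      linarith
    have h3 : κ * (0.99 * t) ≤ κ * (n - Fintype.card V) := mul_le_mul_of_nonneg_left h2 hκ0
    rw [htθ]
    linarith
  · intro ω hW hL
    rw [← Real.exp_add]
    refine Real.one_le_exp ?_
    have h3 : -(θ * (runEst G loss arm S n ω i - runEst G loss arm S n ω k))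
        - θ * failWeight G P loss arm S k n ω
        ≤ ∑ s ∈ Finset.Ioc (Fintype.card V) n, (-(1 - failInd G P loss arm s ω)
          * (θ * (estInc G loss arm S s i ω - estInc G loss arm S s k ω))
          - failInd G P loss arm s ω * κ) := by
      rw [runEst_eq_sum hn, runEst_eq_sum hn, ← Finset.sum_sub_distrib, failWeight,
        Finset.mul_sum, Finset.mul_sum, ← Finset.sum_neg_distrib, ← Finset.sum_sub_distrib]
      refine Finset.sum_le_sum fun s hs => ?_
      rw [Finset.mem_Ioc] at hs
      have hf := (failInd_mem_Icc (G := G) (P := P) (loss := loss) (arm := arm) s ω).1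
      have hx := estInc_nonneg (G := G) (arm := arm) (S := S) hloss (t := s) (by omega) i ω
      have hκθ : κ ≤ θ := by
        have : 0 ≤ 2 * θ ^ 2 / ρ := by positivity
        have : θ * Δ ≤ θ := mul_le_of_le_one_right hθ0.le hΔ1
        linarith
      nlinarith [mul_nonneg hf (mul_nonneg hθ0.le hx), mul_le_mul_of_nonneg_left hκθ hf]
    have h4 : θ * failWeight G P loss arm S k n ω ≤ 0.01 * (t * Δ * θ) := by
      have : failWeight G P loss arm S k n ω ≤ t * Δ / 100 :=
        hW.le.trans (by gcongr)
      nlinarith [mul_le_mul_of_nonneg_left this hθ0.le]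
    have h5 : θ * (runEst G loss arm S n ω i - runEst G loss arm S n ω k)
        ≤ 0.2 * (t * Δ * θ) := by
      nlinarith [mul_le_mul_of_nonneg_left hL.le hθ0.le]
    linarith

end StochasticRounds

section Rounds

variable {V Ω : Type*} [Fintype V] [Nonempty V] {mΩ : MeasurableSpace Ω} {G : Digraph V}
  {P : Measure Ω} [IsProbabilityMeasure P] {𝓕 : Filtration ℕ mΩ}
  {loss : ℕ → Ω → V → ℝ} {arm : ℕ → Ω → V} {S : ℕ → Ω → Finset V}

/-- Probability with which arm `i` is played at round `t > K`. -/
noncomputable def runProb (G : Digraph V) (loss : ℕ → Ω → V → ℝ) (arm : ℕ → Ω → V)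
    (S : ℕ → Ω → Finset V) (t : ℕ) (i : V) (ω : Ω) : ℝ :=
  playProb G (tuning G) (fun s => arm s ω) (fun s => loss s ω) (fun s => S s ω) t i

/-- Exploration rate of arm `i` at round `t`. -/
noncomputable def runRate (G : Digraph V) (loss : ℕ → Ω → V → ℝ) (arm : ℕ → Ω → V)
    (S : ℕ → Ω → Finset V) (t : ℕ) (i : V) (ω : Ω) : ℝ :=
  roundRate G (tuning G) (fun s => arm s ω) (fun s => loss s ω) (fun s => S s ω) t i

/-- Exponential weight of arm `i` at round `t`. -/
noncomputable def runWeight (G : Digraph V) (loss : ℕ → Ω → V → ℝ) (arm : ℕ → Ω → V)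
    (S : ℕ → Ω → Finset V) (t : ℕ) (i : V) (ω : Ω) : ℝ :=
  expWeight ((tuning G).η t) (runEst G loss arm S (t - 1) ω) i

theorem runRate_nonneg (t : ℕ) (i : V) (ω : Ω) : 0 ≤ runRate G loss arm S t i ω :=
  explRate_nonneg tuning_beta_pos.le

theorem runProb_le (t : ℕ) (i : V) (ω : Ω) :
    runProb G loss arm S t i ω ≤ runWeight G loss arm S t i ω + runRate G loss arm S t i ω :=
  mixedProb_le (fun j => runRate_nonneg t j ω) _ _ i

theorem sum_gap_mul_runProb_le_one (hloss : IsStochasticLoss P 𝓕 loss) (t : ℕ) (ω : Ω) :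
    ∑ i, gap P loss i * runProb G loss arm S t i ω ≤ 1 := by
  rw [← sum_playProb (G := G) (prm := tuning G) (fun s => arm s ω) (fun s => loss s ω)
    (fun s => S s ω) t]
  exact Finset.sum_le_sum fun i _ => mul_le_of_le_one_left
    (playProb_nonneg tuning_beta_pos.le _ _ _ _ i) (gap_le_one hloss i)

variable (hK : 2 ≤ Fintype.card V) (hloop : ∀ i, G.Adj i i) (hloss : IsStochasticLoss P 𝓕 loss)
  (hrun : IsRun G (tuning G) P 𝓕 loss arm S)

section Late

variable {D M : ℝ} {n : ℕ} (hD : 0 < D) (hD1 : D ≤ 1)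
  (hDgap : ∀ i, 0 < gap P loss i → D ≤ gap P loss i)
  (hM : ∀ A ∈ StrongIndepSets G, ∑ i ∈ A with 0 < gap P loss i, 1280 / gap P loss i ≤ M)
  (hn : Fintype.card V ≤ n) (h : LateRound G D (n + 1)) {k : V}
  (hk : meanLoss P loss k = ⨅ j, meanLoss P loss j)

include hK hloop hloss hrun hD hD1 hDgap hM hn h hk

theorem sum_gap_mul_runProb_le {ω : Ω} (hF : failInd G P loss arm (n + 1) ω = 0)
    (hO : ∀ i, 0 < gap P loss i → 160 * Real.log (n + 1 : ℕ) / gap P loss i ^ 2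
      ≤ obsCount G (fun s => arm s ω) n i)
    (hOk : 160 * Real.log (n + 1 : ℕ) / D ^ 2 ≤ obsCount G (fun s => arm s ω) n k)
    (hL : ∀ i, 0 < gap P loss i → (n + 1 : ℕ) * gap P loss i / 5
      ≤ runEst G loss arm S n ω i - runEst G loss arm S n ω k) :
    ∑ i, gap P loss i * runProb G loss arm S (n + 1) i ω
      ≤ M * Real.log (n + 1 : ℕ) / (n + 1 : ℕ) + 5 / (n + 1 : ℕ) := by
  classical
  set t := n + 1 with ht
  have ht0 : (0 : ℝ) < t := by exact_mod_cast (by omega : 0 < t)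
  have hl := one_le_log (t := t) (by omega)
  have hconf := failInd_eq_zero hF
  have hpt : ∀ i, gap P loss i * runProb G loss arm S t i ω ≤
      (if i ∈ S t ω ∧ 0 < gap P loss i then 1280 / gap P loss i else 0) * (Real.log t / t)
        + 5 / (t : ℝ) ^ 2 := by
    intro i
    rcases (gap_nonneg (P := P) (loss := loss) i).eq_or_lt with h0 | hpos
    · rw [← h0]; simp; positivity
    have hΔ1 := gap_le_one hloss i
    set Δ := gap P loss i with hΔ
    have hq : runWeight G loss arm S t i ω ≤ 1 / (t : ℝ) ^ 2 := by
      refine (expWeight_le_exp _ _ i k).trans (exp_neg_two_mul_log (by omega) ?_)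
      have h1 := h.le_rate_mul hD hD1 (by omega)
      have h2 := hL i hpos
      have h3 : 0 ≤ (tuning G).η t := Real.sqrt_nonneg _
      have h4 := mul_le_mul_of_nonneg_left h2 h3
      have h5 := mul_le_mul_of_nonneg_left (hDgap i hpos) (mul_nonneg h3 ht0.le)
      rw [show t - 1 = n by omega]
      linarith
    have hε : Δ * runRate G loss arm S t i ω ≤
        (if i ∈ S t ω ∧ 0 < Δ then 1280 / Δ else 0) * (Real.log t / t) + 4 / (t : ℝ) ^ 2 := by
      by_cases hi : i ∈ S t ω
      · rw [if_pos ⟨hi, hpos⟩]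
        have h1 := hconf.le_gapEst i hk
        rw [← gap_eq, ← hΔ] at h1
        have h2 := confWidth_le (G := G) (a := fun s => arm s ω) (t := t) (by omega) (by omega)
          hpos (hO i hpos)
        have h3 := confWidth_le (G := G) (a := fun s => arm s ω) (t := t) (by omega) (by omega)
          hD hOk
        have h4 : runRate G loss arm S t i ω ≤ 4 * 320 * Real.log t / (t * Δ ^ 2) :=
          explRate_le_of_mem tuning_beta_pos.le hi hpos
            ((by linarith [hDgap i hpos] : Δ / 2 ≤ _).trans h1)
        have h5 := mul_le_mul_of_nonneg_left h4 hpos.le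
        have h6 : Δ * (4 * 320 * Real.log t / (t * Δ ^ 2)) = 1280 / Δ * (Real.log t / t) := by
          field_simp; norm_num
        have : (0 : ℝ) ≤ 4 / (t : ℝ) ^ 2 := by positivity
        linarith
      · rw [if_neg fun h => hi h.1, zero_mul, zero_add]
        have h4 : runRate G loss arm S t i ω ≤ 4 / (t : ℝ) ^ 2 := explRate_le_of_notMem hi
        exact (mul_le_of_le_one_left (runRate_nonneg t i ω) hΔ1).trans h4
    have h1 := mul_le_mul_of_nonneg_left (runProb_le (G := G) (loss := loss) (arm := arm) (S := S)
      t i ω) hpos.le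
    have h2 : Δ * runWeight G loss arm S t i ω ≤ 1 / (t : ℝ) ^ 2 :=
      (mul_le_of_le_one_left (expWeight_pos _ _ i).le hΔ1).trans hq
    have h3 : 1 / (t : ℝ) ^ 2 + 4 / (t : ℝ) ^ 2 = 5 / (t : ℝ) ^ 2 := by ring
    rw [mul_add] at h1
    linarith
  refine (Finset.sum_le_sum fun i _ => hpt i).trans ?_
  rw [Finset.sum_add_distrib, ← Finset.sum_mul]
  have hS : ∑ i, (if i ∈ S t ω ∧ 0 < gap P loss i then 1280 / gap P loss i else 0) ≤ M := by
    refine le_trans (le_of_eq ?_) (hM _ ((hrun.expl_greedy n hn ω).mem_strongIndepSets hloop))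
    rw [← Finset.sum_filter]
    congr 1
    ext i; simp [ht]
  refine add_le_add ?_ ?_
  · rw [mul_div_assoc]
    exact mul_le_mul_of_nonneg_right hS (by positivity)
  · simp only [Finset.sum_const, Finset.card_univ, nsmul_eq_mul]
    have : (Fintype.card V : ℝ) ≤ t := by exact_mod_cast (by omega : Fintype.card V ≤ t)
    rw [mul_div_assoc', div_le_div_iff₀ (by positivity) ht0]
    nlinarith

theorem late_round_le :
    ∑ i, gap P loss i * ∫ ω, runProb G loss arm S (n + 1) i ω ∂P
      ≤ M * Real.log (n + 1 : ℕ) / (n + 1 : ℕ) + 110 / D * (1 / (n + 1 : ℕ)) := by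
  classical
  have hgk : gap P loss k = 0 := by rw [gap_eq, hk, sub_self]
  choose! C hCm hC0 hCi hC using fun (i : V) (hi : 0 < gap P loss i) =>
    exists_count_bound hK hloop hloss hrun hD hD1 hn h (hDgap i hi) (gap_le_one hloss i) le_rfl k
  choose! E hEm hE0 hEi hE using fun (i : V) (hi : 0 < gap P loss i) =>
    exists_estLoss_bound hK hloop hloss hrun hD hD1 hn h (hDgap i hi) hk
  obtain ⟨B, hBm, hB0, hBi, hB⟩ :=
    exists_count_bound hK hloop hloss hrun hD hD1 hn h le_rfl hD1 (hgk.le.trans hD.le) k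
  obtain ⟨hWm, hWi⟩ := failWeight_spec hK hloop hloss hrun k n
  have hW0 := failWeight_nonneg (G := G) (P := P) (arm := arm) (S := S) hloss k n
  have hFm := (bddMeasurable_failInd (arm := arm) hloss hrun n).mono (𝓕.le n)
  have hFi := integral_failInd_le tuning_beta_pos.le hloss hrun hloop hn
  set t := n + 1 with ht
  have ht0 : (0 : ℝ) < t := by exact_mod_cast (by omega : 0 < t)
  set U := Finset.univ.filter fun i => 0 < gap P loss i with hU
  have hmU : ∀ i ∈ U, 0 < gap P loss i := fun i hi => (Finset.mem_filter.1 hi).2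
  set c := M * Real.log t / t + 5 / t with hc
  have hc0 : 0 ≤ c := by
    have hM0 : 0 ≤ M := by simpa using hM ∅ (by simp [mem_strongIndepSets])
    positivity
  have hCE : ∀ ω, 0 ≤ ∑ i ∈ U, (C i ω + E i ω) := fun ω => Finset.sum_nonneg fun i hi =>
    add_nonneg (hC0 i (hmU i hi) ω) (hE0 i (hmU i hi) ω)
  have hpt : ∀ ω, ∑ i, gap P loss i * runProb G loss arm S t i ω ≤
      c + failInd G P loss arm t ω + 100 / (t * D) * failWeight G P loss arm S k n ω + B ω
        + ∑ i ∈ U, (C i ω + E i ω) := by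
    intro ω
    have h1 := sum_gap_mul_runProb_le_one (G := G) (arm := arm) (S := S) hloss t ω
    have hF0 := (failInd_mem_Icc (G := G) (P := P) (loss := loss) (arm := arm) t ω).1
    have hw : 0 ≤ 100 / (t * D) * failWeight G P loss arm S k n ω :=
      mul_nonneg (by positivity) (hW0 ω)
    have hb := hB0 ω
    have hce := hCE ω
    rcases failInd_cases (G := G) (P := P) (loss := loss) (arm := arm) t ω with hF | hF
    swap
    · linarith
    rcases le_or_gt (t * D / 100) (failWeight G P loss arm S k n ω) with hW | hW
    · have : 1 ≤ 100 / (t * D) * failWeight G P loss arm S k n ω := by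
        calc (1 : ℝ) = 100 / (t * D) * (t * D / 100) := by field_simp
          _ ≤ _ := by gcongr
      linarith
    by_cases hOk : 160 * Real.log t / D ^ 2 ≤ obsCount G (fun s => arm s ω) n k
    swap
    · have := hB ω hW (not_le.1 hOk)
      linarith
    by_cases hO : ∀ i, 0 < gap P loss i → 160 * Real.log t / gap P loss i ^ 2
      ≤ obsCount G (fun s => arm s ω) n i
    swap
    · push Not at hO
      obtain ⟨i, hi, hOi⟩ := hO
      have h2 := hC i hi ω hW hOi
      have h3 := Finset.single_le_sum (f := fun i => C i ω + E i ω) (fun i hi =>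
        add_nonneg (hC0 i (hmU i hi) ω) (hE0 i (hmU i hi) ω)) (Finset.mem_filter.2 ⟨Finset.mem_univ i, hi⟩)
      have h4 := hE0 i hi ω
      linarith
    by_cases hL : ∀ i, 0 < gap P loss i → t * gap P loss i / 5
      ≤ runEst G loss arm S n ω i - runEst G loss arm S n ω k
    swap
    · push Not at hL
      obtain ⟨i, hi, hLi⟩ := hL
      have h2 := hE i hi ω hW hLi
      have h3 := Finset.single_le_sum (f := fun i => C i ω + E i ω) (fun i hi =>
        add_nonneg (hC0 i (hmU i hi) ω) (hE0 i (hmU i hi) ω)) (Finset.mem_filter.2 ⟨Finset.mem_univ i, hi⟩)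
      have h4 := hC0 i hi ω
      linarith
    have := sum_gap_mul_runProb_le hK hloop hloss hrun hD hD1 hDgap hM hn h hk hF hO hOk hL
    linarith
  have hpm : ∀ i, BddMeasurable mΩ (runProb G loss arm S t i) := fun i =>
    (hrun.bddMeasurable_playProb tuning_beta_pos.le hloss hn i).mono (𝓕.le n)
  have hCEm : ∀ i ∈ U, BddMeasurable mΩ fun ω => C i ω + E i ω := fun i hi =>
    (hCm i (hmU i hi)).add (hEm i (hmU i hi))
  have hint := (BddMeasurable.sum fun i (_ : i ∈ Finset.univ) =>
    (hpm i).const_mul (gap P loss i)).integral_mono (P := P)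
    (((((BddMeasurable.const c).add hFm).add (hWm.const_mul (100 / (t * D)))).add hBm).add
      (.sum hCEm)) hpt
  rw [integral_finsetSum _ fun i _ => ((hpm i).const_mul _).integrable le_rfl] at hint
  simp only [integral_const_mul] at hint
  refine hint.trans ?_
  rw [integral_add (((((BddMeasurable.const c).add hFm).add
      (hWm.const_mul (100 / (t * D)))).add hBm).integrable le_rfl)
      ((BddMeasurable.sum hCEm).integrable le_rfl),
    integral_add ((((BddMeasurable.const c).add hFm).add
      (hWm.const_mul (100 / (t * D)))).integrable le_rfl) (hBm.integrable le_rfl),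
    integral_add (((BddMeasurable.const c).add hFm).integrable le_rfl)
      ((hWm.const_mul (100 / (t * D))).integrable le_rfl),
    integral_add (integrable_const c) (hFm.integrable le_rfl), integral_const_mul,
    integral_finsetSum _ fun i hi => (hCEm i hi).integrable le_rfl]
  have hs : ∑ i ∈ U, ∫ ω, (C i ω + E i ω) ∂P ≤ 2 / t := by
    calc _ ≤ ∑ i ∈ U, 2 * (1 / (t : ℝ) ^ 2) := by
          refine Finset.sum_le_sum fun i hi => ?_
          rw [integral_add ((hCm i (hmU i hi)).integrable le_rfl)
            ((hEm i (hmU i hi)).integrable le_rfl)]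
          have := hCi i (hmU i hi)
          have := hEi i (hmU i hi)
          linarith
      _ ≤ Fintype.card V * (2 * (1 / (t : ℝ) ^ 2)) := by
          rw [Finset.sum_const, nsmul_eq_mul]
          gcongr
          exact Finset.card_le_univ U
      _ ≤ t * (2 * (1 / (t : ℝ) ^ 2)) := by
          gcongr
          omega
      _ = 2 / t := by field_simp
  have hsq : 1 / (t : ℝ) ^ 2 ≤ 1 / t := by
    have : (1 : ℝ) ≤ t := by exact_mod_cast (by omega : 1 ≤ t)
    apply one_div_le_one_div_of_le ht0
    nlinarith
  have hw : 100 / (t * D) * ∫ ω, failWeight G P loss arm S k n ω ∂P ≤ 100 / (t * D) :=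
    mul_le_of_le_one_right (by positivity) hWi
  have hD' : 10 * (1 / (t : ℝ)) ≤ 10 / D * (1 / t) := by
    gcongr
    rw [le_div_iff₀ hD]; linarith
  have e1 : 100 / (t * D) = 100 / D * (1 / t) := by field_simp
  have e2 : 110 / D * (1 / (t : ℝ)) = 100 / D * (1 / t) + 10 / D * (1 / t) := by ring
  have e3 : (2 : ℝ) / t = 2 * (1 / t) := by ring
  have e4 : (5 : ℝ) / t = 5 * (1 / t) := by ring
  have e5 : (0 : ℝ) ≤ 1 / t := by positivity
  simp only [integral_const, probReal_univ, one_smul]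
  rw [e2, hc, e4]
  linarith

end Late

section Adversarial

include hloss hrun in
theorem bddMeasurable_runWeight {t : ℕ} (i : V) :
    BddMeasurable (𝓕 t) (runWeight G loss arm S (t + 1) i) := by
  refine .of_mem_Icc (a := 0) (b := 1) ?_ fun ω => ⟨(expWeight_pos _ _ i).le, ?_⟩
  · exact @measurable_expWeight V Ω (𝓕 t) _ _ (runEst G loss arm S t)
      (fun j => hrun.measurable_estLoss hloss t j) i
  · rw [← sum_expWeight ((tuning G).η (t + 1)) (runEst G loss arm S t ω)]
    exact Finset.single_le_sum (f := expWeight _ _) (fun j _ => (expWeight_pos _ _ j).le)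
      (Finset.mem_univ i)

theorem sum_runWeight (t : ℕ) (ω : Ω) : ∑ i, runWeight G loss arm S t i ω = 1 :=
  sum_expWeight _ _

include hloop in
theorem sum_runWeight_mul_inv_le (t : ℕ) (ω : Ω) :
    ∑ i, runWeight G loss arm S t i ω * (runObsProb G loss arm S t i ω)⁻¹
      ≤ 2 * strongIndepNum G := by
  simp only [← div_eq_mul_inv]
  exact sum_expWeight_div_obsProb_le hloop (fun j => runRate_nonneg t j ω) sum_explRate_le_half _ _

include hK hloop hloss hrun

theorem integral_sum_runWeight_mul_estInc {t : ℕ} (ht : Fintype.card V ≤ t) {k : V}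
    (hk : meanLoss P loss k = ⨅ j, meanLoss P loss j) :
    ∫ ω, (∑ i, runWeight G loss arm S (t + 1) i ω * estInc G loss arm S (t + 1) i ω
      - estInc G loss arm S (t + 1) k ω) ∂P
      = ∑ i, gap P loss i * ∫ ω, runWeight G loss arm S (t + 1) i ω ∂P := by
  have hX := fun i => (bddMeasurable_estInc hK hloop hloss hrun ht i).mono (𝓕.le (t + 1))
  have hq := fun i => bddMeasurable_runWeight hloss hrun (t := t) i
  have hq' := fun i => (hq i).mono (𝓕.le t)
  rw [integral_sub ((BddMeasurable.sum fun i _ => (hq' i).mul (hX i)).integrable le_rfl)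
    ((hX k).integrable le_rfl),
    integral_finsetSum _ fun i _ => ((hq' i).mul (hX i)).integrable le_rfl]
  have h1 := integral_mul_estInc hK hloop hloss hrun ht k (Z := fun _ => 1) (.const 1)
  simp only [one_mul, integral_const, probReal_univ, one_smul] at h1
  have h2 : ∑ i, ∫ ω, runWeight G loss arm S (t + 1) i ω ∂P = 1 := by
    rw [← integral_finsetSum _ fun i _ => (hq' i).integrable le_rfl]
    simp [sum_runWeight]
  rw [h1, ← one_mul (meanLoss P loss k), ← h2, Finset.sum_mul, ← Finset.sum_sub_distrib]
  refine Finset.sum_congr rfl fun i _ => ?_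
  rw [integral_mul_estInc hK hloop hloss hrun ht i (hq i), gap_eq, ← hk]
  ring

theorem integral_sum_runWeight_mul_estInc_sq_le {t : ℕ} (ht : Fintype.card V ≤ t) :
    ∫ ω, ∑ i, runWeight G loss arm S (t + 1) i ω * estInc G loss arm S (t + 1) i ω ^ 2 ∂P
      ≤ 2 * strongIndepNum G := by
  have hX := fun i => (bddMeasurable_estInc hK hloop hloss hrun ht i).mono (𝓕.le (t + 1))
  have hO := fun i => (hrun.bddMeasurable_obsInd (Nat.le_add_left 1 t) i).mono (𝓕.le (t + 1))
  have hQ := fun i => (bddMeasurable_inv_runObsProb hK hloop hloss hrun ht i).mono (𝓕.le t)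
  have hq := fun i => bddMeasurable_runWeight hloss hrun (t := t) i
  have hq' := fun i => (hq i).mono (𝓕.le t)
  have h1 : ∫ ω, ∑ i, runWeight G loss arm S (t + 1) i ω * estInc G loss arm S (t + 1) i ω ^ 2 ∂P
      ≤ ∫ ω, ∑ i, runWeight G loss arm S (t + 1) i ω *
        ((runObsProb G loss arm S (t + 1) i ω)⁻¹ ^ 2 * obsInd G arm (t + 1) i ω) ∂P := by
    refine (BddMeasurable.sum fun i _ => (hq' i).mul ((hX i).pow 2)).integral_mono
      (.sum fun i _ => (hq' i).mul (((hQ i).pow 2).mul (hO i))) fun ω => ?_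
    exact Finset.sum_le_sum fun i _ => mul_le_mul_of_nonneg_left
      (estInc_sq_le hloss (Nat.le_add_left 1 t) i ω) (expWeight_pos _ _ i).le
  refine h1.trans ?_
  rw [integral_finsetSum _ fun i _ => ((hq' i).mul (((hQ i).pow 2).mul (hO i))).integrable le_rfl]
  simp only [integral_mul_inv_sq_mul_obsInd hK hloop hloss hrun ht _ (hq _)]
  rw [← integral_finsetSum _ fun i _ => ((hq' i).mul (hQ i)).integrable le_rfl]
  have := (BddMeasurable.sum fun i (_ : i ∈ Finset.univ) => (hq' i).mul (hQ i)).integral_mono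
    (P := P) (.const (2 * strongIndepNum G : ℝ))
    fun ω => sum_runWeight_mul_inv_le (loss := loss) (arm := arm) (S := S) hloop (t + 1) ω
  simpa using this

theorem sum_integral_runWeight_le {n : ℕ} (hn : Fintype.card V < n) :
    ∑ t ∈ Finset.Ioc (Fintype.card V) n,
      ∑ i, gap P loss i * ∫ ω, runWeight G loss arm S t i ω ∂P
      ≤ 3 * Real.sqrt (strongIndepNum G * Real.log (Fintype.card V) * n) := by
  obtain ⟨k, hk⟩ := exists_meanLoss_eq_iInf (P := P) (loss := loss)
  have hα : (1 : ℝ) ≤ strongIndepNum G := by exact_mod_cast one_le_strongIndepNum G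
  have hlK : 0 < Real.log (Fintype.card V) := Real.log_pos (by exact_mod_cast hK)
  have hn0 : (0 : ℝ) < n := by exact_mod_cast (by omega : 0 < n)
  have hηdef : ∀ t, (tuning G).η t
      = Real.sqrt (Real.log (Fintype.card V) / (2 * strongIndepNum G * t)) := fun t => rfl
  have hη : ∀ t, Fintype.card V < t → 0 < (tuning G).η t := fun t ht => by
    have : (0 : ℝ) < t := by exact_mod_cast (by omega : 0 < t)
    rw [hηdef]; exact Real.sqrt_pos.2 (by positivity)
  have hanti : ∀ s t, Fintype.card V < s → s ≤ t → (tuning G).η t ≤ (tuning G).η s := by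
    intro s t hs hst
    have : (0 : ℝ) < s := by exact_mod_cast (by omega : 0 < s)
    have : (s : ℝ) ≤ t := by exact_mod_cast hst
    rw [hηdef, hηdef]
    apply Real.sqrt_le_sqrt
    gcongr
  have hpt : ∀ ω, ∑ t ∈ Finset.Ioc (Fintype.card V) n,
      (∑ i, runWeight G loss arm S t i ω * estInc G loss arm S t i ω - estInc G loss arm S t k ω)
      ≤ Real.log (Fintype.card V) / (tuning G).η n + ∑ t ∈ Finset.Ioc (Fintype.card V) n,
        (tuning G).η t / 2 * ∑ i, runWeight G loss arm S t i ω * estInc G loss arm S t i ω ^ 2 :=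
    fun ω => hedge_regret (η := (tuning G).η) (L := fun t => runEst G loss arm S t ω)
      (l := fun t i => estInc G loss arm S t i ω) hn hη hanti
      (fun t i ht => estInc_nonneg hloss (by omega) i ω) (fun i => runEst_card i ω)
      (fun t i ht => runEst_succ ht i ω) k
  have hm1 : ∀ t ∈ Finset.Ioc (Fintype.card V) n, BddMeasurable mΩ fun ω =>
      ∑ i, runWeight G loss arm S t i ω * estInc G loss arm S t i ω - estInc G loss arm S t k ω := by
    intro t ht
    rw [Finset.mem_Ioc] at ht
    obtain ⟨t, rfl⟩ : ∃ r, t = r + 1 := ⟨t - 1, by omega⟩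
    have hX := fun i => (bddMeasurable_estInc hK hloop hloss hrun (by omega : Fintype.card V ≤ t) i).mono
      (𝓕.le (t + 1))
    exact (BddMeasurable.sum fun i _ =>
      ((bddMeasurable_runWeight hloss hrun i).mono (𝓕.le t)).mul (hX i)).sub (hX k)
  have hm2 : ∀ t ∈ Finset.Ioc (Fintype.card V) n, BddMeasurable mΩ fun ω =>
      (tuning G).η t / 2 * ∑ i, runWeight G loss arm S t i ω * estInc G loss arm S t i ω ^ 2 := by
    intro t ht
    rw [Finset.mem_Ioc] at ht
    obtain ⟨t, rfl⟩ : ∃ r, t = r + 1 := ⟨t - 1, by omega⟩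
    have hX := fun i => (bddMeasurable_estInc hK hloop hloss hrun (by omega : Fintype.card V ≤ t) i).mono
      (𝓕.le (t + 1))
    exact (BddMeasurable.sum fun i _ =>
      ((bddMeasurable_runWeight hloss hrun i).mono (𝓕.le t)).mul ((hX i).pow 2)).const_mul _
  have hint := (BddMeasurable.sum hm1).integral_mono (P := P)
    ((BddMeasurable.const _).add (.sum hm2)) hpt
  rw [integral_finsetSum _ fun t ht => (hm1 t ht).integrable le_rfl,
    integral_add (integrable_const _) ((BddMeasurable.sum hm2).integrable le_rfl),
    integral_finsetSum _ fun t ht => (hm2 t ht).integrable le_rfl] at hint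
  have h1 : ∀ t ∈ Finset.Ioc (Fintype.card V) n, ∫ ω, (∑ i, runWeight G loss arm S t i ω *
      estInc G loss arm S t i ω - estInc G loss arm S t k ω) ∂P
      = ∑ i, gap P loss i * ∫ ω, runWeight G loss arm S t i ω ∂P := by
    intro t ht
    rw [Finset.mem_Ioc] at ht
    obtain ⟨t, rfl⟩ : ∃ r, t = r + 1 := ⟨t - 1, by omega⟩
    exact integral_sum_runWeight_mul_estInc hK hloop hloss hrun (by omega) hk
  rw [Finset.sum_congr rfl h1] at hint
  refine hint.trans ?_
  set α : ℝ := (strongIndepNum G : ℝ) with hαdef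
  set lK := Real.log (Fintype.card V) with hlKdef
  have hηt : ∀ t : ℕ, (tuning G).η t = Real.sqrt (lK / (2 * α)) * (1 / Real.sqrt t) := by
    intro t
    rw [hηdef, ← div_div, Real.sqrt_div' _ (by positivity)]
    ring
  have h2 : ∑ t ∈ Finset.Ioc (Fintype.card V) n, ∫ ω, (tuning G).η t / 2 *
      ∑ i, runWeight G loss arm S t i ω * estInc G loss arm S t i ω ^ 2 ∂P
      ≤ α * (Real.sqrt (lK / (2 * α)) * (2 * Real.sqrt n)) := by
    calc _ ≤ ∑ t ∈ Finset.Ioc (Fintype.card V) n,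
          α * (Real.sqrt (lK / (2 * α)) * (1 / Real.sqrt t)) := by
          refine Finset.sum_le_sum fun t ht => ?_
          rw [Finset.mem_Ioc] at ht
          rw [integral_const_mul, ← hηt]
          have hpos := hη t ht.1
          obtain ⟨t, rfl⟩ : ∃ r, t = r + 1 := ⟨t - 1, by omega⟩
          have := integral_sum_runWeight_mul_estInc_sq_le hK hloop hloss hrun
            (by omega : Fintype.card V ≤ t)
          nlinarith
      _ ≤ _ := by
          rw [← Finset.mul_sum, ← Finset.mul_sum]
          have := sum_one_div_sqrt_le (Fintype.card V) n
          gcongr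
  set B := Real.sqrt (α * lK * n) with hB
  have hsqrt2 : Real.sqrt 2 ≤ 3 / 2 := by
    rw [Real.sqrt_le_left (by norm_num)]; norm_num
  have e1 : α * (Real.sqrt (lK / (2 * α)) * (2 * Real.sqrt n)) = Real.sqrt 2 * B := by
    rw [hB, ← Real.sqrt_mul (by norm_num)]
    refine (Real.sqrt_eq_iff_mul_self_eq (by positivity) (by positivity)).2 ?_ |>.symm
    have h3 : Real.sqrt (lK / (2 * α)) ^ 2 = lK / (2 * α) := Real.sq_sqrt (by positivity)
    have h4 : Real.sqrt n ^ 2 = n := Real.sq_sqrt hn0.le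
    have h5 : ∀ s r : ℝ, α * (s * (2 * r)) * (α * (s * (2 * r))) = 4 * α ^ 2 * s ^ 2 * r ^ 2 :=
      fun s r => by ring
    rw [h5, h3, h4]
    field_simp
    norm_num
  have e2 : lK / (tuning G).η n = Real.sqrt 2 * B := by
    rw [div_eq_iff (hη n hn).ne', hB, ← Real.sqrt_mul (by norm_num), hηdef,
      ← Real.sqrt_mul (by positivity)]
    refine ((Real.sqrt_eq_iff_mul_self_eq (by positivity) (by positivity)).2 ?_).symm
    field_simp
  have hB0 : 0 ≤ B := Real.sqrt_nonneg _
  simp only [integral_const, probReal_univ, one_smul]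
  rw [e2]
  rw [e1] at h2
  nlinarith

theorem sum_integral_runProb_le {n : ℕ} (hn : Fintype.card V < n) :
    ∑ t ∈ Finset.Ioc (Fintype.card V) n,
      ∑ i, gap P loss i * ∫ ω, runProb G loss arm S t i ω ∂P
      ≤ 4 * Real.sqrt (strongIndepNum G * Real.log (Fintype.card V) * n) := by
  have hlK : 0 < Real.log (Fintype.card V) := Real.log_pos (by exact_mod_cast hK)
  set α : ℝ := (strongIndepNum G : ℝ) with hαdef
  set lK := Real.log (Fintype.card V) with hlKdef
  have h1 := sum_integral_runWeight_le hK hloop hloss hrun hn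
  have h2 : ∀ t ∈ Finset.Ioc (Fintype.card V) n,
      ∑ i, gap P loss i * ∫ ω, runProb G loss arm S t i ω ∂P
      ≤ ∑ i, gap P loss i * ∫ ω, runWeight G loss arm S t i ω ∂P
        + 1 / 2 * Real.sqrt (α * lK) * (1 / Real.sqrt t) := by
    intro t ht
    rw [Finset.mem_Ioc] at ht
    obtain ⟨t, rfl⟩ : ∃ r, t = r + 1 := ⟨t - 1, by omega⟩
    have hp : ∀ i, BddMeasurable mΩ (runProb G loss arm S (t + 1) i) := fun i =>
      (hrun.bddMeasurable_playProb tuning_beta_pos.le hloss (by omega) i).mono (𝓕.le t)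
    have hq := fun i => (bddMeasurable_runWeight hloss hrun (t := t) i).mono (𝓕.le t)
    simp only [← integral_const_mul]
    rw [← integral_finsetSum _ fun i _ => ((hp i).const_mul _).integrable le_rfl,
      ← integral_finsetSum _ fun i _ => ((hq i).const_mul _).integrable le_rfl]
    have := (BddMeasurable.sum fun i (_ : i ∈ Finset.univ) =>
      (hp i).const_mul (gap P loss i)).integral_mono (P := P)
      ((BddMeasurable.sum fun i (_ : i ∈ Finset.univ) => (hq i).const_mul (gap P loss i)).add
        (.const (1 / 2 * Real.sqrt (α * lK) * (1 / Real.sqrt (t + 1 : ℕ))))) fun ω => by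
      have hε : ∑ i, runRate G loss arm S (t + 1) i ω
          ≤ 1 / 2 * Real.sqrt (α * lK / (t + 1 : ℕ)) := sum_explRate_le_sqrt
      rw [Real.sqrt_div' _ (by positivity), div_eq_mul_one_div (Real.sqrt (α * lK)),
        ← mul_assoc] at hε
      refine le_trans ?_ (add_le_add_right hε _)
      rw [← Finset.sum_add_distrib]
      refine Finset.sum_le_sum fun i _ => ?_
      have h3 := mul_le_mul_of_nonneg_left (runProb_le (G := G) (loss := loss) (arm := arm)
        (S := S) (t + 1) i ω) (gap_nonneg (P := P) (loss := loss) i)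
      have h4 := mul_le_of_le_one_left (runRate_nonneg (G := G) (loss := loss) (arm := arm)
        (S := S) (t + 1) i ω) (gap_le_one hloss i)
      linarith
    rw [integral_add ((BddMeasurable.sum fun i (_ : i ∈ Finset.univ) =>
      (hq i).const_mul (gap P loss i)).integrable le_rfl) (integrable_const _)] at this
    simpa using this
  refine (Finset.sum_le_sum h2).trans ?_
  rw [Finset.sum_add_distrib, ← Finset.mul_sum]
  have h3 := sum_one_div_sqrt_le (Fintype.card V) n
  have h4 : Real.sqrt (α * lK * n) = Real.sqrt (α * lK) * Real.sqrt n :=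
    Real.sqrt_mul (by positivity) _
  have h5 := mul_le_mul_of_nonneg_left h3 (by positivity : 0 ≤ 1 / 2 * Real.sqrt (α * lK))
  rw [h4] at h1 ⊢
  linarith

end Adversarial

end Rounds

section Regret

variable {V Ω : Type*} [Fintype V] [Nonempty V] {mΩ : MeasurableSpace Ω} {G : Digraph V}
  {P : Measure Ω} [IsProbabilityMeasure P] {𝓕 : Filtration ℕ mΩ}
  {loss : ℕ → Ω → V → ℝ} {arm : ℕ → Ω → V} {S : ℕ → Ω → Finset V}

/-- Expected regret of round `t`. -/
noncomputable def roundRegret (P : Measure Ω) (loss : ℕ → Ω → V → ℝ) (arm : ℕ → Ω → V)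
    (t : ℕ) : ℝ :=
  ∑ i, gap P loss i * ∫ ω, armInd arm t i ω ∂P

theorem sum_armInd (t : ℕ) (ω : Ω) : ∑ i, armInd arm t i ω = 1 := by
  classical
  simp [armInd]

theorem integral_armInd_nonneg (t : ℕ) (i : V) : 0 ≤ ∫ ω, armInd arm t i ω ∂P :=
  integral_nonneg fun ω => by unfold armInd; positivity

variable (hloss : IsStochasticLoss P 𝓕 loss) (hrun : IsRun G (tuning G) P 𝓕 loss arm S)

include hloss hrun

omit hloss in
theorem sum_integral_armInd {t : ℕ} (ht : 1 ≤ t) : ∑ i, ∫ ω, armInd arm t i ω ∂P = 1 := by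
  rw [← integral_finsetSum _ fun i _ => (hrun.bddMeasurable_armInd ht i).integrable (𝓕.le t)]
  simp [sum_armInd]

theorem roundRegret_le_one {t : ℕ} (ht : 1 ≤ t) : roundRegret P loss arm t ≤ 1 := by
  rw [← sum_integral_armInd hrun ht]
  exact Finset.sum_le_sum fun i _ =>
    mul_le_of_le_one_left (integral_armInd_nonneg t i) (gap_le_one hloss i)

theorem roundRegret_eq {t : ℕ} (ht : Fintype.card V < t) : roundRegret P loss arm t =
    ∑ i, gap P loss i * ∫ ω, runProb G loss arm S t i ω ∂P := by
  obtain ⟨t, rfl⟩ : ∃ r, t = r + 1 := ⟨t - 1, by omega⟩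
  refine Finset.sum_congr rfl fun i _ => ?_
  have := hrun.integral_mul_armInd tuning_beta_pos.le hloss (by omega : Fintype.card V ≤ t)
    (Z := fun _ => 1) (.const 1) i
  simp only [one_mul] at this
  rw [this]
  rfl

theorem pseudoRegret_eq_sum (T : ℕ) :
    pseudoRegret P loss arm T = ∑ t ∈ Finset.Icc 1 T, roundRegret P loss arm t := by
  have hlm : ∀ t, 1 ≤ t → ∀ i, BddMeasurable mΩ fun ω => loss t ω i := fun t ht i =>
    (hloss.bddMeasurable_comp (continuous_apply i) ht).mono (𝓕.le t)
  have ha : ∀ t, 1 ≤ t → ∀ i, BddMeasurable mΩ (armInd arm t i) := fun t ht i =>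
    (hrun.bddMeasurable_armInd ht i).mono (𝓕.le t)
  have hplay : ∀ t ω, loss t ω (arm t ω) = ∑ i, armInd arm t i ω * loss t ω i := by
    classical
    intro t ω; simp [armInd]
  have h1 : ∀ t ∈ Finset.Icc 1 T, ∫ ω, loss t ω (arm t ω) ∂P
      = ∑ i, (∫ ω, armInd arm t i ω ∂P) * meanLoss P loss i := by
    intro t ht
    obtain ⟨t, rfl⟩ : ∃ r, t = r + 1 := ⟨t - 1, by rw [Finset.mem_Icc] at ht; omega⟩
    simp only [hplay]
    rw [integral_finsetSum _ fun i _ => ((ha _ (Nat.le_add_left 1 t) i).mul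
      (hlm _ (Nat.le_add_left 1 t) i)).integrable le_rfl]
    refine Finset.sum_congr rfl fun i _ => ?_
    have := hrun.integral_mul_armInd_mul tuning_beta_pos.le hloss t (Z := fun _ => 1) (.const 1)
      (continuous_apply i) i
    simp only [one_mul] at this
    exact this
  have h2 : ∀ i, ∫ ω, ∑ t ∈ Finset.Icc 1 T, loss t ω i ∂P = T * meanLoss P loss i := by
    intro i
    rw [integral_finsetSum _ fun t ht => (hlm t (Finset.mem_Icc.1 ht).1 i).integrable le_rfl,
      Finset.sum_congr rfl fun t ht =>
        hloss.integral_comp (continuous_apply i) (Finset.mem_Icc.1 ht).1]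
    simp [meanLoss]
  unfold pseudoRegret
  rw [integral_finsetSum _ fun t ht => by
    simp only [hplay]
    exact (BddMeasurable.sum fun i _ => (ha t (Finset.mem_Icc.1 ht).1 i).mul
      (hlm t (Finset.mem_Icc.1 ht).1 i)).integrable le_rfl]
  simp only [h2]
  rw [Finset.sum_congr rfl h1, ← Real.mul_iInf_of_nonneg (Nat.cast_nonneg T)]
  have h3 : (T : ℝ) * ⨅ i, meanLoss P loss i
      = ∑ t ∈ Finset.Icc 1 T, ⨅ i, meanLoss P loss i := by simp
  rw [h3, ← Finset.sum_sub_distrib]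
  refine Finset.sum_congr rfl fun t ht => ?_
  rw [← one_mul (⨅ i, meanLoss P loss i), ← sum_integral_armInd hrun (Finset.mem_Icc.1 ht).1,
    Finset.sum_mul, ← Finset.sum_sub_distrib]
  refine Finset.sum_congr rfl fun i _ => ?_
  rw [gap_eq]
  ring

end Regret

section Horizon

variable {V : Type*} [Fintype V] [Nonempty V] {G : Digraph V}

/-- Before the late rounds, the worst-case regret bound is of the order of `K / D ^ 2`. -/
theorem sqrt_le_of_not_lateRound (hK : 2 ≤ Fintype.card V) {D : ℝ} (hD : 0 < D) (hD1 : D ≤ 1)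
    {n : ℕ} (hn : Fintype.card V < n) (h : ¬ LateRound G D n) :
    Real.sqrt (strongIndepNum G * Real.log (Fintype.card V) * n) ≤
      1600 * Fintype.card V / D ^ 2
        * Real.log (6 * 320 ^ 2 * Fintype.card V ^ 2 / D ^ 4) := by
  have hn0 : (0 : ℝ) < n := by exact_mod_cast (by omega : 0 < n)
  have hl := one_le_log (t := n) (by omega)
  have hα : (1 : ℝ) ≤ strongIndepNum G := by exact_mod_cast one_le_strongIndepNum G
  have hαK : (strongIndepNum G : ℝ) ≤ Fintype.card V := by exact_mod_cast strongIndepNum_le_card G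
  have hK' : (2 : ℝ) ≤ Fintype.card V := by exact_mod_cast hK
  have hKn : (Fintype.card V : ℝ) ≤ n := by exact_mod_cast hn.le
  have hlK : Real.log 2 ≤ Real.log (Fintype.card V) := Real.log_le_log (by norm_num) hK'
  have hln : Real.log (Fintype.card V) ≤ Real.log n := Real.log_le_log (by linarith) hKn
  have hlog2 := Real.log_two_gt_d9
  have hlam : (tuning G).lam = strongIndepNum G := rfl
  unfold LateRound explCap at h
  rw [le_min_iff, hlam] at h
  set α : ℝ := (strongIndepNum G : ℝ)
  set K : ℝ := (Fintype.card V : ℝ)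
  set lK := Real.log K
  set l := Real.log n with hldef
  set y := K / D ^ 2 with hy
  have hDsq : D ^ 2 ≤ 1 := pow_le_one₀ hD.le hD1
  have hyK : K ≤ y := by
    rw [hy, le_div_iff₀ (by positivity)]; nlinarith
  have hB : Real.sqrt (α * lK * n) ≤ 640 * y * l := by
    rw [not_and_or, not_le, not_le] at h
    rcases h with h | h
    · rw [div_lt_div_iff₀ (by positivity) (by positivity)] at h
      have h1 : n ≤ 640 * y * l := by
        have : 640 * y * l = 640 * K * l / D ^ 2 := by rw [hy]; ring
        rw [this, le_div_iff₀ (by positivity)]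
        linarith
      rw [Real.sqrt_le_left (by positivity)]
      have h2 : α * lK ≤ y * l := mul_le_mul (hαK.trans hyK) hln (by linarith) (by linarith)
      have h3 : α * lK * n ≤ (y * l) * (640 * y * l) :=
        mul_le_mul h2 h1 hn0.le (by positivity)
      have h4 : 0 ≤ (y * l) ^ 2 := sq_nonneg _
      nlinarith
    · have h1 : Real.sqrt (α * lK / (n * K ^ 2)) = Real.sqrt (α * lK * n) / (n * K) := by
        rw [Real.sqrt_eq_iff_mul_self_eq (by positivity) (by positivity), div_mul_div_comm,
          Real.mul_self_sqrt (by positivity)]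
        field_simp
      rw [h1] at h
      have h2 : Real.sqrt (α * lK * n) / (n * K) < 640 * l / (n * D ^ 2) := by
        have : 640 * l / (n * D ^ 2) = 2 * (320 * l / (n * D ^ 2)) := by ring
        linarith
      rw [div_lt_iff₀ (by positivity)] at h2
      refine h2.le.trans (le_of_eq ?_)
      rw [hy]; field_simp
  set u := Real.sqrt (Real.sqrt n) with hu
  have hu0 : 0 < u := Real.sqrt_pos.2 (Real.sqrt_pos.2 hn0)
  have hu2 : u ^ 2 = Real.sqrt n := Real.sq_sqrt (Real.sqrt_nonneg _)
  have hu4 : u ^ 4 = n := by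
    have : u ^ 4 = (u ^ 2) ^ 2 := by ring
    rw [this, hu2, Real.sq_sqrt hn0.le]
  have hlu : l = 4 * Real.log u := by
    rw [hldef, ← hu4, Real.log_pow]; norm_num
  have hlu' : l ≤ 4 * u := by
    have := Real.log_le_sub_one_of_pos hu0
    linarith
  have hu3 : u ≤ 3085 * y := by
    have h1 : 0.83 * u ^ 2 ≤ Real.sqrt (α * lK * n) := by
      rw [hu2, Real.le_sqrt (by positivity) (by positivity), mul_pow, Real.sq_sqrt hn0.le]
      refine mul_le_mul_of_nonneg_right ?_ hn0.le
      nlinarith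
    have h2 : 640 * y * l ≤ 640 * y * (4 * u) := mul_le_mul_of_nonneg_left hlu' (by positivity)
    have h3 : 0.83 * u * u ≤ 2560 * y * u := by linarith
    have h4 := le_of_mul_le_mul_right h3 hu0
    linarith
  have hly : l ≤ 5 / 2 * Real.log (6 * 320 ^ 2 * K ^ 2 / D ^ 4) := by
    have e : 6 * 320 ^ 2 * K ^ 2 / D ^ 4 = 614400 * y ^ 2 := by rw [hy]; field_simp; norm_num
    rw [e]
    have h1 : u ^ 8 ≤ (614400 * y ^ 2) ^ 5 := by
      have h2 : u ^ 8 ≤ (3085 * y) ^ 8 := pow_le_pow_left₀ hu0.le hu3 8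
      have h3 : (1 : ℝ) ≤ y ^ 2 := one_le_pow₀ (by linarith)
      have h4 : (0 : ℝ) ≤ y ^ 8 := by positivity
      calc u ^ 8 ≤ (3085 * y) ^ 8 := h2
        _ = 3085 ^ 8 * (y ^ 8 * 1) := by ring
        _ ≤ 614400 ^ 5 * (y ^ 8 * y ^ 2) := by gcongr; norm_num
        _ = (614400 * y ^ 2) ^ 5 := by ring
    have h2 := Real.log_le_log (by positivity) h1
    rw [Real.log_pow, Real.log_pow] at h2
    push_cast at h2
    linarith
  refine hB.trans ?_
  have e : 1600 * K / D ^ 2 = 1600 * y := by rw [hy]; ring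
  rw [e]
  nlinarith [mul_le_mul_of_nonneg_left hly (by positivity : 0 ≤ 640 * y)]

end Horizon

theorem gapMin_spec {V Ω : Type*} [Fintype V] {mΩ : MeasurableSpace Ω}
    {P : Measure Ω} {loss : ℕ → Ω → V → ℝ} (h : ∃ i, 0 < gap P loss i) :
    (∃ i, 0 < gap P loss i ∧ gap P loss i = gapMin P loss) ∧
      ∀ i, 0 < gap P loss i → gapMin P loss ≤ gap P loss i := by
  have : Nonempty {i : V // 0 < gap P loss i} := ⟨⟨h.choose, h.choose_spec⟩⟩
  obtain ⟨i, hi⟩ := exists_eq_ciInf_of_finite (f := fun i : {i : V // 0 < gap P loss i} => gap P loss i.1)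
  exact ⟨⟨i.1, i.2, hi⟩, fun j hj => ciInf_le
    (f := fun i : {i : V // 0 < gap P loss i} => gap P loss i.1) (Set.finite_range _).bddBelow ⟨j, hj⟩⟩

end FeedbackGraph

theorem theorem2 {V Ω : Type*} [Fintype V] [Nonempty V] {mΩ : MeasurableSpace Ω}
    (G : Digraph V) (hloop : ∀ i, G.Adj i i)
    (P : Measure Ω) [IsProbabilityMeasure P] (𝓕 : Filtration ℕ mΩ)
    (loss : ℕ → Ω → V → ℝ) (hloss : FeedbackGraph.IsStochasticLoss P 𝓕 loss)
    (arm : ℕ → Ω → V) (S : ℕ → Ω → Finset V)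
    (hrun : FeedbackGraph.IsRun G (FeedbackGraph.tuning G) P 𝓕 loss arm S)
    (T : ℕ) (hT : 1 ≤ T) :
    FeedbackGraph.pseudoRegret P loss arm T ≤
      (⨆ A : FeedbackGraph.StrongIndepSets G,
        ∑ i ∈ A.1 with 0 < FeedbackGraph.gap P loss i,
          4 * 320 * Real.log T ^ 2 / FeedbackGraph.gap P loss i)
      + 2 * FeedbackGraph.strongIndepNum G * Real.log T
      + 81 * 320 * Fintype.card V / FeedbackGraph.gapMin P loss ^ 2
        * Real.log (6 * 320 ^ 2 * Fintype.card V ^ 2 / FeedbackGraph.gapMin P loss ^ 4)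
      + ∑ i with 0 < FeedbackGraph.gap P loss i,
          4 * FeedbackGraph.strongIndepNum G / FeedbackGraph.gap P loss i := by
  open FeedbackGraph in
  have hLT : 0 ≤ Real.log T := Real.log_nonneg (by exact_mod_cast hT)
  set L := Real.log T with hL
  set W : StrongIndepSets G → ℝ := fun A => ∑ i ∈ A.1 with 0 < gap P loss i, 1280 / gap P loss i
    with hW
  set M := ⨆ A, W A with hMdef
  have hWle : ∀ A (hA : A ∈ StrongIndepSets G),
      ∑ i ∈ A with 0 < gap P loss i, 1280 / gap P loss i ≤ M := fun A hA =>
    le_ciSup (f := W) (Set.finite_range _).bddAbove ⟨A, hA⟩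
  have hfirst : (⨆ A : StrongIndepSets G, ∑ i ∈ A.1 with 0 < gap P loss i,
      4 * 320 * L ^ 2 / gap P loss i) = M * L ^ 2 := by
    rw [hMdef, Real.iSup_mul_of_nonneg (sq_nonneg L)]
    congr 1
    ext A
    rw [hW, Finset.sum_mul]
    refine Finset.sum_congr rfl fun i _ => ?_
    ring
  rw [hfirst]
  have hlast : 0 ≤ ∑ i with 0 < gap P loss i, 4 * strongIndepNum G / gap P loss i :=
    Finset.sum_nonneg fun i hi => div_nonneg (by positivity) (gap_nonneg i)
  have hmid : 0 ≤ 2 * strongIndepNum G * L := by positivity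
  rw [pseudoRegret_eq_sum hloss hrun T]
  by_cases hpos : ∃ i, 0 < gap P loss i
  swap
  · push Not at hpos
    have h0 : ∀ i, gap P loss i = 0 := fun i => le_antisymm (hpos i) (gap_nonneg i)
    have hM0 : 0 ≤ M := by simpa using hWle ∅ (by simp [mem_strongIndepSets])
    have hD0 : gapMin P loss = 0 := by
      have : IsEmpty {i : V // 0 < gap P loss i} := ⟨fun i => (hpos i.1).not_gt i.2⟩
      exact Real.iInf_of_isEmpty _
    have h1 : ∑ t ∈ Finset.Icc 1 T, roundRegret P loss arm t = 0 :=
      Finset.sum_eq_zero fun t _ => by simp [roundRegret, h0]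
    rw [h1, hD0]
    have : 0 ≤ M * L ^ 2 := by positivity
    simp only [ne_eq, OfNat.ofNat_ne_zero, not_false_eq_true, zero_pow, div_zero, zero_mul]
    linarith
  obtain ⟨⟨m, hm, hmD⟩, hDgap⟩ := gapMin_spec hpos
  obtain ⟨k, hk⟩ := exists_meanLoss_eq_iInf (P := P) (loss := loss)
  have hD1 : gapMin P loss ≤ 1 := hmD ▸ gap_le_one hloss m
  have hD : 0 < gapMin P loss := hmD ▸ hm
  set D := gapMin P loss with hDdef
  have hK : 2 ≤ Fintype.card V := by
    have hkm : k ≠ m := by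
      rintro rfl
      rw [gap_eq, hk, sub_self] at hm
      exact lt_irrefl 0 hm
    exact Fintype.one_lt_card_iff.2 ⟨k, m, hkm⟩
  have hMD : 1280 / D ≤ M := by
    have := hWle {m} (by rw [mem_strongIndepSets]; grind)
    rwa [Finset.filter_singleton, if_pos hm, Finset.sum_singleton, hmD] at this
  have hM0 : 0 < M := lt_of_lt_of_le (by positivity) hMD
  have hK' : (2 : ℝ) ≤ Fintype.card V := by exact_mod_cast hK
  have hDsq : D ^ 2 ≤ 1 := pow_le_one₀ hD.le hD1
  have hKy : (Fintype.card V : ℝ) ≤ Fintype.card V / D ^ 2 := by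
    rw [le_div_iff₀ (by positivity)]; nlinarith
  set Lg := Real.log (6 * 320 ^ 2 * Fintype.card V ^ 2 / D ^ 4) with hLg
  have hLg1 : 1 ≤ Lg := by
    rw [hLg, Real.le_log_iff_exp_le (by positivity)]
    have h1 := Real.exp_one_lt_d9
    have h2 : (6 * 320 ^ 2 * Fintype.card V ^ 2 / D ^ 4 : ℝ)
        = 614400 * (Fintype.card V / D ^ 2) ^ 2 := by field_simp; norm_num
    rw [h2]
    nlinarith
  set y := (Fintype.card V : ℝ) / D ^ 2 with hy
  have hthird : 81 * 320 * (Fintype.card V : ℝ) / D ^ 2 * Lg = 25920 * (y * Lg) := by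
    rw [hy]; ring
  rw [hthird]
  have hyLg : (Fintype.card V : ℝ) ≤ y * Lg := by nlinarith
  have hinit : ∀ n, ∑ t ∈ Finset.Icc 1 n, roundRegret P loss arm t ≤ n := fun n => by
    refine (Finset.sum_le_card_nsmul _ _ 1 fun t ht =>
      roundRegret_le_one hloss hrun (Finset.mem_Icc.1 ht).1).trans ?_
    simp
  rcases le_or_gt T (Fintype.card V) with hTK | hTK
  · have h1 := hinit T
    have h2 : (T : ℝ) ≤ Fintype.card V := by exact_mod_cast hTK
    have h3 : 0 ≤ M * L ^ 2 := by positivity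
    linarith
  classical
  obtain ⟨n, hn, hnmax⟩ := ((Finset.Icc (Fintype.card V) T).filter
    fun t => t = Fintype.card V ∨ ¬ LateRound G D t).exists_max_image id
    ⟨Fintype.card V, by simp [hTK.le]⟩
  simp only [Finset.mem_filter, Finset.mem_Icc, id_eq, and_imp] at hn hnmax
  have hlate : ∀ t, n < t → t ≤ T → LateRound G D t := by
    intro t hnt htT
    by_contra hcon
    exact absurd (hnmax t (by omega) htT (Or.inr hcon)) (by omega)
  have hsplit : ∑ t ∈ Finset.Icc 1 T, roundRegret P loss arm t
      = ∑ t ∈ Finset.Icc 1 (Fintype.card V), roundRegret P loss arm t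
        + ∑ t ∈ Finset.Ioc (Fintype.card V) n, roundRegret P loss arm t
        + ∑ t ∈ Finset.Ioc n T, roundRegret P loss arm t := by
    have e : ∀ r, Finset.Icc 1 r = Finset.Ioc 0 r := fun r => by ext; simp; omega
    rw [e, e, Finset.sum_Ioc_consecutive _ (Nat.zero_le _) hn.1.1,
      Finset.sum_Ioc_consecutive _ (Nat.zero_le _) hn.1.2]
  have hearly : ∑ t ∈ Finset.Ioc (Fintype.card V) n, roundRegret P loss arm t
      ≤ 6400 * (y * Lg) := by
    rcases hn.1.1.eq_or_lt with h | h
    · rw [← h]; simp; linarith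
    · have h1 := sum_integral_runProb_le hK hloop hloss hrun h
      have h2 := sqrt_le_of_not_lateRound hK hD hD1 h (hn.2.resolve_left (by omega))
      rw [Finset.sum_congr rfl fun t ht =>
        roundRegret_eq hloss hrun (Finset.mem_Ioc.1 ht).1]
      refine h1.trans ?_
      have e : 1600 * (Fintype.card V : ℝ) / D ^ 2 * Lg = 1600 * (y * Lg) := by rw [hy]; ring
      rw [← hLg, e] at h2
      linarith
  have hlateSum : ∑ t ∈ Finset.Ioc n T, roundRegret P loss arm t
      ≤ (M * L + 110 / D) * (L - Real.log n) := by
    refine le_trans (Finset.sum_le_sum (g := fun t : ℕ => (M * L + 110 / D) * (1 / (t : ℝ)))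
      fun t ht => ?_) ?_
    · rw [Finset.mem_Ioc] at ht
      rw [roundRegret_eq hloss hrun (by omega)]
      obtain ⟨t, rfl⟩ : ∃ r, t = r + 1 := ⟨t - 1, by omega⟩
      refine (late_round_le hK hloop hloss hrun hD hD1 hDgap hWle (by omega)
        (hlate _ ht.1 ht.2) hk).trans ?_
      rw [add_mul, mul_div_assoc, div_eq_mul_one_div, ← mul_assoc]
      have : Real.log (t + 1 : ℕ) ≤ L :=
        Real.log_le_log (by positivity) (by exact_mod_cast ht.2)
      gcongr
    · rw [← Finset.mul_sum]
      have := sum_one_div_le_log (m := n) (n := T) (by omega) hn.1.2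
      gcongr
  have hlogn : 0.69 ≤ Real.log n := by
    have h1 := Real.log_two_gt_d9
    have h2 : Real.log 2 ≤ Real.log n :=
      Real.log_le_log (by norm_num) (by exact_mod_cast hK.trans hn.1.1)
    linarith
  have habsorb : (M * L + 110 / D) * (L - Real.log n) ≤ M * L ^ 2 := by
    have h1 : 110 / D * L ≤ 0.69 * M * L := by
      refine mul_le_mul_of_nonneg_right ?_ hLT
      have : 110 / D = 110 / 1280 * (1280 / D) := by ring
      rw [this]
      linarith
    have h2 : 0.69 * (M * L) ≤ Real.log n * (M * L) :=
      mul_le_mul_of_nonneg_right hlogn (by positivity)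
    have h3 : 0 ≤ 110 / D * Real.log n := by positivity
    linarith
  have h1 := hinit (Fintype.card V)
  rw [hsplit]
  linarith
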